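/- **Setting.** Let $1\le p<\infty$, $0<\theta<p$, and let $(\Omega,d,\mu)$ be an unbounded, locally compact, non-complete metric space with a Borel regular measure $\mu$ that is doubling: balls have positive finite measure and $\mu(B(x,2r))\le C\mu(B(x,r))$ for all $x\in\Omega$, $r>0$. Let $\overline\Omega$ be the metric completion of $\Omega$, $\partial\Omega=\overline\Omega\setminus\Omega$ and $d_\Omega(x)=\operatorname{dist}(x,\partial\Omega)$. *Sobolev space.* A Borel function $g:\Omega\to[0,\infty]$ is an upper gradient of $u:\Omega\to\mathbb R$ if $|u(y)-u(x)|\le\int_\gamma g\,ds$ for every rectifiable curve $\gamma$ joining $x$ to $y$; it is a $p$-weak upper gradient if there is a Borel function $\rho:\Omega\to[0,\infty]$ with $\int_\Omega\rho^p\,d\mu<\infty$ and $\int_\gamma\rho\,ds=\infty$ for every $\gamma$ for which this inequality fails. $D^{1,p}(\Omega)$ is the space of $\mu$-measurable $u:\Omega\to\mathbb R$ for which the seminorm $\|u\|_{D^{1,p}}=\inf_g\|g\|_{L^p(\mu)}$, the infimum being over all $p$-weak upper gradients $g$ of $u$, is finite. *Besov space.* For a Borel regular measure $\nu$ on $\partial\Omega$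 and $\alpha>0$, $HB^{\alpha}_{p,p}(\partial\Omega)$ is the space of ($\nu$-a.e. equivalence classes of) $f\in L^p_{\rm loc}(\partial\Omega,\nu)$ with $$\|f\|_{HB^\alpha_{p,p}}=\left(\int_0^\infty\int_{\partial\Omega}\frac{1}{\nu(B(y,r)\cap\partial\Omega)}\int_{B(y,r)\cap\partial\Omega}\frac{|f(y)-f(x)|^p}{r^{\alpha p}}\,d\nu(x)\,d\nu(y)\,\frac{dr}{r}\right)^{1/p}<\infty .$$ *Assumptions.* Assume that: 1. $(\Omega,d,\mu)$ supports a $p$-Poincaré inequality: there are $C>0$ and $\lambda\ge1$ such that for every ball $B=B(x,r)$ in $\Omega$, every $u\in D^{1,p}(\Omega)$ and every upper gradient $g$ of $u$, $\frac{1}{\mu(B)}\int_B|u-u_B|\,d\mu\le C\,r\,\Bigl(\frac{1}{\mu(\lambda B)}\int_{\lambda B}g^p\,d\mu\Bigr)^{1/p}$, where $u_B=\frac1{\mu(B)}\int_Bu\,d\mu$ and $\lambda B=B(x,\lambda r)$ (the left-hand side is read as $\infty$ if $u$ is not integrable on $B$). 2. $\Omega$ is uniform in $\overline\Omega$: there is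 $A\ge1$ such that any $x,y\in\Omega$ can be joined by a curve $\gamma$ in $\Omega$ with $\ell(\gamma)\le A\,d(x,y)$ and $\min\{\ell(\gamma_{x,z}),\ell(\gamma_{z,y})\}\le A\,d_\Omega(z)$ for each point $z$ on $\gamma$, where $\gamma_{x,z}$ and $\gamma_{z,y}$ are the subcurves of $\gamma$ into which $z$ divides it. 3. $\partial\Omega$ is unbounded and carries a non-atomic Borel regular measure $\nu$ that is $\theta$-codimensional to $\mu$: there is $C\ge1$ such that for all $\zeta\in\partial\Omega$ and $r>0$, $$\frac1C\,\nu(B(\zeta,r)\cap\partial\Omega)\le\frac{\mu(B(\zeta,r)\cap\Omega)}{r^\theta}\le C\,\nu(B(\zeta,r)\cap\partial\Omega).$$ **Theorem.** There are a bounded linear trace operator $T:D^{1,p}(\Omega)\to HB^{1-\theta/p}_{p,p}(\partial\Omega)$ and a bounded linear extension operator $E:HB^{1-\theta/p}_{p,p}(\partial\Omega)\to D^{1,p}(\Omega)$ such that: * for every $u\in D^{1,p}(\Omega)$, $\displaystyle\lim_{r\to0^+}\frac{1}{\mu(B(\zeta,r)\cap\Omega)}\int_{B(\zeta,r)\cap\Omega}|u-Tu(\zeta)|\,d\mu=0$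 for $\nu$-a.e. $\zeta\in\partial\Omega$; * $T\circ E$ is the identity on $HB^{1-\theta/p}_{p,p}(\partial\Omega)$; * $E$ is given by a Whitney partition of unity: there are a cover of $\Omega$ by countably many balls $B_i=B(x_i,r_i)$ with $r_i=\tfrac18d_\Omega(x_i)$ and $\sup_{\Omega}\sum_i\chi_{2B_i}<\infty$, a constant $C$, functions $\varphi_i:\Omega\to\mathbb R$ with $0\le\varphi_i\le\chi_{2B_i}$, $\sum_i\varphi_i=1$ on $\Omega$ and $\varphi_i$ being $C/r_i$-Lipschitz, and points $\hat x_i\in\partial\Omega$ with $d(x_i,\hat x_i)=d_\Omega(x_i)$, such that for all $f\in HB^{1-\theta/p}_{p,p}(\partial\Omega)$ and all $x\in\Omega$, $$Ef(x)=\sum_i\left(\frac{1}{\nu(U_i)}\int_{U_i}f\,d\nu\right)\varphi_i(x),\qquad U_i=B(\hat x_i,r_i)\cap\partial\Omega .$$ -/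

import Mathlib

open MeasureTheory Set Filter Topology
open scoped ENNReal NNReal

namespace MetricTrace

section Curves

variable {Z : Type*} [PseudoMetricSpace Z]

/-- A compact rectifiable curve, in its arc-length parametrization on `[0, length]`.
Only the values of `toFun` on `[0, length]` matter. -/
structure RectifiableCurve (Z : Type*) [PseudoMetricSpace Z] where
  /-- the length of the curve -/
  length : ℝ
  /-- the arc-length parametrization -/
  toFun : ℝ → Z
  length_nonneg : 0 ≤ length
  unitSpeed : HasUnitSpeedOn toFun (Icc 0 length)

/-- The initial point of a rectifiable curve. -/
def RectifiableCurve.source (γ : RectifiableCurve Z) : Z := γ.toFun 0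

/-- The terminal point of a rectifiable curve. -/
def RectifiableCurve.target (γ : RectifiableCurve Z) : Z := γ.toFun γ.length

/-- The line integral `∫_γ g ds`. -/
noncomputable def RectifiableCurve.lineIntegral (γ : RectifiableCurve Z) (g : Z → ℝ≥0∞) : ℝ≥0∞ :=
  ∫⁻ t in Icc 0 γ.length, g (γ.toFun t)

end Curves

section Sobolev

variable {Z : Type*} [PseudoMetricSpace Z] [MeasurableSpace Z]

/-- The upper gradient inequality for the pair `(u, g)` along the curve `γ`. -/
def UpperGradientInequality (u : Z → ℝ) (g : Z → ℝ≥0∞) (γ : RectifiableCurve Z) : Prop :=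
  ‖u γ.target - u γ.source‖ₑ ≤ γ.lineIntegral g

/-- `g` is an upper gradient of `u`. -/
def IsUpperGradient (u : Z → ℝ) (g : Z → ℝ≥0∞) : Prop :=
  Measurable g ∧ ∀ γ : RectifiableCurve Z, UpperGradientInequality u g γ

/-- The family `Γ` of rectifiable curves has `p`-modulus zero. -/
def HasModulusZero (p : ℝ) (μ : Measure Z) (Γ : Set (RectifiableCurve Z)) : Prop :=
  ∃ ρ : Z → ℝ≥0∞, Measurable ρ ∧ ∫⁻ x, ρ x ^ p ∂μ < ∞ ∧ ∀ γ ∈ Γ, γ.lineIntegral ρ = ∞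

/-- `g` is a `p`-weak upper gradient of `u`. -/
def IsWeakUpperGradient (p : ℝ) (μ : Measure Z) (u : Z → ℝ) (g : Z → ℝ≥0∞) : Prop :=
  Measurable g ∧ HasModulusZero p μ {γ | ¬ UpperGradientInequality u g γ}

/-- The Dirichlet seminorm of `u`: the smallest `L^p`-norm of a `p`-weak upper gradient of `u`
(it is infinite if no `p`-weak upper gradient is `p`-integrable). -/
noncomputable def dirichletSeminorm (p : ℝ) (μ : Measure Z) (u : Z → ℝ) : ℝ≥0∞ :=
  ⨅ (g : Z → ℝ≥0∞) (_ : IsWeakUpperGradient p μ u g), (∫⁻ x, g x ^ p ∂μ) ^ (1 / p)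

/-- The Dirichlet-Sobolev space `D^{1,p}(Z)`. -/
def dirichletSpace (p : ℝ) (μ : Measure Z) : Set (Z → ℝ) :=
  {u | AEMeasurable u μ ∧ dirichletSeminorm p μ u < ∞}

/-- `μ` is a doubling measure: balls have positive finite measure, and doubling the radius
increases the measure by at most a constant factor. -/
def IsDoubling (μ : Measure Z) : Prop :=
  (∀ (z : Z) (r : ℝ), 0 < r → 0 < μ (Metric.ball z r) ∧ μ (Metric.ball z r) < ∞) ∧
  ∃ C : ℝ≥0, ∀ (z : Z) (r : ℝ), 0 < r → μ (Metric.ball z (2 * r)) ≤ C * μ (Metric.ball z r)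

/-- `(Z, μ)` supports a `p`-Poincaré inequality. The left-hand side is a lower Lebesgue integral,
so it is infinite if `u` is not integrable on the ball. -/
def SupportsPoincare (p : ℝ) (μ : Measure Z) : Prop :=
  ∃ C lam : ℝ, 0 < C ∧ 1 ≤ lam ∧
    ∀ u ∈ dirichletSpace p μ, ∀ g : Z → ℝ≥0∞, IsUpperGradient u g →
      ∀ (z : Z) (r : ℝ), 0 < r →
        ⨍⁻ x in Metric.ball z r, ‖u x - ⨍ y in Metric.ball z r, u y ∂μ‖ₑ ∂μ ≤
          ENNReal.ofReal (C * r) * (⨍⁻ x in Metric.ball z (lam * r), g x ^ p ∂μ) ^ (1 / p)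

end Sobolev

section Besov

variable {Z : Type*} [PseudoMetricSpace Z] [MeasurableSpace Z]

/-- The homogeneous Besov seminorm `‖f‖_{HB^α_{p,p}}`. -/
noncomputable def besovSeminorm (α p : ℝ) (ν : Measure Z) (f : Z → ℝ) : ℝ≥0∞ :=
  (∫⁻ r in Ioi (0 : ℝ),
    (∫⁻ y, ⨍⁻ x in Metric.ball y r, ‖f y - f x‖ₑ ^ p / ENNReal.ofReal (r ^ (α * p)) ∂ν ∂ν)
      / ENNReal.ofReal r) ^ (1 / p)

/-- The homogeneous Besov space `HB^α_{p,p}(Z)`: classes of `ν`-a.e. equal functions that are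
locally in `L^p` and have finite Besov seminorm. -/
def besovSpace (α p : ℝ) (ν : Measure Z) : Set (Z →ₘ[ν] ℝ) :=
  {f | (∀ z, ∃ U ∈ 𝓝 z, MemLp f (ENNReal.ofReal p) (ν.restrict U)) ∧ besovSeminorm α p ν f < ∞}

end Besov

section Boundary

variable (Ω : Type*) [MetricSpace Ω]

/-- The boundary of `Ω` in its metric completion. -/
def boundary : Set (UniformSpace.Completion Ω) :=
  (range ((↑) : Ω → UniformSpace.Completion Ω))ᶜ

variable {Ω}

/-- The distance `d_Ω(x)` from a point of `Ω` to the boundary. -/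
noncomputable def bdryDist (x : Ω) : ℝ :=
  Metric.infDist (x : UniformSpace.Completion Ω) (boundary Ω)

/-- The trace `B(ζ, r) ∩ Ω` on `Ω` of a ball centred at a boundary point. -/
def innerBall (ζ : boundary Ω) (r : ℝ) : Set Ω :=
  {x | dist (x : UniformSpace.Completion Ω) ζ < r}

variable (Ω) in
/-- `Ω` is a uniform domain in its completion. Since curves are parametrized by arc length, the
two pieces into which the point `γ t` divides `γ` have lengths `t` and `γ.length - t`. -/
def IsUniformDomain : Prop :=
  ∃ A : ℝ, 1 ≤ A ∧ ∀ x y : Ω, ∃ γ : RectifiableCurve Ω, γ.source = x ∧ γ.target = y ∧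
    γ.length ≤ A * dist x y ∧
    ∀ t ∈ Icc 0 γ.length, min t (γ.length - t) ≤ A * bdryDist (γ.toFun t)

/-- The measure `ν` on the boundary is `θ`-codimensional to the measure `μ` on `Ω`. -/
def IsCodimensional [MeasurableSpace Ω] [MeasurableSpace (boundary Ω)]
    (θ : ℝ) (μ : Measure Ω) (ν : Measure (boundary Ω)) : Prop :=
  ∃ C : ℝ, 1 ≤ C ∧ ∀ (ζ : boundary Ω) (r : ℝ), 0 < r →
    ENNReal.ofReal (1 / C) * ν (Metric.ball ζ r) ≤ μ (innerBall ζ r) / ENNReal.ofReal (r ^ θ) ∧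
    μ (innerBall ζ r) / ENNReal.ofReal (r ^ θ) ≤ ENNReal.ofReal C * ν (Metric.ball ζ r)

/-- The radius of a Whitney ball centred at `x`. -/
noncomputable def whitneyRadius (x : Ω) : ℝ := bdryDist x / 8

variable (Ω) in
/-- A Whitney cover of `Ω` by countably many balls `B(x, d_Ω(x)/8)`, indexed by their centres,
with a Lipschitz partition of unity subordinate to the doubled balls and a choice of a nearest
boundary point for each centre. -/
structure WhitneyPartition where
  /-- the centres of the Whitney balls -/
  centers : Set Ω
  countable_centers : centers.Countable
  cover : ∀ y : Ω, ∃ x ∈ centers, y ∈ Metric.ball x (whitneyRadius x)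
  bounded_overlap : ∃ N : ℕ, ∀ y : Ω,
    {x | x ∈ centers ∧ y ∈ Metric.ball x (2 * whitneyRadius x)}.encard ≤ N
  /-- the partition of unity -/
  φ : centers → Ω → ℝ
  φ_nonneg : ∀ x y, 0 ≤ φ x y
  φ_le : ∀ x y, φ x y ≤ (Metric.ball (x : Ω) (2 * whitneyRadius (x : Ω))).indicator 1 y
  φ_sum : ∀ y, ∑ᶠ x, φ x y = 1
  φ_lipschitz : ∃ C : ℝ, ∀ x y z, |φ x y - φ x z| ≤ C / whitneyRadius (x : Ω) * dist y z
  /-- a closest boundary point of each centre -/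
  nearest : centers → boundary Ω
  dist_nearest : ∀ x : centers,
    dist ((x : Ω) : UniformSpace.Completion Ω) (nearest x) = bdryDist (x : Ω)

/-- The extension `∑ₓ f_{U_x} φ_x` of `f`, where `f_{U_x}` is the mean of `f` over the boundary
ball `U_x` centred at the chosen nearest point, with the radius of the Whitney ball at `x`. The sum
is locally finite. -/
noncomputable def WhitneyPartition.extend [MeasurableSpace (boundary Ω)] (W : WhitneyPartition Ω)
    (ν : Measure (boundary Ω)) (f : boundary Ω → ℝ) (y : Ω) : ℝ :=
  ∑ᶠ x : W.centers,
    (⨍ ζ in Metric.ball (W.nearest x) (whitneyRadius (x : Ω)), f ζ ∂ν) * W.φ x y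

end Boundary

/-- On the set `D`, which is closed under addition and scalar multiplication, `T` is linear, takes
values in `H` and is bounded with respect to the seminorms `N` and `M`. The values of `T` outside
`D` do not matter. -/
structure IsBoundedLinear {V W : Type*} [AddCommGroup V] [Module ℝ V] [AddCommGroup W] [Module ℝ W]
    (D : Set V) (N : V → ℝ≥0∞) (H : Set W) (M : W → ℝ≥0∞) (T : V → W) : Prop where
  mapsTo : MapsTo T D H
  map_add : ∀ u ∈ D, ∀ v ∈ D, u + v ∈ D ∧ T (u + v) = T u + T v
  map_smul : ∀ (c : ℝ), ∀ u ∈ D, c • u ∈ D ∧ T (c • u) = c • T u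
  bound : ∃ C : ℝ≥0, ∀ u ∈ D, M (T u) ≤ C * N u

end MetricTrace

open MetricTrace

set_option linter.unusedSectionVars false

/-! Trace. Let `u` have an upper gradient `g` in `L^p`. The Poincaré inequality bounds the mean
oscillation of `u` on B(ζ, s), and the change of its mean from B(ζ, s) to B(ζ, s/2), by a constant
times the p-th root of s^p μ(B(ζ, s))⁻¹ ∫ g^p over B(ζ, Λs); this energy is `bdryEnergy`. Since
μ(B(ζ, s)) is comparable to s^θ ν(B(ζ, s)), Fubini bounds its ν-integral by a constant times s^(p-θ)
∫ g^p (`lintegral_bdryEnergy_le`). Because θ < p, this decays geometrically along s = 2^(-k) r. Half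
of the decay is spent on weights q^(-k), with q = 2^(-(p-θ)/2), which allow a sum of p-th roots to
be replaced by a single p-th root (`tsum_rpow_le`). Hence the dyadic means converge ν-a.e., and
their limit is the trace (`exists_trace`).

For the Besov bound full balls are too wasteful: a point of Ω would be counted at every scale above
its distance to the boundary, and dr/r has infinite mass there. Instead, corkscrew points at
consecutive scales are joined by uniform curves, and the Poincaré inequality is chained along balls
that stay where the distance to the boundary is comparable to the scale
(`TraceSetting.exists_average_sub_le`, `exists_trace_sub_average_le`). After integration over the
boundary the factor r^(p-θ) cancels the Besov weight r^(-αp), α = 1 - θ/p, and each point of Ω is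
seen only for r in an interval of bounded ratio, whose dr/r-mass is bounded (`lintegral_layer_le`,
`besovSeminorm_trace_le`).

Extension. Near `w`, `Ef` is a partition-of-unity average of means of `f` over boundary balls of
size and distance comparable to d_Ω(w). Its local Lipschitz constant is therefore controlled by
differences of such means, hence by `oscEnergy`, the part of the Besov integrand at scales and
places comparable to `w` (`exists_extend_sub_le`). A local Lipschitz bound of this kind is an upper
gradient, and Fubini with the codimension relation turns the μ-integral of `oscEnergy` into the p-th
power of the Besov seminorm (`lintegral_oscEnergy_le`).

Inverse. Finiteness of the Besov seminorm makes the dyadic mean oscillations of `f` about `f ζ`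
summable at ν-a.e. ζ (`ae_tendsto_ballOsc`). On corkscrew balls approaching ζ the extension is
within such an oscillation of `f ζ`, while its means there converge to its trace; so the trace is `f
ζ` (`eq_of_hasTraceAt_extend`). -/

namespace MetricTrace

/-! ### Traces on Ω of balls of the completion. -/

section InteriorBalls

variable {Ω : Type*} [MetricSpace Ω]

/-- The trace on `Ω` of a ball of the completion. -/
def iball (a : UniformSpace.Completion Ω) (r : ℝ) : Set Ω :=
  {x | dist (x : UniformSpace.Completion Ω) a < r}

theorem iball_coe (x : Ω) (r : ℝ) : iball (x : UniformSpace.Completion Ω) r = Metric.ball x r := by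
  ext y; simp [iball, UniformSpace.Completion.dist_eq]

theorem iball_subset {a b : UniformSpace.Completion Ω} {r s : ℝ} (h : dist a b + r ≤ s) :
    iball a r ⊆ iball b s := by
  intro x hx
  simp only [iball, mem_ofPred_eq] at *
  linarith [dist_triangle (x : UniformSpace.Completion Ω) a b]

theorem isOpen_iball (a : UniformSpace.Completion Ω) (r : ℝ) : IsOpen (iball a r) :=
  isOpen_lt ((UniformSpace.Completion.continuous_coe Ω).dist continuous_const) continuous_const

theorem exists_coe_near (a : UniformSpace.Completion Ω) {r : ℝ} (hr : 0 < r) :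
    ∃ x : Ω, dist (x : UniformSpace.Completion Ω) a < r := by
  obtain ⟨y, hy, x, rfl⟩ := (UniformSpace.Completion.denseRange_coe (α := Ω)).inter_open_nonempty
    (Metric.ball a r) Metric.isOpen_ball ⟨a, Metric.mem_ball_self hr⟩
  exact ⟨x, hy⟩

end InteriorBalls

/-! ### Doubling: comparable balls, packing, properness of the completion. -/

section Doubling

variable {Ω : Type*} [MetricSpace Ω] [MeasurableSpace Ω] {μ : Measure Ω}

theorem IsDoubling.ball_le (hμ : IsDoubling μ) (K : ℝ) :
    ∃ C : ℝ≥0, ∀ (x : Ω) (r s : ℝ), 0 < r → s ≤ K * r →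
      μ (Metric.ball x s) ≤ C * μ (Metric.ball x r) := by
  obtain ⟨-, C, hC⟩ := hμ
  obtain ⟨n, hn⟩ := pow_unbounded_of_one_lt K (one_lt_two)
  have key : ∀ (n : ℕ) (x : Ω) (r : ℝ), 0 < r →
      μ (Metric.ball x (2 ^ n * r)) ≤ (C : ℝ≥0∞) ^ n * μ (Metric.ball x r) := by
    intro n
    induction n with
    | zero => intro x r _; simp
    | succ n ih =>
      intro x r hr
      calc μ (Metric.ball x (2 ^ (n + 1) * r)) = μ (Metric.ball x (2 * (2 ^ n * r))) := by
            congr 2; ring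
        _ ≤ C * μ (Metric.ball x (2 ^ n * r)) := hC _ _ (by positivity)
        _ ≤ C * ((C : ℝ≥0∞) ^ n * μ (Metric.ball x r)) := by gcongr; exact ih x r hr
        _ = _ := by ring
  refine ⟨C ^ n, fun x r s hr hs => ?_⟩
  calc μ (Metric.ball x s) ≤ μ (Metric.ball x (2 ^ n * r)) :=
        measure_mono (Metric.ball_subset_ball (hs.trans (by gcongr)))
    _ ≤ _ := by simpa using key n x r hr

theorem measurableSet_iball [BorelSpace Ω] (a : UniformSpace.Completion Ω) (r : ℝ) :
    MeasurableSet (iball a r) := (isOpen_iball a r).measurableSet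

theorem IsDoubling.iball_pos (hμ : IsDoubling μ) (a : UniformSpace.Completion Ω) {r : ℝ}
    (hr : 0 < r) : 0 < μ (iball a r) := by
  obtain ⟨x, hx⟩ := exists_coe_near a (half_pos hr)
  refine (hμ.1 x (r / 2) (half_pos hr)).1.trans_le (measure_mono ?_)
  rw [← iball_coe]
  exact iball_subset (by linarith)

theorem IsDoubling.iball_lt_top (hμ : IsDoubling μ) (a : UniformSpace.Completion Ω) (r : ℝ) :
    μ (iball a r) < ∞ := by
  obtain ⟨x, hx⟩ := exists_coe_near a one_pos
  refine (measure_mono ?_).trans_lt (hμ.1 x (max (1 + r) 1) (by positivity)).2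
  rw [← iball_coe]
  refine iball_subset (le_trans ?_ (le_max_left _ _))
  rw [dist_comm]; linarith

/-- Traces of comparable balls of the completion have comparable measure. -/
theorem IsDoubling.iball_le (hμ : IsDoubling μ) (K : ℝ) :
    ∃ C : ℝ≥0, ∀ (a b : UniformSpace.Completion Ω) (r s : ℝ), 0 < r → dist a b + s ≤ K * r →
      μ (iball b s) ≤ C * μ (iball a r) := by
  -- A point `x` of Ω within `r / 2` of `a` serves as centre, and `(2 * K + 1) * (r / 2) = K * r + r
  -- / 2`.
  obtain ⟨C, hC⟩ := hμ.ball_le (2 * K + 1)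
  refine ⟨C, fun a b r s hr h => ?_⟩
  obtain ⟨x, hx⟩ := exists_coe_near a (half_pos hr)
  calc μ (iball b s) ≤ μ (Metric.ball x (K * r + r / 2)) := by
        rw [← iball_coe]
        refine measure_mono (iball_subset ?_)
        have := dist_triangle b a x
        rw [dist_comm b a, dist_comm a x] at this
        linarith
    _ ≤ C * μ (Metric.ball x (r / 2)) := hC _ _ _ (half_pos hr) (by linarith)
    _ ≤ C * μ (iball a r) := by
        rw [← iball_coe]
        gcongr
        exact iball_subset (by linarith)

/-- A separated subset of a ball has a bounded number of elements. -/
theorem IsDoubling.encard_le_of_separated [BorelSpace Ω] (hμ : IsDoubling μ) (K : ℝ) :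
    ∃ N : ℕ, ∀ (x : Ω) (r : ℝ), 0 < r → ∀ S : Set Ω, S ⊆ Metric.ball x (K * r) →
      (∀ y ∈ S, ∀ z ∈ S, y ≠ z → r ≤ dist y z) → S.encard ≤ N := by
  obtain ⟨C, hC⟩ := hμ.iball_le (4 * (|K| + 1))
  obtain ⟨N, hN⟩ := exists_nat_ge C
  refine ⟨N, fun x r hr S hS hsep => ?_⟩
  -- Volume count: the balls of radius `r / 2` about the points of `t` are disjoint, lie in `B`, and
  -- each carries at least a fixed fraction of the measure of `B`.
  have fin : ∀ t : Finset Ω, (t : Set Ω) ⊆ S → t.card ≤ N := by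
    intro t ht
    rcases t.eq_empty_or_nonempty with rfl | ⟨w, hw⟩
    · simp
    have hKr : K * r ≤ |K| * r := by gcongr; exact le_abs_self K
    have hpos : 0 < |K| * r + r := by positivity
    set B := Metric.ball x (|K| * r + r) with hB
    have hBpos := (hμ.1 x _ hpos).1
    have hBfin := (hμ.1 x _ hpos).2
    have h1 : ∑ y ∈ t, μ (Metric.ball y (r / 2)) ≤ μ B := by
      rw [← measure_biUnion_finset]
      · refine measure_mono (iUnion₂_subset fun y hy => ?_)
        refine Metric.ball_subset_ball' ?_
        have := Metric.mem_ball.1 (hS (ht hy))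
        linarith
      · intro y hy z hz hyz
        refine Metric.ball_disjoint_ball ?_
        linarith [hsep y (ht hy) z (ht hz) hyz]
      · exact fun y _ => measurableSet_ball
    have h2 : ∀ y ∈ t, μ B ≤ C * μ (Metric.ball y (r / 2)) := by
      intro y hy
      have := hC y x (r / 2) (|K| * r + r) (half_pos hr) (by
        have := Metric.mem_ball.1 (hS (ht hy))
        rw [UniformSpace.Completion.dist_eq]
        nlinarith [abs_nonneg K])
      rwa [iball_coe, iball_coe] at this
    have h3 : (t.card : ℝ≥0∞) * μ B ≤ N * μ B := by
      calc (t.card : ℝ≥0∞) * μ B = ∑ y ∈ t, μ B := by simp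
        _ ≤ ∑ y ∈ t, C * μ (Metric.ball y (r / 2)) := Finset.sum_le_sum h2
        _ = C * ∑ y ∈ t, μ (Metric.ball y (r / 2)) := by rw [Finset.mul_sum]
        _ ≤ N * μ B := by gcongr; exact_mod_cast hN
    have := (ENNReal.mul_le_mul_iff_left hBpos.ne' hBfin.ne).1 h3
    exact_mod_cast this
  by_contra! hlt
  obtain ⟨t, htS, ht⟩ := Set.exists_subset_encard_eq (Order.add_one_le_of_lt hlt)
  have hfin : t.Finite := Set.finite_of_encard_eq_coe (k := N + 1) (by exact_mod_cast ht)
  have := fin hfin.toFinset (by simpa using htS)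
  have h5 : (hfin.toFinset.card : ℕ∞) = N + 1 := by
    rw [← Set.encard_coe_eq_coe_finsetCard]; simpa using ht
  have h6 : hfin.toFinset.card = N + 1 := by exact_mod_cast h5
  omega

theorem IsDoubling.totallyBounded_ball [BorelSpace Ω] (hμ : IsDoubling μ) (x : Ω) (R : ℝ) :
    TotallyBounded (Metric.ball x R) := by
  rw [Metric.totallyBounded_iff]
  intro ε hε
  obtain ⟨N, hN⟩ := hμ.encard_le_of_separated (2 * R / ε)
  let δ : ℝ≥0 := ⟨ε / 2, by positivity⟩
  have hδ : (δ : ℝ) = ε / 2 := rfl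
  have hpack : Metric.packingNumber δ (Metric.ball x R) ≤ N := by
    refine iSup_le fun S => iSup_le fun hS => iSup_le fun hsep => ?_
    refine hN x (ε / 2) (by positivity) S ?_ ?_
    · convert hS using 2; field_simp
    · intro y hy z hz hyz
      have : (δ : ℝ≥0∞) < edist y z := hsep hy hz hyz
      rw [edist_nndist] at this
      have h2 : δ < nndist y z := by exact_mod_cast this
      have h3 : (δ : ℝ) < dist y z := by exact_mod_cast h2
      linarith
  have hne : Metric.packingNumber δ (Metric.ball x R) ≠ ⊤ :=
    ne_top_of_le_ne_top (ENat.natCast_ne_top N) hpack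
  refine ⟨Metric.maximalSeparatedSet δ (Metric.ball x R), ?_, ?_⟩
  · apply Set.finite_of_encard_le_coe (k := N)
    rwa [Metric.encard_maximalSeparatedSet hne]
  · intro y hy
    obtain ⟨z, hz, hyz⟩ := Metric.isCover_maximalSeparatedSet hne hy
    refine mem_iUnion₂.2 ⟨z, hz, ?_⟩
    have h2 : nndist y z ≤ δ := by
      simp only [mem_ofPred_eq, edist_nndist] at hyz
      exact_mod_cast hyz
    have h3 : dist y z ≤ δ := by exact_mod_cast h2
    rw [Metric.mem_ball]; linarith

/-- Closed balls of the completion lie in closures of images of totally bounded balls of Ω, and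
total boundedness is compactness after completion. Properness yields second countability and
σ-finiteness, which Fubini needs, and the existence of nearest boundary points. -/
theorem IsDoubling.properSpace [BorelSpace Ω] (hμ : IsDoubling μ) :
    ProperSpace (UniformSpace.Completion Ω) := by
  refine ⟨fun a r => ?_⟩
  obtain ⟨x, hx⟩ := exists_coe_near a one_pos
  have htb := (hμ.totallyBounded_ball x (r + 3)).image
    (UniformSpace.Completion.uniformContinuous_coe Ω)
  refine (htb.closure.isCompact_of_isClosed isClosed_closure).of_isClosed_subset
    Metric.isClosed_closedBall fun b hb => ?_
  rw [Metric.mem_closure_iff]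
  intro ε hε
  obtain ⟨y, hy⟩ := exists_coe_near b (lt_min hε one_pos)
  refine ⟨y, ⟨y, ?_, rfl⟩, by rw [dist_comm]; exact hy.trans_le (min_le_left _ _)⟩
  rw [Metric.mem_ball, ← UniformSpace.Completion.dist_eq]
  have h1 := hy.trans_le (min_le_right _ _)
  have h2 := Metric.mem_closedBall.1 hb
  rw [dist_comm] at hx
  linarith [dist_triangle4 (y : UniformSpace.Completion Ω) b a x]

theorem IsDoubling.secondCountableTopology [BorelSpace Ω] (hμ : IsDoubling μ) :
    SecondCountableTopology Ω := by
  have := hμ.properSpace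
  exact (UniformSpace.Completion.isUniformInducing_coe Ω).isInducing.secondCountableTopology

theorem IsDoubling.isLocallyFiniteMeasure (hμ : IsDoubling μ) : IsLocallyFiniteMeasure μ :=
  ⟨fun x => ⟨Metric.ball x 1, Metric.ball_mem_nhds x one_pos, (hμ.1 x 1 one_pos).2⟩⟩

theorem IsDoubling.sigmaFinite [BorelSpace Ω] (hμ : IsDoubling μ) : SigmaFinite μ := by
  have := hμ.secondCountableTopology
  have := hμ.isLocallyFiniteMeasure
  infer_instance

end Doubling

/-! ### The boundary and the comparison of ν with μ. -/

section Boundary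

variable {Ω : Type*} [MetricSpace Ω]

/-- A locally compact space is open in its completion: a small closed ball is compact, so its image
is closed and already contains every nearby point of the completion. -/
theorem isClosed_boundary [LocallyCompactSpace Ω] : IsClosed (boundary Ω) := by
  rw [boundary, isClosed_compl_iff, Metric.isOpen_iff]
  rintro _ ⟨x, rfl⟩
  obtain ⟨k, hk, hxk⟩ := exists_compact_mem_nhds x
  obtain ⟨ε, hε, hεk⟩ := Metric.nhds_basis_closedBall.mem_iff.1 hxk
  have hcomp : IsCompact (Metric.closedBall x ε) :=
    hk.of_isClosed_subset Metric.isClosed_closedBall hεk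
  refine ⟨ε, hε, fun b hb => ?_⟩
  have hcl : IsClosed (((↑) : Ω → UniformSpace.Completion Ω) '' Metric.closedBall x ε) :=
    (hcomp.image (UniformSpace.Completion.continuous_coe Ω)).isClosed
  have : b ∈ ((↑) : Ω → UniformSpace.Completion Ω) '' Metric.closedBall x ε := by
    rw [← hcl.closure_eq, Metric.mem_closure_iff]
    intro δ hδ
    have hb' := Metric.mem_ball.1 hb
    obtain ⟨y, hy⟩ := exists_coe_near b (lt_min hδ (sub_pos.2 hb'))
    refine ⟨y, ⟨y, ?_, rfl⟩, by rw [dist_comm]; exact hy.trans_le (min_le_left _ _)⟩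
    rw [Metric.mem_closedBall, ← UniformSpace.Completion.dist_eq]
    have h1 := hy.trans_le (min_le_right _ _)
    linarith [dist_triangle (y : UniformSpace.Completion Ω) b x]
  obtain ⟨y, -, rfl⟩ := this
  exact ⟨y, rfl⟩

theorem boundary_nonempty (h : ¬ Bornology.IsBounded (boundary Ω)) : (boundary Ω).Nonempty := by
  by_contra hne
  rw [not_nonempty_iff_eq_empty] at hne
  exact h (hne ▸ Bornology.isBounded_empty)

theorem bdryDist_pos [LocallyCompactSpace Ω] (h : (boundary Ω).Nonempty) (x : Ω) :
    0 < bdryDist x :=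
  (isClosed_boundary.notMem_iff_infDist_pos h).1 fun hx => hx ⟨x, rfl⟩

theorem bdryDist_le (x : Ω) (ζ : boundary Ω) :
    bdryDist x ≤ dist (x : UniformSpace.Completion Ω) ζ :=
  Metric.infDist_le_dist_of_mem ζ.2

theorem bdryDist_le_add (x y : Ω) : bdryDist x ≤ bdryDist y + dist x y := by
  rw [← UniformSpace.Completion.dist_eq]
  exact Metric.infDist_le_infDist_add_dist

theorem continuous_bdryDist : Continuous (bdryDist : Ω → ℝ) :=
  (Metric.continuous_infDist_pt _).comp (UniformSpace.Completion.continuous_coe Ω)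

theorem exists_nearest [LocallyCompactSpace Ω] [ProperSpace (UniformSpace.Completion Ω)]
    (h : (boundary Ω).Nonempty) (x : Ω) :
    ∃ ζ : boundary Ω, dist (x : UniformSpace.Completion Ω) ζ = bdryDist x := by
  obtain ⟨ζ, hζ, h⟩ := isClosed_boundary.exists_infDist_eq_dist h (x : UniformSpace.Completion Ω)
  exact ⟨⟨ζ, hζ⟩, h.symm⟩

/-- The trace on the boundary of a ball of the completion. -/
def bball (a : UniformSpace.Completion Ω) (r : ℝ) : Set (boundary Ω) :=
  {ζ | dist (ζ : UniformSpace.Completion Ω) a < r}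

theorem bball_coe (ζ : boundary Ω) (r : ℝ) :
    bball (ζ : UniformSpace.Completion Ω) r = Metric.ball ζ r := rfl

theorem bball_subset {a b : UniformSpace.Completion Ω} {r s : ℝ} (h : dist a b + r ≤ s) :
    bball a r ⊆ bball b s := by
  intro x hx
  simp only [bball, mem_ofPred_eq] at *
  linarith [dist_triangle (x : UniformSpace.Completion Ω) a b]

theorem isOpen_bball (a : UniformSpace.Completion Ω) (r : ℝ) : IsOpen (bball a r) :=
  isOpen_lt (continuous_subtype_val.dist continuous_const) continuous_const

theorem measurableSet_bball [MeasurableSpace (boundary Ω)] [BorelSpace (boundary Ω)]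
    (a : UniformSpace.Completion Ω) (r : ℝ) : MeasurableSet (bball a r) :=
  (isOpen_bball a r).measurableSet

variable [MeasurableSpace Ω] [MeasurableSpace (boundary Ω)]
  {μ : Measure Ω} {ν : Measure (boundary Ω)} {θ : ℝ}

/-- The measure of a boundary ball, scaled by `r ^ θ`, is controlled by that of comparable balls. -/
theorem IsCodimensional.bball_le_iball (hcodim : IsCodimensional θ μ ν) (hμ : IsDoubling μ)
    (hθ : 0 < θ) (K : ℝ) :
    ∃ C : ℝ≥0, ∀ (a b : UniformSpace.Completion Ω) (r s : ℝ), 0 < r → dist a b + s ≤ K * r →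
      ENNReal.ofReal (r ^ θ) * ν (bball b s) ≤ C * μ (iball a r) := by
  obtain ⟨C₀, hC₀, hcod⟩ := hcodim
  -- If `bball b s` contains a boundary point `ζ`, it lies in the ball about `ζ` of radius `2 * |K|
  -- * r + r`, where codimensionality applies. The summand `r` keeps this radius at least `r`, so
  -- the powers compare; moving the centre to `a` costs another `|K| * r`.
  obtain ⟨C, hC⟩ := hμ.iball_le (3 * |K| + 1)
  refine ⟨C₀.toNNReal * C, fun a b r s hr h => ?_⟩
  rcases (bball b s).eq_empty_or_nonempty with he | ⟨ζ, hζ⟩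
  · simp [he]
  simp only [bball, mem_ofPred_eq] at hζ
  have hKr : K * r ≤ |K| * r := by gcongr; exact le_abs_self K
  have hs : 0 < s := dist_nonneg.trans_lt hζ
  have h2 := (hcod ζ (2 * |K| * r + r) (by positivity)).1
  have hr' : 0 < 2 * |K| * r + r := by positivity
  have hpow : 0 < (2 * |K| * r + r) ^ θ := by positivity
  have hC₀' : (0 : ℝ) < C₀ := by linarith
  have h3 : ENNReal.ofReal ((2 * |K| * r + r) ^ θ) * ν (Metric.ball ζ (2 * |K| * r + r)) ≤
      ENNReal.ofReal C₀ * μ (innerBall ζ (2 * |K| * r + r)) := by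
    rw [ENNReal.le_div_iff_mul_le (Or.inl (by simpa using hpow)) (Or.inl ENNReal.ofReal_ne_top)]
      at h2
    rw [one_div, ENNReal.ofReal_inv_of_pos hC₀'] at h2
    calc _ = ENNReal.ofReal C₀ * ((ENNReal.ofReal C₀)⁻¹ * ν (Metric.ball ζ (2 * |K| * r + r)) *
          ENNReal.ofReal ((2 * |K| * r + r) ^ θ)) := by
          rw [← mul_assoc, ← mul_assoc, ENNReal.mul_inv_cancel (by simpa using hC₀')
            ENNReal.ofReal_ne_top, one_mul, mul_comm]
      _ ≤ _ := by gcongr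
  calc ENNReal.ofReal (r ^ θ) * ν (bball b s)
      ≤ ENNReal.ofReal ((2 * |K| * r + r) ^ θ) * ν (Metric.ball ζ (2 * |K| * r + r)) := by
        gcongr
        · nlinarith [abs_nonneg K]
        · rw [← bball_coe]
          refine bball_subset ?_
          rw [dist_comm]
          linarith [dist_nonneg (x := a) (y := b)]
    _ ≤ ENNReal.ofReal C₀ * μ (innerBall ζ (2 * |K| * r + r)) := h3
    _ ≤ ENNReal.ofReal C₀ * (C * μ (iball a r)) := by
        gcongr
        refine hC a ζ _ _ hr ?_
        have := dist_triangle a b ζ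
        rw [dist_comm b ζ] at this
        linarith
    _ = _ := by rw [ENNReal.ofReal]; push_cast; ring

/-- The measure of a ball of `Ω` is controlled by that of comparable boundary balls, scaled by
`r ^ θ`. -/
theorem IsCodimensional.iball_le_bball (hcodim : IsCodimensional θ μ ν) (hμ : IsDoubling μ)
    (K : ℝ) :
    ∃ C : ℝ≥0, ∀ (ζ : boundary Ω) (b : UniformSpace.Completion Ω) (r s : ℝ), 0 < r →
      dist (ζ : UniformSpace.Completion Ω) b + s ≤ K * r →
      μ (iball b s) ≤ C * (ENNReal.ofReal (r ^ θ) * ν (Metric.ball ζ r)) := by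
  obtain ⟨C₀, hC₀, hcod⟩ := hcodim
  obtain ⟨C, hC⟩ := hμ.iball_le K
  refine ⟨C * C₀.toNNReal, fun ζ b r s hr h => ?_⟩
  have hpow : 0 < r ^ θ := by positivity
  have h2 := (hcod ζ r hr).2
  rw [ENNReal.div_le_iff (by simpa using hpow) ENNReal.ofReal_ne_top] at h2
  calc μ (iball b s) ≤ C * μ (iball ζ r) := hC _ _ _ _ hr h
    _ ≤ C * (ENNReal.ofReal C₀ * ν (Metric.ball ζ r) * ENNReal.ofReal (r ^ θ)) := by gcongr; exact h2
    _ = _ := by rw [ENNReal.ofReal]; push_cast; ring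

theorem IsCodimensional.ball_pos (hcodim : IsCodimensional θ μ ν) (hμ : IsDoubling μ)
    (ζ : boundary Ω) {r : ℝ} (hr : 0 < r) : 0 < ν (Metric.ball ζ r) := by
  obtain ⟨C, hC⟩ := hcodim.iball_le_bball hμ 1
  have h := hC ζ ζ r r hr (by simp)
  rw [pos_iff_ne_zero]
  intro h0
  rw [h0, mul_zero, mul_zero] at h
  exact (hμ.iball_pos ζ hr).not_ge h

theorem IsCodimensional.bball_lt_top (hcodim : IsCodimensional θ μ ν) (hμ : IsDoubling μ)
    (hθ : 0 < θ) (b : UniformSpace.Completion Ω) (s : ℝ) : ν (bball b s) < ∞ := by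
  obtain ⟨C, hC⟩ := hcodim.bball_le_iball hμ hθ (max s 1)
  have h := hC b b 1 s one_pos (by simp)
  simp only [Real.one_rpow, ENNReal.ofReal_one, one_mul] at h
  exact h.trans_lt (ENNReal.mul_lt_top ENNReal.coe_lt_top (hμ.iball_lt_top _ _))

/-- Comparable boundary balls have comparable measure. -/
theorem IsCodimensional.bball_le (hcodim : IsCodimensional θ μ ν) (hμ : IsDoubling μ)
    (hθ : 0 < θ) (K : ℝ) :
    ∃ C : ℝ≥0, ∀ (ζ : boundary Ω) (b : UniformSpace.Completion Ω) (r s : ℝ), 0 < r →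
      dist (ζ : UniformSpace.Completion Ω) b + s ≤ K * r →
      ν (bball b s) ≤ C * ν (Metric.ball ζ r) := by
  obtain ⟨C₁, h₁⟩ := hcodim.bball_le_iball hμ hθ K
  obtain ⟨C₂, h₂⟩ := hcodim.iball_le_bball hμ 1
  refine ⟨C₁ * C₂, fun ζ b r s hr h => ?_⟩
  have hpow : 0 < r ^ θ := by positivity
  have h3 : ENNReal.ofReal (r ^ θ) * ν (bball b s) ≤
      ENNReal.ofReal (r ^ θ) * ((C₁ * C₂ : ℝ≥0) * ν (Metric.ball ζ r)) :=
    calc _ ≤ C₁ * μ (iball ζ r) := h₁ _ _ _ _ hr h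
      _ ≤ C₁ * (C₂ * (ENNReal.ofReal (r ^ θ) * ν (Metric.ball ζ r))) := by
        gcongr; exact h₂ _ _ _ _ hr (by simp)
      _ = _ := by push_cast; ring
  exact (ENNReal.mul_le_mul_iff_right (by simpa using hpow) ENNReal.ofReal_ne_top).1 h3

theorem IsCodimensional.sigmaFinite [BorelSpace Ω] (hcodim : IsCodimensional θ μ ν)
    (hμ : IsDoubling μ) (hθ : 0 < θ) : SigmaFinite ν := by
  have := hμ.properSpace
  have : IsLocallyFiniteMeasure ν :=
    ⟨fun x => ⟨Metric.ball x 1, Metric.ball_mem_nhds x one_pos, hcodim.bball_lt_top hμ hθ x 1⟩⟩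
  infer_instance

end Boundary

/-! ### Upper gradients and the vector space structure of the Dirichlet space. -/

section UpperGradients

variable {Z : Type*} [PseudoMetricSpace Z] [MeasurableSpace Z] {μ : Measure Z} {p : ℝ}
  {u v : Z → ℝ} {g h : Z → ℝ≥0∞}

theorem IsUpperGradient.isWeakUpperGradient (hp : 1 ≤ p) (hg : IsUpperGradient u g) :
    IsWeakUpperGradient p μ u g :=
  ⟨hg.1, 0, measurable_zero, by simp [ENNReal.zero_rpow_of_pos (zero_lt_one.trans_le hp)],
    fun γ hγ => absurd (hg.2 γ) hγ⟩

theorem IsUpperGradient.dirichletSeminorm_le (hp : 1 ≤ p) (hg : IsUpperGradient u g) :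
    dirichletSeminorm p μ u ≤ (∫⁻ x, g x ^ p ∂μ) ^ (1 / p) :=
  iInf₂_le g (hg.isWeakUpperGradient hp)

/-- The Dirichlet seminorm can be computed with upper gradients. -/
theorem exists_isUpperGradient_of_dirichletSeminorm_lt (hp : 1 ≤ p) {c : ℝ≥0∞}
    (hc : dirichletSeminorm p μ u < c) :
    ∃ g, IsUpperGradient u g ∧ (∫⁻ x, g x ^ p ∂μ) ^ (1 / p) < c := by
  have hp0 : 0 < p := zero_lt_one.trans_le hp
  obtain ⟨g, hg⟩ := iInf_lt_iff.1 hc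
  obtain ⟨⟨hgm, ρ, hρm, hρ, hbad⟩, hgc⟩ := iInf_lt_iff.1 hg
  have hR : (∫⁻ x, ρ x ^ p ∂μ) ^ (1 / p) ≠ ∞ :=
    (ENNReal.rpow_lt_top_of_nonneg (by positivity) hρ.ne).ne
  -- Adding `ε * ρ` to `g` makes the line integral infinite on every exceptional curve, and a small
  -- `ε` costs less than the gap between the norm of `g` and `c`.
  obtain ⟨ε, hε, hεR⟩ := ENNReal.exists_nnreal_pos_mul_lt hR (tsub_pos_of_lt hgc).ne'
  refine ⟨fun x => g x + ε * ρ x, ⟨hgm.add (hρm.const_mul _), fun γ => ?_⟩, ?_⟩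
  · by_cases hγ : UpperGradientInequality u g γ
    · exact le_trans hγ (lintegral_mono fun t => le_self_add)
    · have hinf : γ.lineIntegral (fun x => g x + ε * ρ x) = ∞ := by
        rw [eq_top_iff]
        calc ∞ = (ε : ℝ≥0∞) * γ.lineIntegral ρ := by
              rw [hbad γ hγ, ENNReal.mul_top (by exact_mod_cast hε.ne')]
          _ ≤ γ.lineIntegral (fun x => ε * ρ x) := lintegral_const_mul_le _ _
          _ ≤ _ := lintegral_mono fun t => le_add_self
      rw [UpperGradientInequality, hinf]
      exact le_top
  · calc (∫⁻ x, (g x + ε * ρ x) ^ p ∂μ) ^ (1 / p)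
        ≤ (∫⁻ x, g x ^ p ∂μ) ^ (1 / p) + (∫⁻ x, (ε * ρ x) ^ p ∂μ) ^ (1 / p) :=
          ENNReal.lintegral_Lp_add_le hgm.aemeasurable (hρm.const_mul _).aemeasurable hp
      _ = (∫⁻ x, g x ^ p ∂μ) ^ (1 / p) + ε * (∫⁻ x, ρ x ^ p ∂μ) ^ (1 / p) := by
          congr 1
          simp_rw [ENNReal.mul_rpow_of_nonneg _ _ hp0.le]
          rw [lintegral_const_mul _ (hρm.pow_const p),
            ENNReal.mul_rpow_of_nonneg _ _ (by positivity), ← ENNReal.rpow_mul,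
            mul_one_div_cancel hp0.ne', ENNReal.rpow_one]
      _ < c := by
          rw [add_comm]
          exact lt_tsub_iff_right.1 hεR

theorem mem_dirichletSpace_iff (hp : 1 ≤ p) :
    u ∈ dirichletSpace p μ ↔
      AEMeasurable u μ ∧ ∃ g, IsUpperGradient u g ∧ ∫⁻ x, g x ^ p ∂μ < ∞ := by
  have hp0 : 0 < 1 / p := one_div_pos.2 (zero_lt_one.trans_le hp)
  refine and_congr_right fun _ => ⟨fun h => ?_, ?_⟩
  · obtain ⟨g, hg, hgt⟩ := exists_isUpperGradient_of_dirichletSeminorm_lt hp h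
    exact ⟨g, hg, (ENNReal.rpow_lt_top_iff_of_pos hp0).1 hgt⟩
  · rintro ⟨g, hg, hgt⟩
    exact (hg.dirichletSeminorm_le hp).trans_lt ((ENNReal.rpow_lt_top_iff_of_pos hp0).2 hgt)

theorem IsUpperGradient.add (hg : IsUpperGradient u g) (hh : IsUpperGradient v h) :
    IsUpperGradient (u + v) (g + h) := by
  refine ⟨hg.1.add hh.1, fun γ => ?_⟩
  calc ‖(u + v) γ.target - (u + v) γ.source‖ₑ
      = ‖(u γ.target - u γ.source) + (v γ.target - v γ.source)‖ₑ := by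
        simp only [Pi.add_apply]; congr 1; ring
    _ ≤ ‖u γ.target - u γ.source‖ₑ + ‖v γ.target - v γ.source‖ₑ := enorm_add_le _ _
    _ ≤ γ.lineIntegral g + γ.lineIntegral h := add_le_add (hg.2 γ) (hh.2 γ)
    _ ≤ γ.lineIntegral (g + h) := le_lintegral_add _ _

theorem IsUpperGradient.const_smul (c : ℝ) (hg : IsUpperGradient u g) :
    IsUpperGradient (c • u) (fun x => ‖c‖ₑ * g x) := by
  refine ⟨hg.1.const_mul _, fun γ => ?_⟩
  calc ‖(c • u) γ.target - (c • u) γ.source‖ₑ = ‖c‖ₑ * ‖u γ.target - u γ.source‖ₑ := by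
        rw [← enorm_mul]; simp [mul_sub]
    _ ≤ ‖c‖ₑ * γ.lineIntegral g := by gcongr; exact hg.2 γ
    _ ≤ _ := lintegral_const_mul_le _ _

theorem add_mem_dirichletSpace (hp : 1 ≤ p) (hu : u ∈ dirichletSpace p μ)
    (hv : v ∈ dirichletSpace p μ) : u + v ∈ dirichletSpace p μ := by
  rw [mem_dirichletSpace_iff hp] at *
  obtain ⟨hum, g, hg, hgt⟩ := hu
  obtain ⟨hvm, h, hh, hht⟩ := hv
  exact ⟨hum.add hvm, g + h, hg.add hh,
    ENNReal.lintegral_rpow_add_lt_top_of_lintegral_rpow_lt_top hg.1.aemeasurable hgt hht hp⟩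

theorem smul_mem_dirichletSpace (hp : 1 ≤ p) (c : ℝ) (hu : u ∈ dirichletSpace p μ) :
    c • u ∈ dirichletSpace p μ := by
  have hp0 : 0 < p := zero_lt_one.trans_le hp
  rw [mem_dirichletSpace_iff hp] at *
  obtain ⟨hum, g, hg, hgt⟩ := hu
  refine ⟨hum.const_smul c, _, hg.const_smul c, ?_⟩
  simp_rw [ENNReal.mul_rpow_of_nonneg _ _ hp0.le]
  rw [lintegral_const_mul _ (hg.1.pow_const p)]
  exact ENNReal.mul_lt_top (ENNReal.rpow_lt_top_of_nonneg hp0.le enorm_ne_top) hgt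

end UpperGradients

/-! ### Means over comparable sets. -/

section Averages

variable {Z : Type*} [MeasurableSpace Z] {μ : Measure Z} {u : Z → ℝ} {A B : Set Z}

theorem enorm_setAverage_sub_le (hu : IntegrableOn u A μ) (h0 : μ A ≠ 0) (ht : μ A ≠ ∞) (c : ℝ) :
    ‖⨍ x in A, u x ∂μ - c‖ₑ ≤ ⨍⁻ x in A, ‖u x - c‖ₑ ∂μ := by
  have hfin : IsFiniteMeasure (μ.restrict A) := ⟨by simpa using ht.lt_top⟩
  have hne : NeZero (μ.restrict A) := ⟨by simpa using h0⟩
  have h : ⨍ x in A, u x ∂μ - c = ⨍ x in A, (u x - c) ∂μ := by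
    rw [average, average, integral_sub]
    · rw [← average, ← average, setAverage_const h0 ht]
    · exact hu.to_average
    · exact integrable_const c
  rw [h, average, laverage]
  exact enorm_integral_le_lintegral_enorm _

theorem setLAverage_le_of_subset {f : Z → ℝ≥0∞} {K : ℝ≥0∞} (hAB : A ⊆ B)
    (h : μ B ≤ K * μ A) (h0 : μ B ≠ 0) (ht : μ B ≠ ∞) :
    ⨍⁻ x in A, f x ∂μ ≤ K * ⨍⁻ x in B, f x ∂μ := by
  have hA0 : μ A ≠ 0 := fun h' => h0 (by simpa [h'] using h)
  have hAt : μ A ≠ ∞ := ne_top_of_le_ne_top ht (measure_mono hAB)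
  rw [setLAverage_eq, setLAverage_eq, ENNReal.div_le_iff hA0 hAt]
  calc ∫⁻ x in A, f x ∂μ ≤ ∫⁻ x in B, f x ∂μ := lintegral_mono_set hAB
    _ = (∫⁻ x in B, f x ∂μ) / μ B * μ B := (ENNReal.div_mul_cancel h0 ht).symm
    _ ≤ (∫⁻ x in B, f x ∂μ) / μ B * (K * μ A) := by gcongr
    _ = _ := by ring

theorem enorm_setAverage_sub_le_mul {K : ℝ≥0∞} (hu : IntegrableOn u B μ) (hAB : A ⊆ B)
    (h : μ B ≤ K * μ A) (h0 : μ B ≠ 0) (ht : μ B ≠ ∞) (c : ℝ) :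
    ‖⨍ x in A, u x ∂μ - c‖ₑ ≤ K * ⨍⁻ x in B, ‖u x - c‖ₑ ∂μ :=
  (enorm_setAverage_sub_le (hu.mono_set hAB) (fun h' => h0 (by simpa [h'] using h))
    (ne_top_of_le_ne_top ht (measure_mono hAB)) c).trans (setLAverage_le_of_subset hAB h h0 ht)

theorem setLAverage_const_enorm (h0 : μ A ≠ 0) (ht : μ A ≠ ∞) (c : ℝ≥0∞) :
    ⨍⁻ _ in A, c ∂μ = c := by
  rw [setLAverage_eq, setLIntegral_const, ENNReal.mul_div_cancel_right h0 ht]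

/-- Oscillation around the mean is controlled by the oscillation around any constant, on any
larger comparable set. -/
theorem setLAverage_sub_average_le {K : ℝ≥0∞} (hu : IntegrableOn u B μ) (hAB : A ⊆ B)
    (h : μ B ≤ K * μ A) (h0 : μ B ≠ 0) (ht : μ B ≠ ∞) (c : ℝ) :
    ⨍⁻ x in A, ‖u x - ⨍ y in A, u y ∂μ‖ₑ ∂μ ≤ 2 * K * ⨍⁻ x in B, ‖u x - c‖ₑ ∂μ := by
  have hA0 : μ A ≠ 0 := fun h' => h0 (by simpa [h'] using h)
  have hAt : μ A ≠ ∞ := ne_top_of_le_ne_top ht (measure_mono hAB)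
  set m := ⨍ y in A, u y ∂μ
  calc ⨍⁻ x in A, ‖u x - m‖ₑ ∂μ ≤ ⨍⁻ x in A, (‖u x - c‖ₑ + ‖m - c‖ₑ) ∂μ := by
        refine lintegral_mono fun x => ?_
        calc ‖u x - m‖ₑ = ‖(u x - c) - (m - c)‖ₑ := by congr 1; ring
          _ ≤ _ := enorm_sub_le
    _ = ⨍⁻ x in A, ‖u x - c‖ₑ ∂μ + ‖m - c‖ₑ := by
        rw [laverage, lintegral_add_right _ measurable_const]
        congr 1
        exact setLAverage_const_enorm hA0 hAt _
    _ ≤ K * ⨍⁻ x in B, ‖u x - c‖ₑ ∂μ + K * ⨍⁻ x in B, ‖u x - c‖ₑ ∂μ :=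
        add_le_add (setLAverage_le_of_subset hAB h h0 ht)
          (enorm_setAverage_sub_le_mul hu hAB h h0 ht c)
    _ = _ := by ring

end Averages

/-- Inverting in `ℝ≥0∞` requires a nonzero constant; this is why several comparison constants below
are enlarged to `C + 1`. -/
theorem inv_le_mul_inv {K : ℝ≥0} {V m : ℝ≥0∞} (hK : K ≠ 0) (h : V ≤ K * m) :
    m⁻¹ ≤ K * V⁻¹ := by
  have hK' : (K : ℝ≥0∞) ≠ 0 := by exact_mod_cast hK
  calc m⁻¹ = K * (K * m)⁻¹ := by
        rw [ENNReal.mul_inv (Or.inl hK') (Or.inl ENNReal.coe_ne_top), ← mul_assoc,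
          ENNReal.mul_inv_cancel hK' ENNReal.coe_ne_top, one_mul]
    _ ≤ K * V⁻¹ := by gcongr

/-! ### Consequences of the Poincaré inequality. -/

section Poincare

variable {Ω : Type*} [MetricSpace Ω] [MeasurableSpace Ω] {μ : Measure Ω} {p : ℝ}

/-- The scaled energy `s ^ p V⁻¹ ∫_F g ^ p`. -/
noncomputable def scaledEnergy (p : ℝ) (μ : Measure Ω) (g : Ω → ℝ≥0∞) (s : ℝ) (V : ℝ≥0∞)
    (F : Set Ω) : ℝ≥0∞ :=
  ENNReal.ofReal (s ^ p) * V⁻¹ * ∫⁻ x in F, g x ^ p ∂μ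

theorem integrableOn_ball_of_mem_dirichletSpace (hp : 1 ≤ p)
    (hμ : IsDoubling μ) (hP : SupportsPoincare p μ) {u : Ω → ℝ} (hu : u ∈ dirichletSpace p μ)
    (x : Ω) (r : ℝ) : IntegrableOn u (Metric.ball x r) μ := by
  rcases le_or_gt r 0 with hr | hr
  · simp [Metric.ball_eq_empty.2 hr]
  obtain ⟨C, lam, hC, hlam, hPI⟩ := hP
  obtain ⟨hum, g, hg, hgt⟩ := (mem_dirichletSpace_iff hp).1 hu
  have hB := hμ.1 x r hr
  have hB' := hμ.1 x (lam * r) (by positivity)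
  have h := hPI u hu g hg x r hr
  -- If `u` were not integrable, `c` would be the default value `0`. The argument works for any real
  -- `c`: a finite lower integral of `‖u - c‖ₑ` on a ball of finite measure forces integrability.
  set c := ⨍ y in Metric.ball x r, u y ∂μ
  have hfin : ⨍⁻ y in Metric.ball x r, ‖u y - c‖ₑ ∂μ < ∞ := by
    refine h.trans_lt (ENNReal.mul_lt_top ENNReal.ofReal_lt_top
      (ENNReal.rpow_lt_top_of_nonneg (by positivity) ?_))
    rw [setLAverage_eq]
    exact (ENNReal.div_lt_top
      ((setLIntegral_le_lintegral _ _).trans_lt hgt).ne hB'.1.ne').ne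
  rw [setLAverage_eq] at hfin
  have hfin2 : ∫⁻ y in Metric.ball x r, ‖u y - c‖ₑ ∂μ < ∞ := by
    by_contra h'
    rw [not_lt, top_le_iff] at h'
    rw [h', ENNReal.top_div_of_ne_top hB.2.ne] at hfin
    exact lt_irrefl _ hfin
  have hint : IntegrableOn (fun y => u y - c) (Metric.ball x r) μ :=
    ⟨(hum.restrict.sub_const c).aestronglyMeasurable, hfin2⟩
  have := hint.add (integrableOn_const (C := c) hB.2.ne)
  refine this.congr_fun_ae (ae_of_all _ fun y => ?_)
  simp

theorem integrableOn_iball_of_mem_dirichletSpace (hp : 1 ≤ p)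
    (hμ : IsDoubling μ) (hP : SupportsPoincare p μ) {u : Ω → ℝ} (hu : u ∈ dirichletSpace p μ)
    (a : UniformSpace.Completion Ω) (r : ℝ) : IntegrableOn u (iball a r) μ := by
  obtain ⟨x, hx⟩ := exists_coe_near a one_pos
  refine (integrableOn_ball_of_mem_dirichletSpace hp hμ hP hu x (1 + r)).mono_set ?_
  rw [← iball_coe]
  refine iball_subset ?_
  rw [dist_comm]; linarith

/-- A form of the Poincaré inequality comparing the means of `u` over sets that are large in a
common ball. -/
theorem SupportsPoincare.exists_average_sub_le (hp : 1 ≤ p) (hμ : IsDoubling μ)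
    (hP : SupportsPoincare p μ) :
    ∃ Λ : ℝ, 1 ≤ Λ ∧ ∀ K : ℝ≥0, ∃ C : ℝ≥0, ∀ u ∈ dirichletSpace p μ, ∀ g, IsUpperGradient u g →
      ∀ (z : Ω) (r s : ℝ) (V : ℝ≥0∞) (F A A' : Set Ω), 0 < r → 0 < s → r ≤ K * s →
        V ≤ K * μ (Metric.ball z r) → Metric.ball z (Λ * r) ⊆ F →
        A ⊆ Metric.ball z r → A' ⊆ Metric.ball z r →
        μ (Metric.ball z r) ≤ K * μ A → μ (Metric.ball z r) ≤ K * μ A' →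
        ‖⨍ x in A, u x ∂μ - ⨍ x in A', u x ∂μ‖ₑ ≤ C * scaledEnergy p μ g s V F ^ (1 / p) ∧
        ⨍⁻ x in A, ‖u x - ⨍ y in A, u y ∂μ‖ₑ ∂μ ≤ C * scaledEnergy p μ g s V F ^ (1 / p) := by
  have hp0 : 0 < p := zero_lt_one.trans_le hp
  obtain ⟨C, lam, hC, hlam, hPI⟩ := id hP
  refine ⟨lam, hlam, fun K => ⟨2 * K * (C.toNNReal * K * K ^ (1 / p)), ?_⟩⟩
  intro u hu g hg z r s V F A A' hr hs hrs hV hF hA hA' hKA hKA'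
  have hB := hμ.1 z r hr
  have hint := integrableOn_ball_of_mem_dirichletSpace hp hμ hP hu z r
  set c := ⨍ y in Metric.ball z r, u y ∂μ with hc
  have hosc : ⨍⁻ x in Metric.ball z r, ‖u x - c‖ₑ ∂μ ≤
      C.toNNReal * K * (K : ℝ≥0∞) ^ (1 / p) * scaledEnergy p μ g s V F ^ (1 / p) := by
    calc ⨍⁻ x in Metric.ball z r, ‖u x - c‖ₑ ∂μ
        ≤ ENNReal.ofReal (C * r) * (⨍⁻ x in Metric.ball z (lam * r), g x ^ p ∂μ) ^ (1 / p) :=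
          hPI u hu g hg z r hr
      _ ≤ (C.toNNReal * (K * ENNReal.ofReal s)) * (K * (V⁻¹ * ∫⁻ x in F, g x ^ p ∂μ)) ^ (1 / p) := by
          gcongr
          · rw [ENNReal.ofReal_mul hC.le, ← ENNReal.ofReal_coe_nnreal,
              ← ENNReal.ofReal_coe_nnreal, ← ENNReal.ofReal_mul K.coe_nonneg,
              Real.coe_toNNReal _ hC.le]
            gcongr
          · rw [setLAverage_eq, div_eq_mul_inv, mul_comm, ← mul_assoc]
            gcongr
            refine (ENNReal.inv_le_inv.2 (measure_mono
              (Metric.ball_subset_ball (by nlinarith)))).trans (inv_le_mul_inv ?_ hV)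
            rintro rfl
            simp [hB.1.ne'] at hKA
      _ = _ := by
          rw [scaledEnergy, ← ENNReal.ofReal_rpow_of_nonneg hs.le hp0.le,
            mul_assoc (ENNReal.ofReal s ^ p),
            ENNReal.mul_rpow_of_nonneg (ENNReal.ofReal s ^ p) _ (by positivity),
            ENNReal.mul_rpow_of_nonneg (K : ℝ≥0∞) _ (by positivity), ← ENNReal.rpow_mul,
            mul_one_div_cancel hp0.ne', ENNReal.rpow_one]
          ring
  have hKr : ((2 * K * (C.toNNReal * K * K ^ (1 / p)) : ℝ≥0) : ℝ≥0∞) =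
      2 * K * (C.toNNReal * K * (K : ℝ≥0∞) ^ (1 / p)) := by
    push_cast [ENNReal.coe_rpow_of_nonneg K (show (0:ℝ) ≤ 1 / p by positivity)]
    ring
  rw [hKr, mul_assoc (2 * (K : ℝ≥0∞))]
  constructor
  · calc ‖⨍ x in A, u x ∂μ - ⨍ x in A', u x ∂μ‖ₑ
        = ‖(⨍ x in A, u x ∂μ - c) - (⨍ x in A', u x ∂μ - c)‖ₑ := by congr 1; ring
      _ ≤ ‖⨍ x in A, u x ∂μ - c‖ₑ + ‖⨍ x in A', u x ∂μ - c‖ₑ := enorm_sub_le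
      _ ≤ K * ⨍⁻ x in Metric.ball z r, ‖u x - c‖ₑ ∂μ +
          K * ⨍⁻ x in Metric.ball z r, ‖u x - c‖ₑ ∂μ :=
        add_le_add (enorm_setAverage_sub_le_mul hint hA hKA hB.1.ne' hB.2.ne c)
          (enorm_setAverage_sub_le_mul hint hA' hKA' hB.1.ne' hB.2.ne c)
      _ = 2 * K * ⨍⁻ x in Metric.ball z r, ‖u x - c‖ₑ ∂μ := by ring
      _ ≤ _ := by gcongr
  · exact (setLAverage_sub_average_le hint hA hKA hB.1.ne' hB.2.ne c).trans (by gcongr)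

end Poincare

/-- The standing assumptions of the trace and extension theorems. -/
structure TraceSetting {Ω : Type*} [MetricSpace Ω] [MeasurableSpace Ω]
    [MeasurableSpace (boundary Ω)] (p θ : ℝ) (μ : Measure Ω) (ν : Measure (boundary Ω)) : Prop where
  unbounded : ¬ Bornology.IsBounded (univ : Set Ω)
  doubling : IsDoubling μ
  one_le : 1 ≤ p
  poincare : SupportsPoincare p μ
  uniform : IsUniformDomain Ω
  nonempty : (boundary Ω).Nonempty
  pos : 0 < θ
  lt : θ < p
  codim : IsCodimensional θ μ ν


/-! ### Summation over dyadic scales. -/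

section Sequences

/-- Each term is bounded by `q ^ k` times the weighted sum, so the p-th roots are dominated by a
geometric series. A crude substitute for Hölder's inequality that also covers `p = 1`. -/
theorem tsum_rpow_le {p : ℝ} (hp : 1 ≤ p) {q : ℝ≥0∞} (hq0 : q ≠ 0) (hqt : q ≠ ∞) (b : ℕ → ℝ≥0∞) :
    ∑' k, b k ^ (1 / p) ≤ (1 - q ^ (1 / p))⁻¹ * (∑' k, q⁻¹ ^ k * b k) ^ (1 / p) := by
  have hp0 : 0 ≤ 1 / p := by positivity
  set S := ∑' k, q⁻¹ ^ k * b k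
  have hb : ∀ k, b k ≤ q ^ k * S := fun k =>
    calc b k = q ^ k * (q⁻¹ ^ k * b k) := by
          rw [← mul_assoc, ← mul_pow, ENNReal.mul_inv_cancel hq0 hqt, one_pow, one_mul]
      _ ≤ _ := by gcongr; exact ENNReal.le_tsum (f := fun k => q⁻¹ ^ k * b k) k
  calc ∑' k, b k ^ (1 / p) ≤ ∑' k, (q ^ (1 / p)) ^ k * S ^ (1 / p) := by
        refine ENNReal.tsum_le_tsum fun k => ?_
        calc b k ^ (1 / p) ≤ (q ^ k * S) ^ (1 / p) := by gcongr; exact hb k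
          _ = _ := by
            rw [ENNReal.mul_rpow_of_nonneg _ _ hp0, ← ENNReal.rpow_natCast, ← ENNReal.rpow_mul,
              mul_comm (k : ℝ), ENNReal.rpow_mul, ENNReal.rpow_natCast]
    _ = _ := by rw [ENNReal.tsum_mul_right, ENNReal.tsum_geometric]

theorem tendsto_nhdsGT_zero_of_pow_half {F : ℝ → ℝ≥0∞} {a : ℕ → ℝ≥0∞}
    (ha : Tendsto a atTop (𝓝 0))
    (h : ∀ (r : ℝ) (n : ℕ), (1 / 2) ^ (n + 1) < r → r ≤ (1 / 2) ^ n → F r ≤ a n) :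
    Tendsto F (𝓝[>] 0) (𝓝 0) := by
  rw [ENNReal.tendsto_nhds_zero] at *
  intro ε hε
  obtain ⟨N, hN⟩ := eventually_atTop.1 (ha ε hε)
  have hpos : (0 : ℝ) < (1 / 2) ^ N := by positivity
  filter_upwards [Ioo_mem_nhdsGT hpos] with r hr
  obtain ⟨n, hn1, hn2⟩ := exists_nat_pow_near_of_lt_one hr.1
    (hr.2.le.trans (pow_le_one₀ (by norm_num) (by norm_num)))
    (by norm_num : (0 : ℝ) < 1 / 2) (by norm_num)
  refine (h r n hn1 hn2).trans (hN n ?_)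
  by_contra! hlt
  have : ((1 : ℝ) / 2) ^ N ≤ (1 / 2) ^ (n + 1) :=
    pow_le_pow_of_le_one (by norm_num) (by norm_num) hlt
  linarith [hr.2]

/-- The geometric ratio used for summation over dyadic scales. -/
noncomputable def scaleRatio (p θ : ℝ) : ℝ≥0∞ := ENNReal.ofReal ((1 / 2) ^ ((p - θ) / 2))

theorem scaleRatio_ne_zero (p θ : ℝ) : scaleRatio p θ ≠ 0 := by
  rw [scaleRatio, ne_eq, ENNReal.ofReal_eq_zero, not_le]
  positivity

theorem scaleRatio_ne_top (p θ : ℝ) : scaleRatio p θ ≠ ∞ := ENNReal.ofReal_ne_top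

theorem scaleRatio_lt_one {p θ : ℝ} (h : θ < p) : scaleRatio p θ < 1 := by
  rw [scaleRatio, ENNReal.ofReal_lt_one]
  exact Real.rpow_lt_one (by norm_num) (by norm_num) (by linarith)

theorem tsum_scaleRatio_ne_top {p θ : ℝ} (h : θ < p) : ∑' k, scaleRatio p θ ^ k ≠ ∞ := by
  rw [ENNReal.tsum_geometric]
  exact ENNReal.inv_ne_top.2 (tsub_pos_of_lt (scaleRatio_lt_one h)).ne'

/-- The ratio is the square root of the decay `2 ^ (-(p - θ))` per scale, so the weight `q⁻¹ ^ k`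
uses half of the decay and leaves a summable factor `q ^ k`. -/
theorem scaleRatio_inv_pow_mul (p θ : ℝ) {r : ℝ} (hr : 0 < r) (k : ℕ) :
    (scaleRatio p θ)⁻¹ ^ k * ENNReal.ofReal (((1 / 2) ^ k * r) ^ (p - θ)) =
      scaleRatio p θ ^ k * ENNReal.ofReal (r ^ (p - θ)) := by
  have h1 : ENNReal.ofReal (((1 / 2) ^ k * r) ^ (p - θ)) =
      scaleRatio p θ ^ k * (scaleRatio p θ ^ k * ENNReal.ofReal (r ^ (p - θ))) := by
    have hq : scaleRatio p θ * scaleRatio p θ = ENNReal.ofReal ((1 / 2) ^ (p - θ)) := by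
      rw [scaleRatio, ← ENNReal.ofReal_mul (by positivity), ← Real.rpow_add (by norm_num),
        add_halves]
    rw [Real.mul_rpow (by positivity) hr.le, ENNReal.ofReal_mul (by positivity), ← mul_assoc,
      ← mul_pow, hq, ← ENNReal.ofReal_pow (by positivity), ← Real.rpow_natCast,
      ← Real.rpow_natCast, ← Real.rpow_mul (by norm_num), ← Real.rpow_mul (by norm_num),
      mul_comm (k : ℝ)]
  rw [h1, ← mul_assoc, ← mul_pow, ENNReal.inv_mul_cancel (scaleRatio_ne_zero p θ)
    (scaleRatio_ne_top p θ), one_pow, one_mul]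

end Sequences

/-! ### Integrating energies over the boundary. -/

section Energy

variable {Ω : Type*} [MetricSpace Ω] [MeasurableSpace Ω] [BorelSpace Ω]
  [MeasurableSpace (boundary Ω)] [BorelSpace (boundary Ω)]
  {μ : Measure Ω} {ν : Measure (boundary Ω)} {p θ : ℝ}

theorem TraceSetting.pos_p (h : TraceSetting p θ μ ν) : 0 < p := zero_lt_one.trans_le h.one_le

theorem measurableSet_dist_lt {Y : Type*} [TopologicalSpace Y] [MeasurableSpace Y]
    [OpensMeasurableSpace Y] [SecondCountableTopology Y]
    [ProperSpace (UniformSpace.Completion Ω)] {e : Y → UniformSpace.Completion Ω}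
    (he : Continuous e) (R : ℝ) :
    MeasurableSet {q : boundary Ω × Y | dist (e q.2) (q.1 : UniformSpace.Completion Ω) < R} :=
  (isOpen_lt ((he.comp continuous_snd).dist (continuous_subtype_val.comp continuous_fst))
    continuous_const).measurableSet

/-- Integrating normalized integrals over balls centred at the boundary. -/
theorem TraceSetting.lintegral_inv_measure_mul_le (h : TraceSetting p θ μ ν)
    {Y : Type*} [TopologicalSpace Y] [MeasurableSpace Y] [OpensMeasurableSpace Y]
    [SecondCountableTopology Y] (m : Measure Y) [SFinite m] {e : Y → UniformSpace.Completion Ω}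
    (he : Continuous e) (Λ : ℝ) :
    ∃ C : ℝ≥0, ∀ r : ℝ, 0 < r → ∀ f : Y → ℝ≥0∞, Measurable f →
      ∫⁻ ζ : boundary Ω, (ν (Metric.ball ζ r))⁻¹ *
        ∫⁻ y in {y | dist (e y) ζ < Λ * r}, f y ∂m ∂ν ≤ C * ∫⁻ y, f y ∂m := by
  have := h.doubling.properSpace
  have := h.codim.sigmaFinite h.doubling h.pos
  obtain ⟨C, hC⟩ := h.codim.bball_le h.doubling h.pos (2 * Λ)
  refine ⟨C + 1, fun r hr f hf => ?_⟩
  have hset := measurableSet_dist_lt he (Λ * r)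
  -- When `e y` is within `Λ * r` of `ζ`, doubling of `ν` gives `V y ≤ (C + 1) * ν (ball ζ r)`.
  -- Replacing the normalization by `V y`, which does not depend on `ζ`, lets the integral over `ζ`
  -- cancel it after the interchange.
  set V : Y → ℝ≥0∞ := fun y => ν (bball (e y) (Λ * r)) with hV
  have hVm : Measurable V := by
    have := measurable_measure_prodMk_right (μ := ν) hset
    refine (congrArg Measurable (funext fun y => ?_)).mpr this
    refine congrArg ν (Set.ext fun ζ => ?_)
    simp [bball, dist_comm]
  have hV_top : ∀ y, V y ≠ ∞ := fun y => (h.codim.bball_lt_top h.doubling h.pos _ _).ne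
  let k : boundary Ω → Y → ℝ≥0∞ := fun ζ y =>
    {q : boundary Ω × Y | dist (e q.2) (q.1 : UniformSpace.Completion Ω) < Λ * r}.indicator
      (fun q => (C + 1) * (V q.2)⁻¹ * f q.2) (ζ, y)
  have hk : Measurable (Function.uncurry k) :=
    Measurable.indicator (((hVm.comp measurable_snd).inv.const_mul _).mul
      (hf.comp measurable_snd)) hset
  calc ∫⁻ ζ : boundary Ω, (ν (Metric.ball ζ r))⁻¹ *
        ∫⁻ y in {y | dist (e y) ζ < Λ * r}, f y ∂m ∂ν
      ≤ ∫⁻ ζ, ∫⁻ y, k ζ y ∂m ∂ν := by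
        refine lintegral_mono fun ζ => ?_
        have hs : MeasurableSet {y | dist (e y) (ζ : UniformSpace.Completion Ω) < Λ * r} :=
          measurable_prodMk_left (x := ζ) hset
        dsimp only
        rw [← lintegral_const_mul _ hf, ← lintegral_indicator hs]
        refine lintegral_mono fun y => ?_
        by_cases hy : dist (e y) (ζ : UniformSpace.Completion Ω) < Λ * r
        · simp only [k, indicator, mem_ofPred_eq, hy, if_true]
          gcongr
          have h1 : V y ≤ ((C + 1 : ℝ≥0) : ℝ≥0∞) * ν (Metric.ball ζ r) := by
            refine (hC ζ (e y) r (Λ * r) hr ?_).trans ?_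
            · rw [dist_comm]; linarith
            · gcongr; simp
          simpa using inv_le_mul_inv (by positivity) h1
        · simp [indicator, hy]
    _ = ∫⁻ y, ∫⁻ ζ, k ζ y ∂ν ∂m := lintegral_lintegral_swap hk.aemeasurable
    _ ≤ ∫⁻ y, (C + 1) * f y ∂m := by
        refine lintegral_mono fun y => ?_
        have : ∀ ζ, k ζ y = (bball (e y) (Λ * r)).indicator
            (fun _ => (C + 1) * (V y)⁻¹ * f y) ζ := by
          intro ζ
          by_cases hy : dist (e y) (ζ : UniformSpace.Completion Ω) < Λ * r
          · simp [k, indicator, bball, hy, dist_comm _ (e y)]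
          · simp [k, indicator, bball, hy, dist_comm _ (e y)]
        simp_rw [this]
        rw [lintegral_indicator (measurableSet_bball _ _), setLIntegral_const]
        calc (C + 1) * (V y)⁻¹ * f y * V y = (C + 1) * f y * ((V y)⁻¹ * V y) := by ring
          _ ≤ (C + 1) * f y * 1 := by gcongr; exact ENNReal.inv_mul_le_one _
          _ = _ := mul_one _
    _ = _ := by rw [lintegral_const_mul _ hf]; push_cast; rfl

/-- The scaled energy of `g` near a boundary point, restricted to the set `G`. -/
noncomputable def bdryEnergy (p : ℝ) (μ : Measure Ω) (g : Ω → ℝ≥0∞) (Λ s : ℝ) (G : Set Ω)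
    (ζ : boundary Ω) : ℝ≥0∞ :=
  scaledEnergy p μ g s (μ (iball ζ s)) (iball ζ (Λ * s) ∩ G)

theorem TraceSetting.measurable_bdryEnergy (h : TraceSetting p θ μ ν) {g : Ω → ℝ≥0∞}
    (hg : Measurable g) (Λ s : ℝ) {G : Set Ω} (hG : MeasurableSet G) :
    Measurable (bdryEnergy p μ g Λ s G) := by
  have := h.doubling.properSpace
  have := h.doubling.secondCountableTopology
  have := h.doubling.sigmaFinite
  have he := UniformSpace.Completion.continuous_coe Ω
  have h1 : Measurable fun ζ : boundary Ω => μ (iball ζ s) :=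
    measurable_measure_prodMk_left (measurableSet_dist_lt he s)
  have h2 : Measurable fun ζ : boundary Ω => ∫⁻ x in iball ζ (Λ * s) ∩ G, g x ^ p ∂μ := by
    have h3 : Measurable fun q : boundary Ω × Ω =>
        {q : boundary Ω × Ω | dist (q.2 : UniformSpace.Completion Ω)
          (q.1 : UniformSpace.Completion Ω) < Λ * s}.indicator
          (fun q => G.indicator (fun x => g x ^ p) q.2) q :=
      (((hg.pow_const p).indicator hG).comp measurable_snd).indicator
        (measurableSet_dist_lt he (Λ * s))
    refine (congrArg Measurable (funext fun ζ => ?_)).mpr (h3.lintegral_prod_right' (ν := μ))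
    rw [inter_comm, ← setLIntegral_indicator hG, ← lintegral_indicator (measurableSet_iball _ _)]
    rfl
  exact ((h1.inv).const_mul _).mul h2

/-- The integral of the boundary energy over the boundary. -/
theorem TraceSetting.lintegral_bdryEnergy_le (h : TraceSetting p θ μ ν) (Λ : ℝ) :
    ∃ C : ℝ≥0, ∀ s : ℝ, 0 < s → ∀ g : Ω → ℝ≥0∞, Measurable g → ∀ G : Set Ω, MeasurableSet G →
      ∫⁻ ζ, bdryEnergy p μ g Λ s G ζ ∂ν ≤
        C * ENNReal.ofReal (s ^ (p - θ)) * ∫⁻ x in G, g x ^ p ∂μ := by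
  have := h.doubling.properSpace
  have := h.doubling.secondCountableTopology
  have := h.doubling.sigmaFinite
  obtain ⟨C₁, hC₁⟩ := h.lintegral_inv_measure_mul_le μ (UniformSpace.Completion.continuous_coe Ω) Λ
  obtain ⟨C₂, hC₂⟩ := h.codim.bball_le_iball h.doubling h.pos 1
  refine ⟨(C₂ + 1) * C₁, fun s hs g hg G hG => ?_⟩
  have hf := (hg.pow_const p).indicator hG
  have key : ∀ ζ : boundary Ω, bdryEnergy p μ g Λ s G ζ ≤
      ((C₂ + 1) * ENNReal.ofReal (s ^ (p - θ))) * ((ν (Metric.ball ζ s))⁻¹ *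
        ∫⁻ y in {y : Ω | dist (y : UniformSpace.Completion Ω) ζ < Λ * s},
          G.indicator (fun x => g x ^ p) y ∂μ) := by
    intro ζ
    have h1 : ENNReal.ofReal (s ^ θ) * ν (Metric.ball ζ s) ≤
        ((C₂ + 1 : ℝ≥0) : ℝ≥0∞) * μ (iball ζ s) :=
      (hC₂ ζ ζ s s hs (by simp)).trans (by gcongr; simp)
    have h2 := inv_le_mul_inv (by positivity) h1
    rw [ENNReal.mul_inv (Or.inr (bball_coe ζ s ▸ (h.codim.bball_lt_top h.doubling h.pos ζ s).ne))
      (Or.inl ENNReal.ofReal_ne_top), ← ENNReal.ofReal_inv_of_pos (by positivity)] at h2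
    rw [bdryEnergy, scaledEnergy, setLIntegral_indicator hG]
    calc _ ≤ ENNReal.ofReal (s ^ p) * (((C₂ + 1 : ℝ≥0) : ℝ≥0∞) *
          (ENNReal.ofReal (s ^ θ)⁻¹ * (ν (Metric.ball ζ s))⁻¹)) *
          ∫⁻ x in iball ζ (Λ * s) ∩ G, g x ^ p ∂μ := by gcongr
      _ = ((C₂ + 1) * (ENNReal.ofReal (s ^ p) * ENNReal.ofReal (s ^ θ)⁻¹)) *
          ((ν (Metric.ball ζ s))⁻¹ * ∫⁻ x in iball ζ (Λ * s) ∩ G, g x ^ p ∂μ) := by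
        push_cast; ring
      _ = _ := by
        rw [← ENNReal.ofReal_mul (by positivity), Real.rpow_sub hs, div_eq_mul_inv, inter_comm]
        rfl
  calc ∫⁻ ζ, bdryEnergy p μ g Λ s G ζ ∂ν
      ≤ ((C₂ + 1) * ENNReal.ofReal (s ^ (p - θ))) * ∫⁻ ζ : boundary Ω, ((ν (Metric.ball ζ s))⁻¹ *
        ∫⁻ y in {y : Ω | dist (y : UniformSpace.Completion Ω) ζ < Λ * s},
          G.indicator (fun x => g x ^ p) y ∂μ) ∂ν := by
        rw [← lintegral_const_mul' _ _ (by finiteness)]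
        exact lintegral_mono key
    _ ≤ ((C₂ + 1) * ENNReal.ofReal (s ^ (p - θ))) *
        (C₁ * ∫⁻ y, G.indicator (fun x => g x ^ p) y ∂μ) := by
        gcongr; exact hC₁ s hs _ hf
    _ = _ := by rw [lintegral_indicator hG]; push_cast; ring

/-- The weighted sum of the boundary energies over dyadic scales. -/
noncomputable def multiscaleEnergy (p θ : ℝ) (μ : Measure Ω) (g : Ω → ℝ≥0∞) (Λ r : ℝ)
    (G : ℕ → Set Ω) (ζ : boundary Ω) : ℝ≥0∞ :=
  ∑' k, (scaleRatio p θ)⁻¹ ^ k * bdryEnergy p μ g Λ ((1 / 2) ^ k * r) (G k) ζ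

theorem TraceSetting.measurable_multiscaleEnergy (h : TraceSetting p θ μ ν) {g : Ω → ℝ≥0∞}
    (hg : Measurable g) (Λ r : ℝ) {G : ℕ → Set Ω} (hG : ∀ k, MeasurableSet (G k)) :
    Measurable (multiscaleEnergy p θ μ g Λ r G) :=
  Measurable.tsum fun k => (h.measurable_bdryEnergy hg Λ _ (hG k)).const_mul _

theorem TraceSetting.lintegral_multiscaleEnergy_le (h : TraceSetting p θ μ ν) (Λ : ℝ) :
    ∃ C : ℝ≥0, ∀ r : ℝ, 0 < r → ∀ g : Ω → ℝ≥0∞, Measurable g →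
      ∀ G : ℕ → Set Ω, (∀ k, MeasurableSet (G k)) →
      ∫⁻ ζ, multiscaleEnergy p θ μ g Λ r G ζ ∂ν ≤
        C * ENNReal.ofReal (r ^ (p - θ)) *
          ∑' k, scaleRatio p θ ^ k * ∫⁻ x in G k, g x ^ p ∂μ := by
  obtain ⟨C, hC⟩ := h.lintegral_bdryEnergy_le Λ
  refine ⟨C, fun r hr g hg G hG => ?_⟩
  unfold multiscaleEnergy
  rw [lintegral_tsum fun k => ((h.measurable_bdryEnergy hg Λ _ (hG k)).const_mul _).aemeasurable,
    ← ENNReal.tsum_mul_left]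
  refine ENNReal.tsum_le_tsum fun k => ?_
  rw [lintegral_const_mul _ (h.measurable_bdryEnergy hg Λ _ (hG k))]
  calc _ ≤ (scaleRatio p θ)⁻¹ ^ k * (C * ENNReal.ofReal (((1 / 2) ^ k * r) ^ (p - θ)) *
        ∫⁻ x in G k, g x ^ p ∂μ) := by
        gcongr; exact hC _ (by positivity) g hg _ (hG k)
    _ = C * ((scaleRatio p θ)⁻¹ ^ k * ENNReal.ofReal (((1 / 2) ^ k * r) ^ (p - θ))) *
        ∫⁻ x in G k, g x ^ p ∂μ := by ring
    _ = _ := by rw [scaleRatio_inv_pow_mul p θ hr]; ring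

theorem tsum_bdryEnergy_rpow_le (hp : 1 ≤ p) (g : Ω → ℝ≥0∞) (Λ r : ℝ) (G : ℕ → Set Ω)
    (ζ : boundary Ω) :
    ∑' k, bdryEnergy p μ g Λ ((1 / 2) ^ k * r) (G k) ζ ^ (1 / p) ≤
      (1 - scaleRatio p θ ^ (1 / p))⁻¹ * multiscaleEnergy p θ μ g Λ r G ζ ^ (1 / p) :=
  tsum_rpow_le hp (scaleRatio_ne_zero p θ) (scaleRatio_ne_top p θ) _

theorem scaleRatio_const_ne_top (hp : 1 ≤ p) (hθ : θ < p) :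
    (1 - scaleRatio p θ ^ (1 / p))⁻¹ ≠ ∞ :=
  ENNReal.inv_ne_top.2 (tsub_pos_of_lt
    (ENNReal.rpow_lt_one (scaleRatio_lt_one hθ) (by positivity))).ne'

end Energy

theorem setLAverage_enorm_sub_le {Z : Type*} [MeasurableSpace Z] {μ : Measure Z} {u : Z → ℝ}
    {A : Set Z} (h0 : μ A ≠ 0) (ht : μ A ≠ ∞) (c m : ℝ) :
    ⨍⁻ x in A, ‖u x - c‖ₑ ∂μ ≤ ⨍⁻ x in A, ‖u x - m‖ₑ ∂μ + ‖m - c‖ₑ := by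
  calc ⨍⁻ x in A, ‖u x - c‖ₑ ∂μ ≤ ⨍⁻ x in A, (‖u x - m‖ₑ + ‖m - c‖ₑ) ∂μ := by
        refine lintegral_mono fun x => ?_
        calc ‖u x - c‖ₑ = ‖(u x - m) + (m - c)‖ₑ := by congr 1; ring
          _ ≤ _ := enorm_add_le _ _
    _ = _ := by
        rw [laverage, lintegral_add_right _ measurable_const]
        congr 1
        exact setLAverage_const_enorm h0 ht _

/-! ### Existence and uniqueness of traces. -/

section Trace

variable {Ω : Type*} [MetricSpace Ω] [MeasurableSpace Ω] [BorelSpace Ω]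
  [MeasurableSpace (boundary Ω)] [BorelSpace (boundary Ω)]
  {μ : Measure Ω} {ν : Measure (boundary Ω)} {p θ : ℝ}

/-- `c` is the trace of `u` at the boundary point `ζ`. -/
def HasTraceAt (μ : Measure Ω) (u : Ω → ℝ) (ζ : boundary Ω) (c : ℝ) : Prop :=
  Tendsto (fun r : ℝ => ⨍⁻ x in innerBall ζ r, ‖u x - c‖ₑ ∂μ) (𝓝[>] 0) (𝓝 0)

/-- The sets `A n` need only be large in shrinking balls about `ζ`; in the applications to chaining
and to the extension they are corkscrew balls, away from the boundary. -/
theorem HasTraceAt.tendsto_average {u : Ω → ℝ} {ζ : boundary Ω} {c : ℝ} (hμ : IsDoubling μ)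
    (hu : ∀ r, IntegrableOn u (iball ζ r) μ) (hc : HasTraceAt μ u ζ c) {K : ℝ≥0}
    {r : ℕ → ℝ} (hr : ∀ n, 0 < r n) (hr0 : Tendsto r atTop (𝓝 0)) {A : ℕ → Set Ω}
    (hA : ∀ n, A n ⊆ iball ζ (r n)) (hK : ∀ n, μ (iball ζ (r n)) ≤ K * μ (A n)) :
    Tendsto (fun n => ⨍ x in A n, u x ∂μ) atTop (𝓝 c) := by
  have hr' : Tendsto r atTop (𝓝[>] 0) :=
    tendsto_nhdsWithin_iff.2 ⟨hr0, Eventually.of_forall hr⟩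
  have h1 := ENNReal.Tendsto.const_mul (a := (K : ℝ≥0∞)) (hc.comp hr')
    (Or.inr ENNReal.coe_ne_top)
  rw [mul_zero] at h1
  rw [tendsto_iff_edist_tendsto_0]
  refine tendsto_of_tendsto_of_tendsto_of_le_of_le tendsto_const_nhds h1 (fun _ => zero_le)
    fun n => ?_
  simp only [edist_eq_enorm_sub]
  exact enorm_setAverage_sub_le_mul (hu _) (hA n) (hK n) (hμ.iball_pos _ (hr n)).ne'
    (hμ.iball_lt_top _ _).ne c

theorem HasTraceAt.unique {u : Ω → ℝ} {ζ : boundary Ω} {c c' : ℝ} (hμ : IsDoubling μ)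
    (hu : ∀ r, IntegrableOn u (iball ζ r) μ)
    (hc : HasTraceAt μ u ζ c) (hc' : HasTraceAt μ u ζ c') : c = c' := by
  have hr0 : Tendsto (fun n : ℕ => ((1 : ℝ) / 2) ^ n) atTop (𝓝 0) :=
    tendsto_pow_atTop_nhds_zero_of_lt_one (by norm_num) (by norm_num)
  have key : ∀ {c}, HasTraceAt μ u ζ c → Tendsto
      (fun n : ℕ => ⨍ x in iball (ζ : UniformSpace.Completion Ω) ((1 / 2) ^ n), u x ∂μ)
      atTop (𝓝 c) := fun h =>
    h.tendsto_average hμ hu (K := 1) (r := fun n => (1 / 2) ^ n) (fun n => by positivity) hr0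
      (fun n => Subset.rfl) (fun n => by simp)
  exact tendsto_nhds_unique (key hc) (key hc')

theorem HasTraceAt.add {u v : Ω → ℝ} {ζ : boundary Ω} {c d : ℝ}
    (hu : AEMeasurable u μ) (hc : HasTraceAt μ u ζ c) (hd : HasTraceAt μ v ζ d) :
    HasTraceAt μ (u + v) ζ (c + d) := by
  have h := Tendsto.add hc hd
  rw [add_zero] at h
  refine tendsto_of_tendsto_of_tendsto_of_le_of_le tendsto_const_nhds h (fun _ => zero_le)
    fun r => ?_
  dsimp only
  rw [laverage, laverage, laverage, ← lintegral_add_left']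
  · refine lintegral_mono fun x => ?_
    calc ‖(u + v) x - (c + d)‖ₑ = ‖(u x - c) + (v x - d)‖ₑ := by
          simp only [Pi.add_apply]; congr 1; ring
      _ ≤ _ := enorm_add_le _ _
  · exact ((hu.restrict.sub_const c).enorm).smul_measure _

theorem HasTraceAt.const_smul {u : Ω → ℝ} {ζ : boundary Ω} {c : ℝ} (a : ℝ)
    (hc : HasTraceAt μ u ζ c) : HasTraceAt μ (a • u) ζ (a * c) := by
  have h := ENNReal.Tendsto.const_mul (a := ‖a‖ₑ) hc (Or.inr enorm_ne_top)
  rw [mul_zero] at h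
  refine h.congr fun r => ?_
  rw [laverage, laverage, ← lintegral_const_mul' _ _ enorm_ne_top]
  refine lintegral_congr fun x => ?_
  rw [← enorm_mul]
  simp [mul_sub]

theorem TraceSetting.integrableOn_iball (h : TraceSetting p θ μ ν) {u : Ω → ℝ}
    (hu : u ∈ dirichletSpace p μ) (a : UniformSpace.Completion Ω) (r : ℝ) :
    IntegrableOn u (iball a r) μ :=
  integrableOn_iball_of_mem_dirichletSpace h.one_le h.doubling h.poincare hu a r

/-- Oscillation of the means over dyadic balls centred at the boundary. -/
theorem TraceSetting.exists_average_iball_sub_le (h : TraceSetting p θ μ ν) :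
    ∃ (Λ : ℝ) (C : ℝ≥0), ∀ u ∈ dirichletSpace p μ, ∀ g, IsUpperGradient u g →
      ∀ (ζ : boundary Ω) (s : ℝ), 0 < s →
        ‖⨍ x in iball ζ s, u x ∂μ - ⨍ x in iball ζ (s / 2), u x ∂μ‖ₑ ≤
          C * bdryEnergy p μ g Λ s univ ζ ^ (1 / p) ∧
        ⨍⁻ x in iball ζ s, ‖u x - ⨍ y in iball ζ s, u y ∂μ‖ₑ ∂μ ≤
          C * bdryEnergy p μ g Λ s univ ζ ^ (1 / p) := by
  obtain ⟨Λ, hΛ, hPI⟩ := h.poincare.exists_average_sub_le h.one_le h.doubling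
  -- With `z` in Ω within `s` of `ζ`, the ball `B(z, 2s)` contains both balls about `ζ`; the smaller
  -- has radius `s / 2`, and `s + 2 * s = 6 * (s / 2)`.
  obtain ⟨C₀, hC₀⟩ := h.doubling.iball_le 6
  obtain ⟨C, hC⟩ := hPI (C₀ + 2)
  refine ⟨2 * Λ + 1, C, fun u hu g hg ζ s hs => ?_⟩
  obtain ⟨z, hz⟩ := exists_coe_near (ζ : UniformSpace.Completion Ω) hs
  have hz' : dist (ζ : UniformSpace.Completion Ω) z < s := by rwa [dist_comm]
  have hle : ∀ m : ℝ≥0∞, (C₀ : ℝ≥0∞) * m ≤ ((C₀ + 2 : ℝ≥0) : ℝ≥0∞) * m := fun m => by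
    gcongr; simp
  refine hC u hu g hg z (2 * s) s _ _ _ _ (by positivity) hs ?_ ?_ ?_ ?_ ?_ ?_ ?_
  · push_cast; nlinarith [C₀.coe_nonneg]
  · rw [← iball_coe]
    exact (hC₀ _ _ _ _ (by positivity) (by linarith)).trans (hle _)
  · rw [inter_univ, ← iball_coe]
    exact iball_subset (by nlinarith)
  · rw [← iball_coe]; exact iball_subset (by linarith)
  · rw [← iball_coe]; exact iball_subset (by linarith)
  · rw [← iball_coe]
    exact (hC₀ _ _ _ _ (by positivity) (by linarith)).trans (hle _)
  · rw [← iball_coe]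
    exact (hC₀ _ _ _ _ (by positivity) (by linarith)).trans (hle _)

theorem TraceSetting.measurable_average_iball (h : TraceSetting p θ μ ν) {u : Ω → ℝ}
    (hu : AEMeasurable u μ) (s : ℝ) :
    Measurable fun ζ : boundary Ω => ⨍ x in iball ζ s, u x ∂μ := by
  have := h.doubling.properSpace
  have := h.doubling.secondCountableTopology
  have := h.doubling.sigmaFinite
  have hset := measurableSet_dist_lt (UniformSpace.Completion.continuous_coe Ω) s
  have h1 : Measurable fun ζ : boundary Ω => μ (iball ζ s) := measurable_measure_prodMk_left hset
  have h2 : Measurable fun ζ : boundary Ω => ∫ x in iball ζ s, u x ∂μ := by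
    have h3 : StronglyMeasurable (Function.uncurry fun (ζ : boundary Ω) (x : Ω) =>
        {q : boundary Ω × Ω | dist (q.2 : UniformSpace.Completion Ω)
          (q.1 : UniformSpace.Completion Ω) < s}.indicator (fun q => hu.mk u q.2) (ζ, x)) :=
      ((hu.measurable_mk.comp measurable_snd).indicator hset).stronglyMeasurable
    refine (congrArg Measurable (funext fun ζ => ?_)).mpr
      (h3.integral_prod_right (ν := μ)).measurable
    rw [integral_congr_ae (ae_restrict_of_ae hu.ae_eq_mk),
      ← integral_indicator (measurableSet_iball _ _)]
    rfl
  simp_rw [setAverage_eq, smul_eq_mul]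
  exact (h1.ennreal_toReal.inv).mul h2

/-- The multiscale energy from scale `1` downwards has finite ν-integral, so it is finite a.e.;
there the increments of the dyadic means are summable, and the oscillations about these means tend
to zero as well. -/
theorem TraceSetting.exists_trace (h : TraceSetting p θ μ ν) {u : Ω → ℝ}
    (hu : u ∈ dirichletSpace p μ) :
    ∃ f : boundary Ω →ₘ[ν] ℝ, ∀ᵐ ζ ∂ν, HasTraceAt μ u ζ (f ζ) := by
  have hp0 : 0 < 1 / p := one_div_pos.2 h.pos_p
  obtain ⟨hum, g, hg, hgt⟩ := (mem_dirichletSpace_iff h.one_le).1 hu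
  obtain ⟨Λ, C, hosc⟩ := h.exists_average_iball_sub_le
  obtain ⟨C₁, hC₁⟩ := h.lintegral_multiscaleEnergy_le Λ
  obtain ⟨C₂, hC₂⟩ := h.doubling.iball_le 2
  set S := multiscaleEnergy p θ μ g Λ 1 (fun _ => univ)
  have hS : ∀ᵐ ζ ∂ν, S ζ < ∞ := by
    refine ae_lt_top (h.measurable_multiscaleEnergy hg.1 Λ 1 fun _ => MeasurableSet.univ) ?_
    refine ne_top_of_le_ne_top ?_ (hC₁ 1 one_pos g hg.1 _ fun _ => MeasurableSet.univ)
    rw [ENNReal.tsum_mul_right, setLIntegral_univ]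
    exact ENNReal.mul_ne_top (by finiteness)
      (ENNReal.mul_ne_top (tsum_scaleRatio_ne_top h.lt) hgt.ne)
  let d : boundary Ω → ℕ → ℝ≥0∞ := fun ζ k =>
    C * bdryEnergy p μ g Λ ((1 / 2) ^ k) univ ζ ^ (1 / p)
  have hd : ∀ ζ, S ζ < ∞ → ∑' k, d ζ k ≠ ∞ := by
    intro ζ hζ
    rw [ENNReal.tsum_mul_left]
    refine ENNReal.mul_ne_top ENNReal.coe_ne_top ?_
    have := tsum_bdryEnergy_rpow_le (μ := μ) (θ := θ) h.one_le g Λ 1 (fun _ => univ) ζ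
    simp only [mul_one] at this
    exact ne_top_of_le_ne_top (ENNReal.mul_ne_top (scaleRatio_const_ne_top h.one_le h.lt)
      (ENNReal.rpow_lt_top_of_nonneg hp0.le hζ.ne).ne) this
  let a : ℕ → boundary Ω → ℝ := fun k ζ => ⨍ x in iball ζ ((1 / 2) ^ k), u x ∂μ
  have hdiff : ∀ ζ k, edist (a k ζ) (a (k + 1) ζ) ≤ d ζ k := by
    intro ζ k
    rw [edist_eq_enorm_sub]
    have := (hosc u hu g hg ζ ((1 / 2) ^ k) (by positivity)).1
    rwa [show ((1 : ℝ) / 2) ^ k / 2 = (1 / 2) ^ (k + 1) by ring] at this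
  obtain ⟨f, hfm, hf⟩ := measurable_limit_of_tendsto_metrizable_ae (μ := ν) (f := a) (L := atTop)
    (fun k => (h.measurable_average_iball hum _).aemeasurable)
    (hS.mono fun ζ hζ => cauchySeq_tendsto_of_complete
      (cauchySeq_of_edist_le_of_tsum_ne_top (d ζ) (hdiff ζ) (hd ζ hζ)))
  refine ⟨AEEqFun.mk f hfm.aestronglyMeasurable, ?_⟩
  filter_upwards [hS, hf, AEEqFun.coeFn_mk f hfm.aestronglyMeasurable] with ζ hζ hfζ hmk
  rw [hmk]
  have hpos : ∀ n : ℕ, (0 : ℝ) < (1 / 2) ^ n := fun n => by positivity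
  have ht1 : Tendsto (fun k => C₂ * (d ζ k + ‖a k ζ - f ζ‖ₑ)) atTop (𝓝 0) := by
    have h1 := ENNReal.tendsto_atTop_zero_of_tsum_ne_top (hd ζ hζ)
    have h2 := tendsto_iff_edist_tendsto_0.1 hfζ
    simp only [edist_eq_enorm_sub] at h2
    simpa using ENNReal.Tendsto.const_mul (a := (C₂ : ℝ≥0∞)) (h1.add h2)
      (Or.inr ENNReal.coe_ne_top)
  refine tendsto_nhdsGT_zero_of_pow_half ht1 fun r n hn1 hn2 => ?_
  have hr : 0 < r := (hpos _).trans hn1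
  have hB0 := (h.doubling.iball_pos (ζ : UniformSpace.Completion Ω) (hpos n)).ne'
  have hBt := (h.doubling.iball_lt_top (ζ : UniformSpace.Completion Ω) ((1 / 2) ^ n)).ne
  calc ⨍⁻ x in iball ζ r, ‖u x - f ζ‖ₑ ∂μ
      ≤ C₂ * ⨍⁻ x in iball ζ ((1 / 2) ^ n), ‖u x - f ζ‖ₑ ∂μ := by
        refine setLAverage_le_of_subset (iball_subset (by simpa using hn2))
          (hC₂ _ _ _ _ hr ?_) hB0 hBt
        rw [pow_succ] at hn1
        rw [dist_self]; linarith
    _ ≤ C₂ * (⨍⁻ x in iball ζ ((1 / 2) ^ n), ‖u x - a n ζ‖ₑ ∂μ + ‖a n ζ - f ζ‖ₑ) := by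
        gcongr; exact setLAverage_enorm_sub_le hB0 hBt _ _
    _ ≤ _ := by gcongr; exact (hosc u hu g hg ζ _ (hpos n)).2

end Trace

/-! ### Corkscrew points and chains of balls along uniform curves. -/

theorem RectifiableCurve.dist_le {Z : Type*} [PseudoMetricSpace Z] (γ : RectifiableCurve Z)
    {s t : ℝ} (hs : s ∈ Icc 0 γ.length) (ht : t ∈ Icc 0 γ.length) (hst : s ≤ t) :
    dist (γ.toFun s) (γ.toFun t) ≤ t - s := by
  have h := γ.unitSpeed hs ht
  have h2 : edist (γ.toFun s) (γ.toFun t) ≤ ENNReal.ofReal (t - s) := by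
    calc _ ≤ eVariationOn γ.toFun (Icc 0 γ.length ∩ Icc s t) :=
          eVariationOn.edist_le _ ⟨hs, left_mem_Icc.2 hst⟩ ⟨ht, right_mem_Icc.2 hst⟩
      _ = _ := by rw [h]; simp
  rw [edist_dist] at h2
  exact (ENNReal.ofReal_le_ofReal_iff (by linarith)).1 h2

theorem enorm_sub_le_add {a c : ℝ} (b : ℝ) : ‖a - c‖ₑ ≤ ‖a - b‖ₑ + ‖b - c‖ₑ := by
  simpa only [edist_eq_enorm_sub] using edist_triangle a b c

/-- The points whose distance to the boundary is comparable to `s`. -/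
def bdryLayer (Ω : Type*) [MetricSpace Ω] (K s : ℝ) : Set Ω :=
  {z | s / K ≤ bdryDist z ∧ bdryDist z ≤ K * s}

theorem measurableSet_bdryLayer {Ω : Type*} [MetricSpace Ω] [MeasurableSpace Ω] [BorelSpace Ω] (K s : ℝ) :
    MeasurableSet (bdryLayer Ω K s) :=
  ((isClosed_le continuous_const continuous_bdryDist).inter
    (isClosed_le continuous_bdryDist continuous_const)).measurableSet

section Chains

variable {Ω : Type*} [MetricSpace Ω] [MeasurableSpace Ω] [BorelSpace Ω]
  [MeasurableSpace (boundary Ω)] [BorelSpace (boundary Ω)]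
  {μ : Measure Ω} {ν : Measure (boundary Ω)} {p θ : ℝ}

/-- Existence of corkscrew points. -/
theorem IsUniformDomain.exists_corkscrew (hu : IsUniformDomain Ω)
    (hunb : ¬ Bornology.IsBounded (univ : Set Ω)) :
    ∃ c : ℝ, 0 < c ∧ c ≤ 1 ∧ ∀ (ζ : boundary Ω) (r : ℝ), 0 < r →
      ∃ x : Ω, dist (x : UniformSpace.Completion Ω) ζ < r ∧ c * r ≤ bdryDist x := by
  obtain ⟨A, hA, h⟩ := hu
  refine ⟨1 / (2 * A), by positivity, by rw [div_le_one (by positivity)]; linarith,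
    fun ζ r hr => ?_⟩
  -- Unboundedness provides a point `y` at distance at least `r` from `x`. On a uniform curve to
  -- `y`, the point reached after length `r / 2` is still near `ζ`, and both subcurves there have
  -- length at least `r / 2`.
  obtain ⟨x, hx⟩ := exists_coe_near (ζ : UniformSpace.Completion Ω) (r := r / 4) (by positivity)
  obtain ⟨y, hy⟩ : ∃ y : Ω, r ≤ dist x y := by
    by_contra! hcon
    exact hunb ((Metric.isBounded_ball (x := x) (r := r)).subset fun y _ => by
      rw [Metric.mem_ball, dist_comm]; exact hcon y)
  obtain ⟨γ, hγx, hγy, -, hγ⟩ := h x y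
  have h0 : (0 : ℝ) ∈ Icc 0 γ.length := left_mem_Icc.2 γ.length_nonneg
  have h1 : γ.length ∈ Icc 0 γ.length := right_mem_Icc.2 γ.length_nonneg
  have hL : r ≤ γ.length := by
    have := γ.dist_le h0 h1 γ.length_nonneg
    rw [show γ.toFun 0 = x from hγx, show γ.toFun γ.length = y from hγy] at this
    linarith
  have ht : r / 2 ∈ Icc 0 γ.length := ⟨by positivity, by linarith⟩
  refine ⟨γ.toFun (r / 2), ?_, ?_⟩
  · have h2 := γ.dist_le h0 ht (by positivity)
    rw [show γ.toFun 0 = x from hγx, dist_comm, ← UniformSpace.Completion.dist_eq] at h2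
    have := dist_triangle (γ.toFun (r / 2) : UniformSpace.Completion Ω) x ζ
    linarith
  · have h2 := hγ _ ht
    have h3 : r / 2 ≤ min (r / 2) (γ.length - r / 2) := le_min le_rfl (by linarith)
    have h4 := h3.trans h2
    rw [div_mul_eq_mul_div, one_mul, div_le_iff₀ (by positivity)]
    linarith

/-- Uniform curves between points far from the boundary stay far from the boundary. -/
theorem le_bdryDist_of_uniform {A δ : ℝ} (hA : 1 ≤ A) {x y : Ω} {γ : RectifiableCurve Ω}
    (hx : γ.source = x) (hy : γ.target = y) (hδx : 2 * δ ≤ bdryDist x) (hδy : 2 * δ ≤ bdryDist y)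
    (hδ : 0 < δ) {t : ℝ} (ht : t ∈ Icc 0 γ.length)
    (hγ : min t (γ.length - t) ≤ A * bdryDist (γ.toFun t)) : δ / A ≤ bdryDist (γ.toFun t) := by
  have h0 : (0 : ℝ) ∈ Icc 0 γ.length := left_mem_Icc.2 γ.length_nonneg
  have h1 : γ.length ∈ Icc 0 γ.length := right_mem_Icc.2 γ.length_nonneg
  have hδA : δ / A ≤ δ := div_le_self hδ.le hA
  -- Either both subcurves have length at least `δ` and uniformity applies, or the point is within
  -- `δ` of an endpoint whose distance to the boundary is at least `2 * δ`.
  rcases le_or_gt δ (min t (γ.length - t)) with h | h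
  · rw [div_le_iff₀ (by positivity)]; linarith
  · rcases min_lt_iff.1 h with h | h
    · have h2 := γ.dist_le h0 ht ht.1
      rw [show γ.toFun 0 = x from hx] at h2
      have := bdryDist_le_add x (γ.toFun t)
      linarith
    · have h2 := γ.dist_le ht h1 ht.2
      rw [show γ.toFun γ.length = y from hy, dist_comm] at h2
      have := bdryDist_le_add y (γ.toFun t)
      linarith

/-- Chaining the Poincaré inequality along uniform curves. -/
theorem TraceSetting.exists_average_sub_le (h : TraceSetting p θ μ ν) {K : ℝ} (hK : 1 ≤ K) :
    ∃ (K' : ℝ) (C : ℝ≥0), 1 ≤ K' ∧ ∀ u ∈ dirichletSpace p μ, ∀ g, IsUpperGradient u g →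
      ∀ (ζ : boundary Ω) (s : ℝ) (x y : Ω), 0 < s →
        dist (x : UniformSpace.Completion Ω) ζ ≤ K * s →
        dist (y : UniformSpace.Completion Ω) ζ ≤ K * s →
        s / K ≤ bdryDist x → s / K ≤ bdryDist y →
        ‖⨍ z in Metric.ball x (s / K'), u z ∂μ - ⨍ z in Metric.ball y (s / K'), u z ∂μ‖ₑ ≤
          C * bdryEnergy p μ g K' s (bdryLayer Ω K' s) ζ ^ (1 / p) ∧
        ‖⨍ z in Metric.ball x (s / K'), u z ∂μ - ⨍ z in Metric.ball x (s / K' / 2), u z ∂μ‖ₑ ≤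
          C * bdryEnergy p μ g K' s (bdryLayer Ω K' s) ζ ^ (1 / p) := by
  obtain ⟨Λ, hΛ, hPI⟩ := h.poincare.exists_average_sub_le h.one_le h.doubling
  obtain ⟨A, hA, hunif⟩ := h.uniform
  -- With `ρ = s / K'`, the enlarged Poincaré ball of radius `Λ * (2 * ρ)` has radius `s / (4 * K *
  -- A)`, half of the lower bound `s / (2 * K * A)` for the distance to the boundary along the
  -- curve. It therefore stays inside the layer.
  obtain ⟨K', hK'⟩ : ∃ K', K' = 8 * K * A * Λ := ⟨_, rfl⟩
  have hKA : 1 ≤ K * A := one_le_mul_of_one_le_of_one_le hK hA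
  have hK'1 : 8 * (K * A) ≤ K' := by rw [hK']; nlinarith
  have hK'0 : 0 < K' := by linarith
  obtain ⟨C₀, hC₀⟩ := h.doubling.iball_le ((K' + 1) * K' + 4)
  obtain ⟨C, hC⟩ := hPI (C₀ + 2)
  -- The curve has length at most `2 * A * K * s`, so this many steps have length at most `ρ` each;
  -- the number does not depend on the scale or on the points.
  obtain ⟨N, hN⟩ := exists_nat_gt (2 * A * K * K')
  have hN0 : (0 : ℝ) < N := lt_trans (by positivity) hN
  refine ⟨K', (N + 1) * C, by linarith, fun u hu g hg ζ s x y hs hx hy hdx hdy => ?_⟩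
  set E := bdryEnergy p μ g K' s (bdryLayer Ω K' s) ζ ^ (1 / p)
  obtain ⟨γ, hγx, hγy, hL, hγ⟩ := hunif x y
  have h0 : (0 : ℝ) ∈ Icc 0 γ.length := left_mem_Icc.2 γ.length_nonneg
  obtain ⟨ρ, hρ⟩ : ∃ ρ, ρ = s / K' := ⟨_, rfl⟩
  have hρ0 : 0 < ρ := by rw [hρ]; positivity
  have hsρ : s = K' * ρ := by rw [hρ]; field_simp
  have hle : ∀ m : ℝ≥0∞, (C₀ : ℝ≥0∞) * m ≤ ((C₀ + 2 : ℝ≥0) : ℝ≥0∞) * m := fun m => by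
    gcongr; simp
  have hxy : dist x y ≤ 2 * K * s := by
    rw [← UniformSpace.Completion.dist_eq]
    have := dist_triangle_right (x : UniformSpace.Completion Ω) y ζ
    linarith
  have hL' : γ.length ≤ 2 * A * K * s := by
    calc _ ≤ A * dist x y := hL
      _ ≤ A * (2 * K * s) := by gcongr
      _ = _ := by ring
  -- one step of the chain
  have step : ∀ t ∈ Icc 0 γ.length, ∀ (w : Ω) (τ : ℝ), dist w (γ.toFun t) ≤ ρ → ρ / 2 ≤ τ → τ ≤ ρ →
      ‖⨍ z in Metric.ball (γ.toFun t) ρ, u z ∂μ - ⨍ z in Metric.ball w τ, u z ∂μ‖ₑ ≤ C * E := by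
    intro t ht w τ hw hτ1 hτ2
    have hz1 : s / (2 * K) / A ≤ bdryDist (γ.toFun t) :=
      le_bdryDist_of_uniform hA hγx hγy (by convert hdx using 1; field_simp)
        (by convert hdy using 1; field_simp) (by positivity) ht (hγ t ht)
    have hz2 : dist (γ.toFun t : UniformSpace.Completion Ω) ζ ≤ 2 * A * K * s + K * s := by
      have h2 := γ.dist_le h0 ht ht.1
      rw [show γ.toFun 0 = x from hγx, dist_comm, ← UniformSpace.Completion.dist_eq] at h2
      have := dist_triangle (γ.toFun t : UniformSpace.Completion Ω) x ζ
      linarith [ht.2]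
    have hz2' : dist (γ.toFun t : UniformSpace.Completion Ω) ζ ≤ 3 * (K * A) * s := by
      nlinarith [mul_le_mul_of_nonneg_right (mul_le_mul_of_nonneg_left hA (by linarith : 0 ≤ K))
        hs.le]
    have hz3 : dist (γ.toFun t : UniformSpace.Completion Ω) ζ ≤ K' * s := by
      refine hz2'.trans ?_
      gcongr
      linarith
    have hΛρ : Λ * (2 * ρ) = s / (4 * (K * A)) := by rw [hρ, hK']; field_simp; norm_num
    refine (hC u hu g hg (γ.toFun t) (2 * ρ) s _ _ _ _ (by positivity) hs ?_ ?_ ?_ ?_ ?_ ?_ ?_).1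
    · push_cast
      rw [hsρ]
      have : ρ ≤ K' * ρ := le_mul_of_one_le_left hρ0.le (by linarith)
      nlinarith [C₀.coe_nonneg, mul_nonneg C₀.coe_nonneg (this.trans' hρ0.le)]
    · rw [← iball_coe]
      refine (hC₀ _ _ _ _ (by positivity) ?_).trans (hle _)
      calc _ ≤ K' * s + s := by gcongr
        _ = (K' + 1) * K' * ρ := by rw [hsρ]; ring
        _ ≤ _ := by nlinarith [mul_pos (mul_pos (by linarith : 0 < K' + 1) hK'0) hρ0]
    · rw [hΛρ]
      intro w' hw'
      rw [Metric.mem_ball] at hw'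
      have h1 := bdryDist_le_add (γ.toFun t) w'
      rw [dist_comm] at h1
      have h2 : s / (2 * K) / A = s / (4 * (K * A)) + s / (4 * (K * A)) := by field_simp; norm_num
      have h3 : s / K' ≤ s / (4 * (K * A)) := by gcongr; linarith
      have h4 : s / (4 * (K * A)) ≤ s := div_le_self hs.le (by linarith)
      have h5 : dist (w' : UniformSpace.Completion Ω) ζ < K' * s := by
        have := dist_triangle (w' : UniformSpace.Completion Ω) (γ.toFun t) ζ
        rw [UniformSpace.Completion.dist_eq] at this
        nlinarith [mul_le_mul_of_nonneg_right hK'1 hs.le, mul_le_mul_of_nonneg_right hKA hs.le]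
      exact ⟨h5, by linarith, (bdryDist_le w' ζ).trans h5.le⟩
    · exact Metric.ball_subset_ball (by linarith)
    · exact Metric.ball_subset_ball' (by linarith)
    · rw [← iball_coe, ← iball_coe]
      refine (hC₀ _ _ _ _ hρ0 ?_).trans (hle _)
      rw [dist_self]
      nlinarith [mul_pos (mul_pos (by linarith : 0 < K' + 1) hK'0) hρ0]
    · rw [← iball_coe, ← iball_coe]
      refine (hC₀ _ _ _ _ (by linarith) ?_).trans (hle _)
      rw [UniformSpace.Completion.dist_eq]
      nlinarith [mul_pos (mul_pos (by linarith : 0 < K' + 1) hK'0) hρ0,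
        mul_nonneg (mul_nonneg (by linarith : 0 ≤ K' + 1) hK'0.le)
          (by linarith : 0 ≤ τ - ρ / 2)]
  let v : ℕ → ℝ := fun j => ⨍ z in Metric.ball (γ.toFun (j * (γ.length / N))) ρ, u z ∂μ
  have hLN : γ.length / N ≤ ρ := by
    rw [div_le_iff₀ hN0]
    calc _ ≤ 2 * A * K * s := hL'
      _ = ρ * (2 * A * K * K') := by rw [hsρ]; ring
      _ ≤ ρ * N := by gcongr
  have hLN0 : 0 ≤ γ.length / N := div_nonneg γ.length_nonneg hN0.le
  have hmem : ∀ j : ℕ, j ≤ N → (j : ℝ) * (γ.length / N) ∈ Icc 0 γ.length := by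
    intro j hj
    refine ⟨by positivity, ?_⟩
    calc (j : ℝ) * (γ.length / N) ≤ N * (γ.length / N) := by gcongr
      _ = _ := by field_simp
  have chain : ∀ j : ℕ, j ≤ N → ‖v 0 - v j‖ₑ ≤ j * (C * E) := by
    intro j
    induction j with
    | zero => intro _; simp
    | succ j ih =>
      intro hj
      have h1 := ih (by omega)
      have h2 : ‖v j - v (j + 1)‖ₑ ≤ C * E := by
        refine step _ (hmem j (by omega)) _ ρ ?_ (by linarith) le_rfl
        rw [dist_comm]
        refine (γ.dist_le (hmem j (by omega)) (hmem (j + 1) hj) ?_).trans ?_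
        · gcongr; simp
        · push_cast; linarith
      calc ‖v 0 - v (j + 1)‖ₑ = ‖(v 0 - v j) + (v j - v (j + 1))‖ₑ := by congr 1; ring
        _ ≤ ‖v 0 - v j‖ₑ + ‖v j - v (j + 1)‖ₑ := enorm_add_le _ _
        _ ≤ j * (C * E) + C * E := add_le_add h1 h2
        _ = _ := by push_cast; ring
  rw [← hρ]
  have hv0 : v 0 = ⨍ z in Metric.ball x ρ, u z ∂μ := by
    simp only [v, Nat.cast_zero, zero_mul]
    rw [show γ.toFun 0 = x from hγx]
  have hvN : v N = ⨍ z in Metric.ball y ρ, u z ∂μ := by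
    simp only [v]
    rw [mul_div_cancel₀ _ hN0.ne', show γ.toFun γ.length = y from hγy]
  constructor
  · rw [← hv0, ← hvN]
    refine (chain N le_rfl).trans ?_
    rw [← mul_assoc]
    push_cast
    gcongr
    exact le_self_add
  -- Halving the radius at a fixed centre links the balls of one dyadic scale to those of the next.
  · have := step 0 h0 x (ρ / 2) (by rw [show γ.toFun 0 = x from hγx]; simpa using hρ0.le) le_rfl
      (by linarith)
    rw [show γ.toFun 0 = x from hγx] at this
    refine this.trans ?_
    push_cast
    calc C * E = 1 * C * E := by ring
      _ ≤ _ := by gcongr; exact le_add_self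

/-- The trace at a boundary point is close to the mean over an interior ball at scale `r`. -/
theorem TraceSetting.exists_trace_sub_average_le (h : TraceSetting p θ μ ν) :
    ∃ (K : ℝ) (C : ℝ≥0), 1 ≤ K ∧ ∀ u ∈ dirichletSpace p μ, ∀ g, IsUpperGradient u g →
      ∀ (ζ ξ : boundary Ω) (c c' r : ℝ), HasTraceAt μ u ζ c → HasTraceAt μ u ξ c' → 0 < r →
        dist ζ ξ < r →
        ‖c - c'‖ₑ ^ p ≤ C * (multiscaleEnergy p θ μ g K r (fun k => bdryLayer Ω K ((1 / 2) ^ k * r)) ζ +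
          multiscaleEnergy p θ μ g K r (fun k => bdryLayer Ω K ((1 / 2) ^ k * r)) ξ) := by
  have hp0 : 0 < p := h.pos_p
  obtain ⟨c₀, hc₀, hc₀1, hcork⟩ := h.uniform.exists_corkscrew h.unbounded
  have hK2 : 2 ≤ 2 / c₀ := by rw [le_div_iff₀ hc₀]; linarith
  -- A corkscrew point for the next scale `s / 2` has distance at least `c₀ * s / 2` to the
  -- boundary, so `2 / c₀` admits both it and the corkscrew point for `s` at scale `s`.
  obtain ⟨K, C, hK, hchain⟩ := h.exists_average_sub_le (K := 2 / c₀) (by linarith)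
  obtain ⟨C₁, hC₁⟩ := h.doubling.iball_le (4 * K)
  set q := (1 - scaleRatio p θ ^ (1 / p))⁻¹ with hq
  have hqt : q ≠ ∞ := scaleRatio_const_ne_top h.one_le h.lt
  have hQ : ((C : ℝ≥0∞) + 4 * C * q) * 2 ≠ ∞ := by finiteness
  obtain ⟨Q, hQ'⟩ : ∃ Q : ℝ≥0, (Q : ℝ≥0∞) = (((C : ℝ≥0∞) + 4 * C * q) * 2) ^ p :=
    ⟨_, ENNReal.coe_toNNReal (ENNReal.rpow_lt_top_of_nonneg hp0.le hQ).ne⟩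
  refine ⟨K, Q, hK, fun u hu g hg ζ ξ c c' r hc hc' hr hζξ => ?_⟩
  set S := multiscaleEnergy p θ μ g K r (fun k => bdryLayer Ω K ((1 / 2) ^ k * r)) with hS
  have key : ∀ (ζ : boundary Ω) (c : ℝ), HasTraceAt μ u ζ c → ∃ x : Ω,
      dist (x : UniformSpace.Completion Ω) ζ < r ∧ c₀ * r ≤ bdryDist x ∧
      ‖⨍ z in Metric.ball x (r / K), u z ∂μ - c‖ₑ ≤ 2 * C * q * S ζ ^ (1 / p) := by
    intro ζ c hc
    have hs : ∀ k : ℕ, 0 < (1 / 2) ^ k * r := fun k => by positivity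
    choose x hx1 hx2 using fun k : ℕ => hcork ζ ((1 / 2) ^ k * r) (hs k)
    let v : ℕ → ℝ := fun k => ⨍ z in Metric.ball (x k) ((1 / 2) ^ k * r / K), u z ∂μ
    have hlim : Tendsto v atTop (𝓝 c) := by
      refine hc.tendsto_average h.doubling (fun r => h.integrableOn_iball hu _ r) (K := C₁)
        (r := fun k => (1 / 2) ^ k * (2 * r)) (fun k => by positivity) ?_ ?_ ?_
      · simpa using (tendsto_pow_atTop_nhds_zero_of_lt_one (r := (1 / 2 : ℝ)) (by norm_num)
          (by norm_num)).mul_const (2 * r)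
      · intro k
        rw [← iball_coe]
        refine iball_subset ?_
        have : (1 / 2) ^ k * r / K ≤ (1 / 2) ^ k * r := div_le_self (hs k).le hK
        linarith [hx1 k]
      · intro k
        rw [← iball_coe]
        refine hC₁ _ _ _ _ (by have := hs k; positivity) ?_
        have : 4 * K * ((1 / 2) ^ k * r / K) = 4 * ((1 / 2) ^ k * r) := by field_simp
        rw [this]
        linarith [hx1 k, hs k]
    have hd : ∀ k, edist (v k) (v (k + 1)) ≤
        2 * C * bdryEnergy p μ g K ((1 / 2) ^ k * r) (bdryLayer Ω K ((1 / 2) ^ k * r)) ζ ^ (1 / p) := by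
      intro k
      have hk := hs k
      have hk1 := hx1 (k + 1)
      have hk2 := hx2 (k + 1)
      have e1 : ((1 : ℝ) / 2) ^ (k + 1) * r = (1 / 2) ^ k * r / 2 := by ring
      rw [e1] at hk1 hk2
      have e2 : (1 / 2) ^ k * r / (2 / c₀) = c₀ * ((1 / 2) ^ k * r / 2) := by field_simp
      have h1 : dist (x k : UniformSpace.Completion Ω) ζ ≤ 2 / c₀ * ((1 / 2) ^ k * r) := by
        nlinarith [hx1 k]
      have h2 : dist (x (k + 1) : UniformSpace.Completion Ω) ζ ≤ 2 / c₀ * ((1 / 2) ^ k * r) := by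
        nlinarith
      have h3 : (1 / 2) ^ k * r / (2 / c₀) ≤ bdryDist (x k) := by
        rw [e2]; nlinarith [hx2 k]
      have h4 : (1 / 2) ^ k * r / (2 / c₀) ≤ bdryDist (x (k + 1)) := by rw [e2]; exact hk2
      have c1 := (hchain u hu g hg ζ _ _ _ hk h1 h2 h3 h4).1
      have c2 := (hchain u hu g hg ζ _ _ _ hk h2 h2 h4 h4).2
      rw [edist_eq_enorm_sub]
      have e3 : v (k + 1) = ⨍ z in Metric.ball (x (k + 1)) ((1 / 2) ^ k * r / K / 2), u z ∂μ := by
        simp only [v]; rw [show ((1 : ℝ) / 2) ^ (k + 1) * r / K = (1 / 2) ^ k * r / K / 2 by ring]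
      rw [e3]
      refine (enorm_sub_le_add (⨍ z in Metric.ball (x (k + 1)) ((1 / 2) ^ k * r / K), u z ∂μ)).trans
        ((add_le_add c1 c2).trans (le_of_eq (by ring)))
    refine ⟨x 0, by simpa using hx1 0, by simpa using hx2 0, ?_⟩
    -- Telescoping from scale `r` down to the boundary: the means over corkscrew balls converge to
    -- the trace.
    have h1 := edist_le_tsum_of_edist_le_of_tendsto₀ _ hd hlim
    rw [ENNReal.tsum_mul_left, edist_eq_enorm_sub] at h1
    simp only [v, pow_zero, one_mul] at h1
    refine h1.trans ?_
    rw [mul_assoc (2 * (C : ℝ≥0∞)) q]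
    gcongr
    exact tsum_bdryEnergy_rpow_le h.one_le g K r _ ζ
  obtain ⟨x, hx1, hx2, hx⟩ := key ζ c hc
  obtain ⟨y, hy1, hy2, hy⟩ := key ξ c' hc'
  have e2 : r / (2 / c₀) = c₀ * r / 2 := by field_simp
  have hyζ : dist (y : UniformSpace.Completion Ω) ζ < 2 * r := by
    have h1 := dist_triangle (y : UniformSpace.Completion Ω) ξ ζ
    have h2 : dist (ξ : UniformSpace.Completion Ω) ζ < r := by rw [dist_comm]; exact hζξ
    linarith
  have hxy := (hchain u hu g hg ζ r x y hr (by nlinarith) (by nlinarith)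
    (by rw [e2]; nlinarith) (by rw [e2]; nlinarith)).1
  have hE0 : bdryEnergy p μ g K r (bdryLayer Ω K r) ζ ≤ S ζ := by
    have := ENNReal.le_tsum (f := fun k => (scaleRatio p θ)⁻¹ ^ k *
      bdryEnergy p μ g K ((1 / 2) ^ k * r) (bdryLayer Ω K ((1 / 2) ^ k * r)) ζ) 0
    simpa [hS, multiscaleEnergy] using this
  set X := (S ζ + S ξ) ^ (1 / p)
  have hX1 : S ζ ^ (1 / p) ≤ X :=
    ENNReal.rpow_le_rpow le_self_add (by positivity)
  have hX2 : S ξ ^ (1 / p) ≤ X :=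
    ENNReal.rpow_le_rpow le_add_self (by positivity)
  have htot : ‖c - c'‖ₑ ≤ ((C : ℝ≥0∞) + 4 * C * q) * 2 * X := by
    rw [enorm_sub_rev] at hx
    calc ‖c - c'‖ₑ ≤ ‖c - ⨍ z in Metric.ball x (r / K), u z ∂μ‖ₑ +
          ‖⨍ z in Metric.ball x (r / K), u z ∂μ - c'‖ₑ := enorm_sub_le_add _
      _ ≤ 2 * C * q * S ζ ^ (1 / p) + (C * bdryEnergy p μ g K r (bdryLayer Ω K r) ζ ^ (1 / p) +
          2 * C * q * S ξ ^ (1 / p)) :=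
        add_le_add hx ((enorm_sub_le_add (⨍ z in Metric.ball y (r / K), u z ∂μ)).trans
          (add_le_add hxy hy))
      _ ≤ 2 * C * q * X + (C * S ζ ^ (1 / p) + 2 * C * q * X) := by gcongr
      _ ≤ 2 * C * q * X + (C * X + 2 * C * q * X) := by gcongr
      _ = (C + 4 * C * q) * X * 1 := by ring
      _ ≤ (C + 4 * C * q) * X * 2 := by gcongr; exact one_le_two
      _ = _ := by ring
  calc ‖c - c'‖ₑ ^ p ≤ (((C : ℝ≥0∞) + 4 * C * q) * 2 * X) ^ p := by gcongr
    _ = Q * (S ζ + S ξ) := by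
      rw [ENNReal.mul_rpow_of_nonneg _ _ hp0.le, hQ', ← ENNReal.rpow_mul,
        one_div_mul_cancel hp0.ne', ENNReal.rpow_one]

end Chains

/-! ### Mean oscillation and the Besov seminorm. -/

section Oscillation

variable {Z : Type*} [PseudoMetricSpace Z] [MeasurableSpace Z] {ν : Measure Z} {p α : ℝ}

/-- The mean `p`-oscillation of `f` over the ball `B(y, r)` around the value at its centre. -/
noncomputable def ballOsc (p : ℝ) (ν : Measure Z) (f : Z → ℝ) (r : ℝ) (y : Z) : ℝ≥0∞ :=
  ⨍⁻ x in Metric.ball y r, ‖f y - f x‖ₑ ^ p ∂ν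

theorem besovSeminorm_eq (f : Z → ℝ) :
    besovSeminorm α p ν f = (∫⁻ r in Ioi (0 : ℝ),
      (ENNReal.ofReal (r ^ (α * p)))⁻¹ * (ENNReal.ofReal r)⁻¹ *
        ∫⁻ y, ballOsc p ν f r y ∂ν) ^ (1 / p) := by
  unfold besovSeminorm
  congr 1
  refine setLIntegral_congr_fun measurableSet_Ioi fun r hr => ?_
  have hr' : 0 < r ^ (α * p) := Real.rpow_pos_of_pos hr _
  have hfin : (ENNReal.ofReal (r ^ (α * p)))⁻¹ ≠ ∞ :=
    ENNReal.inv_ne_top.2 (by simpa using hr')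
  simp_rw [div_eq_mul_inv, laverage]
  simp_rw [lintegral_mul_const' _ _ hfin]
  simp only [ballOsc, laverage]
  ring

theorem lintegral_le_lintegral_rpow {m : Measure Z} [IsProbabilityMeasure m] (hp : 1 ≤ p)
    {f : Z → ℝ≥0∞} (hf : AEMeasurable f m) : ∫⁻ x, f x ∂m ≤ (∫⁻ x, f x ^ p ∂m) ^ (1 / p) := by
  have := eLpNorm'_le_eLpNorm'_of_exponent_le (μ := m) one_pos hp hf.aestronglyMeasurable
  simpa [eLpNorm'] using this

theorem setLAverage_le_rpow (hp : 1 ≤ p) {A : Set Z} (h0 : ν A ≠ 0) (ht : ν A ≠ ∞)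
    {f : Z → ℝ≥0∞} (hf : AEMeasurable f (ν.restrict A)) :
    ⨍⁻ x in A, f x ∂ν ≤ (⨍⁻ x in A, f x ^ p ∂ν) ^ (1 / p) := by
  have hfin : IsFiniteMeasure (ν.restrict A) := ⟨by simpa using ht.lt_top⟩
  have hne : NeZero (ν.restrict A) := ⟨by simpa using h0⟩
  exact lintegral_le_lintegral_rpow hp (hf.smul_measure _)

end Oscillation

/-! ### Integrating over the layers of all scales. -/

section LayerIntegral

variable {Ω : Type*} [MetricSpace Ω] [MeasurableSpace Ω] [BorelSpace Ω] {μ : Measure Ω}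

theorem lintegral_indicator_Icc_inv_le {a M : ℝ} (ha : 0 < a) :
    ∫⁻ r in Ioi (0 : ℝ), (Icc a (M * a)).indicator (fun r => (ENNReal.ofReal r)⁻¹) r ≤
      ENNReal.ofReal M := by
  calc ∫⁻ r in Ioi (0 : ℝ), (Icc a (M * a)).indicator (fun r => (ENNReal.ofReal r)⁻¹) r
      ≤ ∫⁻ r, (Icc a (M * a)).indicator (fun _ => (ENNReal.ofReal a)⁻¹) r := by
        refine (setLIntegral_le_lintegral _ _).trans (lintegral_mono fun r => ?_)
        refine indicator_le_indicator' fun hr => ?_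
        exact ENNReal.inv_le_inv.2 (ENNReal.ofReal_le_ofReal hr.1)
    _ = (ENNReal.ofReal a)⁻¹ * ENNReal.ofReal (M * a - a) := by
        rw [lintegral_indicator measurableSet_Icc, setLIntegral_const, Real.volume_Icc]
    _ ≤ (ENNReal.ofReal a)⁻¹ * (ENNReal.ofReal a * ENNReal.ofReal M) := by
        gcongr
        rw [← ENNReal.ofReal_mul ha.le]
        exact ENNReal.ofReal_le_ofReal (by nlinarith)
    _ = _ := by
        rw [← mul_assoc, ENNReal.inv_mul_cancel (by simpa using ha) ENNReal.ofReal_ne_top, one_mul]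

/-- Each point lies in the layers of a bounded logarithmic range of scales. -/
theorem lintegral_layer_le [SFinite μ] (hd : ∀ x : Ω, 0 < bdryDist x) {K t : ℝ} (hK : 0 < K)
    (ht : 0 < t) {f : Ω → ℝ≥0∞} (hf : Measurable f) :
    ∫⁻ r in Ioi (0 : ℝ), (ENNReal.ofReal r)⁻¹ * ∫⁻ x in bdryLayer Ω K (t * r), f x ∂μ ≤
      ENNReal.ofReal (K * K) * ∫⁻ x, f x ∂μ := by
  have hdm : Measurable (bdryDist : Ω → ℝ) := continuous_bdryDist.measurable
  let s : Set (ℝ × Ω) := {q | t * q.1 / K ≤ bdryDist q.2 ∧ bdryDist q.2 ≤ K * (t * q.1)}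
  have hs : MeasurableSet s :=
    (measurableSet_le ((measurable_fst.const_mul t).div_const K) (hdm.comp measurable_snd)).inter
      (measurableSet_le (hdm.comp measurable_snd) ((measurable_fst.const_mul t).const_mul K))
  let k : ℝ → Ω → ℝ≥0∞ := fun r x =>
    s.indicator (fun q => (ENNReal.ofReal q.1)⁻¹ * f q.2) (r, x)
  have hk : Measurable (Function.uncurry k) :=
    ((measurable_fst.ennreal_ofReal.inv).mul (hf.comp measurable_snd)).indicator hs
  calc ∫⁻ r in Ioi (0 : ℝ), (ENNReal.ofReal r)⁻¹ * ∫⁻ x in bdryLayer Ω K (t * r), f x ∂μ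
      = ∫⁻ r in Ioi (0 : ℝ), ∫⁻ x, k r x ∂μ := by
        refine lintegral_congr fun r => ?_
        rw [← lintegral_const_mul _ hf, ← lintegral_indicator (measurableSet_bdryLayer _ _)]
        rfl
    _ = ∫⁻ x, (∫⁻ r in Ioi (0 : ℝ), k r x) ∂μ := lintegral_lintegral_swap hk.aemeasurable
    _ ≤ ∫⁻ x, ENNReal.ofReal (K * K) * f x ∂μ := by
        refine lintegral_mono fun x => ?_
        -- The layer condition on `r` confines it to an interval starting here, with endpoint ratio
        -- `K * K`. Its dr/r-mass is a logarithm, but the crude bound `K * K` is enough.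
        have ha : 0 < bdryDist x / (K * t) := div_pos (hd x) (by positivity)
        set J : ℝ → ℝ≥0∞ := (Icc (bdryDist x / (K * t)) (K * K * (bdryDist x / (K * t)))).indicator
          (fun r => (ENNReal.ofReal r)⁻¹) with hJ
        have hle : ∀ r, k r x ≤ J r * f x := by
          intro r
          by_cases hr : (r, x) ∈ s
          · have hr2 : r ∈ Icc (bdryDist x / (K * t)) (K * K * (bdryDist x / (K * t))) := by
              obtain ⟨h1, h2⟩ := hr
              refine ⟨?_, ?_⟩
              · rw [div_le_iff₀ (by positivity)]; dsimp only at h2; linarith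
              · have : K * K * (bdryDist x / (K * t)) = K * bdryDist x / t := by field_simp
                rw [this, le_div_iff₀ ht]
                rw [div_le_iff₀ hK] at h1
                dsimp only at h1
                linarith
            simp [k, J, indicator_of_mem hr, indicator_of_mem hr2]
          · simp [k, indicator_of_notMem hr]
        calc ∫⁻ r in Ioi (0 : ℝ), k r x ≤ ∫⁻ r in Ioi (0 : ℝ), J r * f x := lintegral_mono hle
          _ = (∫⁻ r in Ioi (0 : ℝ), J r) * f x :=
              lintegral_mul_const _ ((measurable_id.ennreal_ofReal.inv).indicator measurableSet_Icc)
          _ ≤ _ := by gcongr; exact lintegral_indicator_Icc_inv_le ha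
    _ = _ := by rw [lintegral_const_mul _ hf]

theorem measurable_lintegral_layer [SFinite μ] {K t : ℝ} {f : Ω → ℝ≥0∞} (hf : Measurable f) :
    Measurable fun r : ℝ => ∫⁻ x in bdryLayer Ω K (t * r), f x ∂μ := by
  have hdm : Measurable (bdryDist : Ω → ℝ) := continuous_bdryDist.measurable
  let s : Set (ℝ × Ω) := {q | t * q.1 / K ≤ bdryDist q.2 ∧ bdryDist q.2 ≤ K * (t * q.1)}
  have hs : MeasurableSet s :=
    (measurableSet_le ((measurable_fst.const_mul t).div_const K) (hdm.comp measurable_snd)).inter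
      (measurableSet_le (hdm.comp measurable_snd) ((measurable_fst.const_mul t).const_mul K))
  have hk : Measurable (s.indicator fun q => f q.2) := (hf.comp measurable_snd).indicator hs
  refine (congrArg Measurable (funext fun r => ?_)).mpr (hk.lintegral_prod_right' (ν := μ))
  rw [← lintegral_indicator (measurableSet_bdryLayer _ _)]
  rfl

end LayerIntegral

/-! ### Boundedness of the trace. -/

section TraceBound

variable {Ω : Type*} [MetricSpace Ω] [LocallyCompactSpace Ω] [MeasurableSpace Ω] [BorelSpace Ω]
  [MeasurableSpace (boundary Ω)] [BorelSpace (boundary Ω)]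
  {μ : Measure Ω} {ν : Measure (boundary Ω)} {p θ : ℝ}

theorem TraceSetting.ball_ne_zero (h : TraceSetting p θ μ ν) (ζ : boundary Ω) {r : ℝ} (hr : 0 < r) :
    ν (Metric.ball ζ r) ≠ 0 := (h.codim.ball_pos h.doubling ζ hr).ne'

theorem TraceSetting.ball_ne_top (h : TraceSetting p θ μ ν) (ζ : boundary Ω) (r : ℝ) :
    ν (Metric.ball ζ r) ≠ ∞ := (h.codim.bball_lt_top h.doubling h.pos ζ r).ne

/-- Averaging an integrable function over balls of a fixed radius. -/
theorem TraceSetting.lintegral_laverage_le (h : TraceSetting p θ μ ν) :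
    ∃ C : ℝ≥0, ∀ r : ℝ, 0 < r → ∀ f : boundary Ω → ℝ≥0∞, Measurable f →
      ∫⁻ y, ⨍⁻ x in Metric.ball y r, f x ∂ν ∂ν ≤ C * ∫⁻ y, f y ∂ν := by
  have := h.doubling.properSpace
  have := h.codim.sigmaFinite h.doubling h.pos
  obtain ⟨C, hC⟩ := h.lintegral_inv_measure_mul_le ν continuous_subtype_val 1
  refine ⟨C, fun r hr f hf => le_trans (le_of_eq ?_) (hC r hr f hf)⟩
  refine lintegral_congr fun y => ?_
  rw [setLAverage_eq, div_eq_mul_inv, mul_comm]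
  congr 3
  ext x
  simp [Subtype.dist_eq]

/-- The pointwise bound by layer-restricted multiscale energies is integrated first over pairs of
boundary points, where `r ^ (p - θ)` cancels the Besov weight, and then in dr/r, where the layers
have bounded overlap. The weights `scaleRatio p θ ^ k` sum the contributions of the finer scales. -/
theorem TraceSetting.besovSeminorm_trace_le (h : TraceSetting p θ μ ν) :
    ∃ C : ℝ≥0, ∀ u ∈ dirichletSpace p μ, ∀ f : boundary Ω → ℝ,
      (∀ᵐ ζ ∂ν, HasTraceAt μ u ζ (f ζ)) →
      besovSeminorm (1 - θ / p) p ν f ≤ C * dirichletSeminorm p μ u := by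
  have hp0 : 0 < p := h.pos_p
  have hp1 : 0 ≤ 1 / p := by positivity
  have := h.doubling.sigmaFinite
  obtain ⟨K, C₁, hK, htr⟩ := h.exists_trace_sub_average_le
  obtain ⟨C₂, hC₂⟩ := h.lintegral_laverage_le
  obtain ⟨C₃, hC₃⟩ := h.lintegral_multiscaleEnergy_le K
  have hα : (1 - θ / p) * p = p - θ := by field_simp
  set Q := ∑' k, scaleRatio p θ ^ k with hQ
  have hQt : Q ≠ ∞ := tsum_scaleRatio_ne_top h.lt
  set M : ℝ≥0∞ := C₁ * (1 + C₂) * C₃ * Q * ENNReal.ofReal (K * K) with hM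
  have hMt : M ≠ ∞ := by finiteness
  refine ⟨(M ^ (1 / p)).toNNReal, fun u hu f hf => ?_⟩
  rw [ENNReal.coe_toNNReal (ENNReal.rpow_lt_top_of_nonneg hp1 hMt).ne]
  -- the estimate for a fixed upper gradient
  have main : ∀ g, IsUpperGradient u g →
      besovSeminorm (1 - θ / p) p ν f ≤ M ^ (1 / p) * (∫⁻ x, g x ^ p ∂μ) ^ (1 / p) := by
    intro g hg
    rw [besovSeminorm_eq, hα, ← ENNReal.mul_rpow_of_nonneg _ _ hp1]
    gcongr
    have hgp := hg.1.pow_const p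
    have hscale : ∀ r ∈ Ioi (0 : ℝ), (ENNReal.ofReal (r ^ (p - θ)))⁻¹ * (ENNReal.ofReal r)⁻¹ *
        ∫⁻ y, ballOsc p ν f r y ∂ν ≤ (C₁ * (1 + C₂) * C₃) * ∑' k, scaleRatio p θ ^ k *
          ((ENNReal.ofReal r)⁻¹ * ∫⁻ x in bdryLayer Ω K ((1 / 2) ^ k * r), g x ^ p ∂μ) := by
      intro r hr
      have hr : 0 < r := hr
      have hR : 0 < r ^ (p - θ) := by positivity
      set S := multiscaleEnergy p θ μ g K r (fun k => bdryLayer Ω K ((1 / 2) ^ k * r))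
      have hSm : Measurable S :=
        h.measurable_multiscaleEnergy hg.1 K r fun k => measurableSet_bdryLayer _ _
      have hosc : ∀ᵐ y ∂ν, ballOsc p ν f r y ≤ C₁ * (S y + ⨍⁻ x in Metric.ball y r, S x ∂ν) := by
        filter_upwards [hf] with y hy
        have h0 := h.ball_ne_zero y hr
        have ht := h.ball_ne_top y r
        calc ballOsc p ν f r y ≤ ⨍⁻ x in Metric.ball y r, C₁ * (S y + S x) ∂ν := by
              rw [ballOsc, setLAverage_eq, setLAverage_eq]
              gcongr ?_ / _
              refine lintegral_mono_ae ?_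
              filter_upwards [ae_restrict_of_ae hf, ae_restrict_mem measurableSet_ball] with x hx hxB
              exact htr u hu g hg y x _ _ r hy hx hr (by rw [dist_comm]; exact hxB)
          _ = _ := by
              rw [laverage, lintegral_const_mul _ (hSm.const_add _), lintegral_add_left measurable_const,
                ← laverage, ← laverage, setLAverage_const_enorm h0 ht]
      have hint : ∫⁻ y, ballOsc p ν f r y ∂ν ≤ C₁ * ((1 + C₂) * ∫⁻ y, S y ∂ν) :=
        calc _ ≤ ∫⁻ y, C₁ * (S y + ⨍⁻ x in Metric.ball y r, S x ∂ν) ∂ν := lintegral_mono_ae hosc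
          _ = C₁ * (∫⁻ y, S y ∂ν + ∫⁻ y, ⨍⁻ x in Metric.ball y r, S x ∂ν ∂ν) := by
              rw [lintegral_const_mul' _ _ ENNReal.coe_ne_top, lintegral_add_left hSm]
          _ ≤ C₁ * (∫⁻ y, S y ∂ν + C₂ * ∫⁻ y, S y ∂ν) := by gcongr; exact hC₂ r hr S hSm
          _ = _ := by ring
      have hS := hC₃ r hr g hg.1 _ fun k => measurableSet_bdryLayer K ((1 / 2) ^ k * r)
      calc (ENNReal.ofReal (r ^ (p - θ)))⁻¹ * (ENNReal.ofReal r)⁻¹ * ∫⁻ y, ballOsc p ν f r y ∂ν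
          ≤ (ENNReal.ofReal (r ^ (p - θ)))⁻¹ * (ENNReal.ofReal r)⁻¹ * (C₁ * ((1 + C₂) *
            (C₃ * ENNReal.ofReal (r ^ (p - θ)) * ∑' k, scaleRatio p θ ^ k *
              ∫⁻ x in bdryLayer Ω K ((1 / 2) ^ k * r), g x ^ p ∂μ))) := by
            gcongr; exact hint.trans (by gcongr)
        _ = ((ENNReal.ofReal (r ^ (p - θ)))⁻¹ * ENNReal.ofReal (r ^ (p - θ))) *
            ((C₁ * (1 + C₂) * C₃) * ((ENNReal.ofReal r)⁻¹ * ∑' k, scaleRatio p θ ^ k *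
              ∫⁻ x in bdryLayer Ω K ((1 / 2) ^ k * r), g x ^ p ∂μ)) := by ring
        _ = _ := by
            rw [ENNReal.inv_mul_cancel (by simpa using hR) ENNReal.ofReal_ne_top, one_mul,
              ← ENNReal.tsum_mul_left]
            congr 2
            funext k
            ring
    calc _ ≤ ∫⁻ r in Ioi (0 : ℝ), (C₁ * (1 + C₂) * C₃) * ∑' k, scaleRatio p θ ^ k *
          ((ENNReal.ofReal r)⁻¹ * ∫⁻ x in bdryLayer Ω K ((1 / 2) ^ k * r), g x ^ p ∂μ) :=
        setLIntegral_mono' measurableSet_Ioi hscale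
      _ = (C₁ * (1 + C₂) * C₃) * ∑' k, scaleRatio p θ ^ k * ∫⁻ r in Ioi (0 : ℝ),
          ((ENNReal.ofReal r)⁻¹ * ∫⁻ x in bdryLayer Ω K ((1 / 2) ^ k * r), g x ^ p ∂μ) := by
        have hm : ∀ k : ℕ, Measurable fun r : ℝ =>
            (ENNReal.ofReal r)⁻¹ * ∫⁻ x in bdryLayer Ω K ((1 / 2) ^ k * r), g x ^ p ∂μ := fun k =>
          (measurable_id.ennreal_ofReal.inv).mul (measurable_lintegral_layer hgp)
        rw [lintegral_const_mul' _ _ (by finiteness),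
          lintegral_tsum fun k => ((hm k).const_mul _).aemeasurable]
        congr 2
        funext k
        rw [lintegral_const_mul _ (hm k)]
      _ ≤ (C₁ * (1 + C₂) * C₃) * ∑' k, scaleRatio p θ ^ k *
          (ENNReal.ofReal (K * K) * ∫⁻ x, g x ^ p ∂μ) := by
        gcongr with k
        exact lintegral_layer_le (fun x => bdryDist_pos h.nonempty x) (by linarith) (by positivity) hgp
      _ = _ := by rw [ENNReal.tsum_mul_right, hM]; ring
  -- The infimum over upper gradients is taken after dividing by the constant, so a vanishing
  -- constant is treated apart.
  by_cases hM0 : M ^ (1 / p) = 0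
  · obtain ⟨-, g, hg, -⟩ := (mem_dirichletSpace_iff h.one_le).1 hu
    have := main g hg
    rw [hM0, zero_mul] at this ⊢
    exact this
  · have hMt' : M ^ (1 / p) ≠ ∞ := (ENNReal.rpow_lt_top_of_nonneg hp1 hMt).ne
    rw [mul_comm, ← ENNReal.div_le_iff hM0 hMt']
    refine le_of_forall_gt_imp_ge_of_dense fun c hc => ?_
    obtain ⟨g, hg, hgc⟩ := exists_isUpperGradient_of_dirichletSeminorm_lt h.one_le hc
    rw [ENNReal.div_le_iff hM0 hMt', mul_comm]
    exact (main g hg).trans (by gcongr)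

end TraceBound

/-! ### Local integrability and Lebesgue points of Besov functions. -/

section BesovRegularity

variable {Ω : Type*} [MetricSpace Ω] [LocallyCompactSpace Ω] [MeasurableSpace Ω] [BorelSpace Ω]
  [MeasurableSpace (boundary Ω)] [BorelSpace (boundary Ω)]
  {μ : Measure Ω} {ν : Measure (boundary Ω)} {p θ α : ℝ}

/-- Functions with finite Besov seminorm are `p`-integrable on balls. -/
theorem TraceSetting.memLp_ball_of_besovSeminorm_lt_top (h : TraceSetting p θ μ ν)
    {f : boundary Ω → ℝ} (hf : Measurable f) (hfin : besovSeminorm α p ν f < ∞)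
    (ζ : boundary Ω) (R : ℝ) : MemLp f (ENNReal.ofReal p) (ν.restrict (Metric.ball ζ R)) := by
  have hp0 : 0 < p := h.pos_p
  rw [besovSeminorm_eq, ENNReal.rpow_lt_top_iff_of_pos (by positivity)] at hfin
  -- A finite integral over all scales leaves some large scale `r` with finite integrand. There some
  -- `y` near `ζ` has finite oscillation, so `f - f y` is `p`-integrable on a ball containing `B(ζ,
  -- R)`.
  obtain ⟨r, hr, hrfin⟩ : ∃ r ∈ Ioi (2 * |R| + 1), (ENNReal.ofReal (r ^ (α * p)))⁻¹ *
      (ENNReal.ofReal r)⁻¹ * ∫⁻ y, ballOsc p ν f r y ∂ν ≠ ∞ := by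
    by_contra! hcon
    have h1 : ∫⁻ r in Ioi (2 * |R| + 1), (∞ : ℝ≥0∞) ≤ ∫⁻ r in Ioi (0 : ℝ),
        (ENNReal.ofReal (r ^ (α * p)))⁻¹ * (ENNReal.ofReal r)⁻¹ *
          ∫⁻ y, ballOsc p ν f r y ∂ν :=
      (setLIntegral_mono' measurableSet_Ioi fun r hr => (hcon r hr).ge).trans
        (lintegral_mono_set (Ioi_subset_Ioi (by positivity)))
    rw [setLIntegral_const, Real.volume_Ioi, ENNReal.top_mul_top, top_le_iff] at h1
    exact hfin.ne h1
  have hr : 2 * |R| + 1 < r := hr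
  have hr0 : 0 < r := by linarith [abs_nonneg R]
  have hR : R ≤ r / 2 := by linarith [le_abs_self R]
  have hpow : 0 < r ^ (α * p) := by positivity
  have hosc : ∫⁻ y, ballOsc p ν f r y ∂ν ≠ ∞ := by
    intro htop
    rw [htop, ENNReal.mul_top] at hrfin
    · exact hrfin rfl
    · exact mul_ne_zero (ENNReal.inv_ne_zero.2 ENNReal.ofReal_ne_top)
        (ENNReal.inv_ne_zero.2 ENNReal.ofReal_ne_top)
  set B := Metric.ball ζ (r / 2) with hB
  have hB0 : ν B ≠ 0 := h.ball_ne_zero ζ (half_pos hr0)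
  have hBt : ν B ≠ ∞ := h.ball_ne_top ζ _
  obtain ⟨y, hy, hyfin⟩ : ∃ y ∈ B, ballOsc p ν f r y ≠ ∞ := by
    by_contra! hcon
    have h1 : ∫⁻ y in B, (∞ : ℝ≥0∞) ∂ν ≤ ∫⁻ y, ballOsc p ν f r y ∂ν :=
      (setLIntegral_mono' measurableSet_ball fun y hy => (hcon y hy).ge).trans
        (setLIntegral_le_lintegral _ _)
    rw [setLIntegral_const, ENNReal.top_mul hB0, top_le_iff] at h1
    exact hosc h1
  have hfinB : ∫⁻ x in B, ‖f y - f x‖ₑ ^ p ∂ν < ∞ := by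
    have hsub : B ⊆ Metric.ball y r := by
      refine Metric.ball_subset_ball' ?_
      rw [dist_comm]; linarith [Metric.mem_ball.1 hy]
    refine (lintegral_mono_set hsub).trans_lt ?_
    rw [ballOsc, setLAverage_eq] at hyfin
    by_contra htop
    rw [not_lt, top_le_iff] at htop
    rw [htop, ENNReal.top_div_of_ne_top (h.ball_ne_top y r)] at hyfin
    exact hyfin rfl
  have hpE0 : ENNReal.ofReal p ≠ 0 := by simpa using hp0
  have hfinite : IsFiniteMeasure (ν.restrict B) := ⟨by simpa using hBt.lt_top⟩
  have hmem : MemLp (fun x => f y - f x) (ENNReal.ofReal p) (ν.restrict B) := by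
    refine ⟨(hf.const_sub _).aestronglyMeasurable, ?_⟩
    rw [eLpNorm_lt_top_iff_lintegral_rpow_enorm_lt_top hpE0 ENNReal.ofReal_ne_top,
      ENNReal.toReal_ofReal hp0.le]
    exact hfinB
  have hmem2 : MemLp f (ENNReal.ofReal p) (ν.restrict B) := by
    have := (memLp_const (f y) (p := ENNReal.ofReal p) (μ := ν.restrict B)).sub hmem
    refine (memLp_congr_ae (ae_of_all _ fun x => ?_)).1 this
    simp
  exact hmem2.mono_measure (Measure.restrict_mono (Metric.ball_subset_ball hR) le_rfl)

theorem TraceSetting.integrableOn_of_besovSeminorm_lt_top (h : TraceSetting p θ μ ν)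
    {f : boundary Ω → ℝ} (hf : Measurable f) (hfin : besovSeminorm α p ν f < ∞)
    (ζ : boundary Ω) (R : ℝ) : IntegrableOn f (Metric.ball ζ R) ν := by
  have : IsFiniteMeasure (ν.restrict (Metric.ball ζ R)) :=
    ⟨by simpa using (h.ball_ne_top ζ R).lt_top⟩
  refine (h.memLp_ball_of_besovSeminorm_lt_top hf hfin ζ R).integrable ?_
  rw [ENNReal.one_le_ofReal]; exact h.one_le

theorem TraceSetting.measurable_ballOsc (h : TraceSetting p θ μ ν)
    {f : boundary Ω → ℝ} (hf : Measurable f) (r : ℝ) : Measurable (ballOsc p ν f r) := by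
  have := h.doubling.properSpace
  have := h.codim.sigmaFinite h.doubling h.pos
  have hset := measurableSet_dist_lt (Ω := Ω) (Y := boundary Ω) continuous_subtype_val r
  have h1 : Measurable fun ζ : boundary Ω => ν (Metric.ball ζ r) :=
    measurable_measure_prodMk_left hset
  have h2 : Measurable fun q : boundary Ω × boundary Ω => ‖f q.1 - f q.2‖ₑ ^ p :=
    (((hf.comp measurable_fst).sub (hf.comp measurable_snd)).enorm).pow_const p
  have h3 := (h2.indicator hset).lintegral_prod_right' (ν := ν)
  refine (congrArg Measurable (funext fun ζ => ?_)).mpr (h3.div h1)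
  rw [ballOsc, setLAverage_eq, ← lintegral_indicator measurableSet_ball]
  rfl

/-- Functions with finite Besov seminorm have Lebesgue points almost everywhere along dyadic
radii. -/
theorem TraceSetting.ae_tendsto_ballOsc (h : TraceSetting p θ μ ν)
    {f : boundary Ω → ℝ} (hf : Measurable f) (hα : 0 < α) (hfin : besovSeminorm α p ν f < ∞) :
    ∀ᵐ ζ ∂ν, Tendsto (fun n : ℕ => ballOsc p ν f ((1 / 2) ^ (n + 1)) ζ) atTop (𝓝 0) := by
  have hp0 : 0 < p := h.pos_p
  rw [besovSeminorm_eq, ENNReal.rpow_lt_top_iff_of_pos (by positivity)] at hfin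
  obtain ⟨C, hC⟩ := h.codim.bball_le h.doubling h.pos 2
  have hball : ∀ (n : ℕ) (r : ℝ), r ∈ Ioc ((1 / 2 : ℝ) ^ (n + 1)) ((1 / 2) ^ n) →
      ∫⁻ y, ballOsc p ν f ((1 / 2) ^ (n + 1)) y ∂ν ≤ C * ∫⁻ y, ballOsc p ν f r y ∂ν := by
    intro n r hr
    have hs : (0 : ℝ) < (1 / 2) ^ (n + 1) := by positivity
    rw [← lintegral_const_mul' _ _ ENNReal.coe_ne_top]
    refine lintegral_mono fun y => setLAverage_le_of_subset (Metric.ball_subset_ball hr.1.le) ?_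
      (h.ball_ne_zero y (hs.trans hr.1)) (h.ball_ne_top y r)
    refine hC y y _ r hs ?_
    rw [dist_self, pow_succ]
    linarith [hr.2]
  -- On this interval dr/r has mass at least `1 / 2`, and the weight `r ^ (-α * p)` is at least `1`
  -- because `r ≤ 1` and `α > 0`. Summed over the disjoint intervals, the right-hand sides stay
  -- below the Besov integral.
  have hterm : ∀ n : ℕ, ∫⁻ y, ballOsc p ν f ((1 / 2) ^ (n + 1)) y ∂ν ≤
      2 * C * ∫⁻ r in Ioc ((1 / 2 : ℝ) ^ (n + 1)) ((1 / 2) ^ n),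
        (ENNReal.ofReal (r ^ (α * p)))⁻¹ * (ENNReal.ofReal r)⁻¹ * ∫⁻ y, ballOsc p ν f r y ∂ν := by
    intro n
    set s : ℝ := (1 / 2) ^ (n + 1) with hs
    have hs0 : 0 < s := by positivity
    have h2s : ((1 : ℝ) / 2) ^ n = 2 * s := by rw [hs, pow_succ]; ring
    have h2s1 : 2 * s ≤ 1 := h2s ▸ pow_le_one₀ (by norm_num) (by norm_num)
    set J := ∫⁻ y, ballOsc p ν f s y ∂ν
    calc J = 2 * ((ENNReal.ofReal (2 * s))⁻¹ * J * ENNReal.ofReal (2 * s - s)) := by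
          rw [show 2 * s - s = s by ring, ENNReal.ofReal_mul two_pos.le, ENNReal.ofReal_ofNat,
            ENNReal.mul_inv (Or.inl two_ne_zero) (Or.inl ENNReal.ofNat_ne_top)]
          calc J = 1 * 1 * J := by ring
            _ = (2 * 2⁻¹) * ((ENNReal.ofReal s)⁻¹ * ENNReal.ofReal s) * J := by
              rw [ENNReal.inv_mul_cancel (by simpa using hs0) ENNReal.ofReal_ne_top,
                ENNReal.mul_inv_cancel two_ne_zero ENNReal.ofNat_ne_top]
            _ = _ := by ring
      _ = 2 * ∫⁻ _ in Ioc s (2 * s), (ENNReal.ofReal (2 * s))⁻¹ * J := by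
          rw [setLIntegral_const, Real.volume_Ioc]
      _ ≤ 2 * ∫⁻ r in Ioc s (2 * s), C * ((ENNReal.ofReal (r ^ (α * p)))⁻¹ *
          (ENNReal.ofReal r)⁻¹ * ∫⁻ y, ballOsc p ν f r y ∂ν) := by
          gcongr 2 * ?_
          refine setLIntegral_mono' measurableSet_Ioc fun r hr => ?_
          have hJ := hball n r (by rw [h2s]; exact hr)
          have hr0 : 0 < r := hs0.trans hr.1
          have hone : 1 ≤ (ENNReal.ofReal (r ^ (α * p)))⁻¹ := by
            rw [ENNReal.one_le_inv, ENNReal.ofReal_le_one]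
            exact Real.rpow_le_one hr0.le (hr.2.trans h2s1) (by positivity)
          calc (ENNReal.ofReal (2 * s))⁻¹ * J
              ≤ (ENNReal.ofReal r)⁻¹ * (C * ∫⁻ y, ballOsc p ν f r y ∂ν) := by
                gcongr
                exact hr.2
            _ = 1 * (ENNReal.ofReal r)⁻¹ * (C * ∫⁻ y, ballOsc p ν f r y ∂ν) := by ring
            _ ≤ (ENNReal.ofReal (r ^ (α * p)))⁻¹ * (ENNReal.ofReal r)⁻¹ *
                (C * ∫⁻ y, ballOsc p ν f r y ∂ν) := by gcongr
            _ = _ := by ring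
      _ = _ := by
          rw [lintegral_const_mul' _ _ ENNReal.coe_ne_top, h2s]; ring
  have hdisj : Pairwise (Function.onFun Disjoint
      fun n : ℕ => Ioc ((1 / 2 : ℝ) ^ (n + 1)) ((1 / 2) ^ n)) := by
    have key : ∀ m n : ℕ, m < n → Disjoint (Ioc ((1 / 2 : ℝ) ^ (m + 1)) ((1 / 2) ^ m))
        (Ioc ((1 / 2 : ℝ) ^ (n + 1)) ((1 / 2) ^ n)) := by
      intro m n hmn
      rw [Set.disjoint_left]
      intro r hr hr'
      have : ((1 : ℝ) / 2) ^ n ≤ (1 / 2) ^ (m + 1) :=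
        pow_le_pow_of_le_one (by norm_num) (by norm_num) hmn
      linarith [hr.1, hr'.2]
    intro m n hmn
    rcases lt_or_gt_of_ne hmn with hlt | hlt
    · exact key m n hlt
    · exact (key n m hlt).symm
  have hsum : ∫⁻ y, ∑' n : ℕ, ballOsc p ν f ((1 / 2) ^ (n + 1)) y ∂ν ≠ ∞ := by
    rw [lintegral_tsum fun n => (h.measurable_ballOsc hf _).aemeasurable]
    refine ne_top_of_le_ne_top ?_ (ENNReal.tsum_le_tsum hterm)
    rw [ENNReal.tsum_mul_left, ← lintegral_iUnion (fun n => measurableSet_Ioc) hdisj]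
    refine ENNReal.mul_ne_top (by finiteness) (ne_top_of_le_ne_top hfin.ne (lintegral_mono_set ?_))
    refine iUnion_subset fun n r hr => ?_
    have : (0 : ℝ) < (1 / 2) ^ (n + 1) := by positivity
    exact this.trans hr.1
  filter_upwards [ae_lt_top (Measurable.tsum fun n => h.measurable_ballOsc hf _) hsum] with ζ hζ
  exact ENNReal.tendsto_atTop_zero_of_tsum_ne_top hζ.ne

end BesovRegularity

/-! ### Whitney covers and partitions of unity. -/

section Whitney

variable {Ω : Type*} [MetricSpace Ω]

theorem whitneyRadius_le_add (x y : Ω) : whitneyRadius x ≤ whitneyRadius y + dist x y / 8 := by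
  have := bdryDist_le_add x y
  unfold whitneyRadius
  linarith

theorem whitneyRadius_pos [LocallyCompactSpace Ω] (h : (boundary Ω).Nonempty) (x : Ω) :
    0 < whitneyRadius x := div_pos (bdryDist_pos h x) (by norm_num)

variable (Ω) in
/-- A maximal set of centres of Whitney balls. -/
theorem exists_whitney_centers : ∃ S : Set Ω,
    (∀ x ∈ S, ∀ y ∈ S, x ≠ y → min (whitneyRadius x) (whitneyRadius y) ≤ dist x y) ∧
    (∀ y : Ω, 0 < whitneyRadius y → ∃ x ∈ S, dist y x < whitneyRadius x) := by
  obtain ⟨S, hS⟩ := zorn_subset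
    {S : Set Ω | ∀ x ∈ S, ∀ y ∈ S, x ≠ y → min (whitneyRadius x) (whitneyRadius y) ≤ dist x y}
    (fun c hc hchain => ⟨⋃₀ c, by
      rintro x ⟨s, hs, hx⟩ y ⟨t, ht, hy⟩ hxy
      rcases hchain.total hs ht with hst | hst
      · exact hc ht x (hst hx) y hy hxy
      · exact hc hs x hx y (hst hy) hxy, fun s hs => subset_sUnion_of_mem hs⟩)
  refine ⟨S, hS.prop, fun y hy => ?_⟩
  by_contra! hcon
  -- A point outside all the balls could be added to the separated set; maximality puts it into `S`,
  -- where its own ball contains it.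
  have hmem : insert y S ∈ {S : Set Ω | ∀ x ∈ S, ∀ y ∈ S, x ≠ y →
      min (whitneyRadius x) (whitneyRadius y) ≤ dist x y} := by
    rintro a (rfl | ha) b (rfl | hb) hab
    · exact absurd rfl hab
    · exact (min_le_right _ _).trans (hcon b hb)
    · rw [dist_comm]; exact (min_le_left _ _).trans (hcon a ha)
    · exact hS.prop a ha b hb hab
  have hyS : y ∈ S := hS.le_of_ge hmem (subset_insert y S) (mem_insert y S)
  have := hcon y hyS
  rw [dist_self] at this
  linarith

/-- The radius is `1 / 8`-Lipschitz, so it varies by at most a quarter of `whitneyRadius x` on the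
doubled ball. -/
theorem whitneyRadius_bounds {x y : Ω} (h : dist y x < 2 * whitneyRadius x) :
    whitneyRadius x ≤ 4 / 3 * whitneyRadius y ∧ whitneyRadius y ≤ 5 / 4 * whitneyRadius x := by
  have h1 := whitneyRadius_le_add x y
  have h2 := whitneyRadius_le_add y x
  rw [dist_comm] at h1
  constructor <;> linarith

/-- Separation at the smaller radius, together with the Lipschitz bound on radii, makes the balls of
a quarter of the radius disjoint. -/
theorem countable_whitney_centers [SecondCountableTopology Ω] {S : Set Ω}
    (hpos : ∀ x : Ω, 0 < whitneyRadius x)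
    (hS : ∀ x ∈ S, ∀ y ∈ S, x ≠ y → min (whitneyRadius x) (whitneyRadius y) ≤ dist x y) :
    S.Countable := by
  have hdisj : S.PairwiseDisjoint fun x => Metric.ball x (whitneyRadius x / 4) := by
    intro x hx y hy hxy
    refine Metric.ball_disjoint_ball ?_
    have h1 := hS x hx y hy hxy
    have h2 := whitneyRadius_le_add x y
    have h3 := whitneyRadius_le_add y x
    rw [dist_comm] at h3
    have := hpos x
    have := hpos y
    rcases min_le_iff.1 h1 with h | h <;> linarith
  exact hdisj.countable_of_isOpen (fun x _ => Metric.isOpen_ball)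
    fun x _ => ⟨x, Metric.mem_ball_self (by have := hpos x; positivity)⟩

theorem whitney_bounded_overlap [MeasurableSpace Ω] [BorelSpace Ω] {μ : Measure Ω}
    (hμ : IsDoubling μ) (hpos : ∀ x : Ω, 0 < whitneyRadius x) {S : Set Ω}
    (hS : ∀ x ∈ S, ∀ y ∈ S, x ≠ y → min (whitneyRadius x) (whitneyRadius y) ≤ dist x y) :
    ∃ N : ℕ, ∀ y : Ω,
      {x | x ∈ S ∧ y ∈ Metric.ball x (2 * whitneyRadius x)}.encard ≤ N := by
  -- The relevant centres are within `8 / 3 * whitneyRadius y` of `y` and separated by at least `4 /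
  -- 5 * whitneyRadius y`; packing is applied with separation `whitneyRadius y / 2` inside radius `3
  -- * whitneyRadius y`.
  obtain ⟨N, hN⟩ := hμ.encard_le_of_separated 6
  refine ⟨N, fun y => hN y (whitneyRadius y / 2) (half_pos (hpos y)) _ ?_ ?_⟩
  · rintro x ⟨-, hx⟩
    rw [Metric.mem_ball] at hx ⊢
    have := (whitneyRadius_bounds hx).1
    have := hpos y
    rw [dist_comm]
    linarith
  · rintro a ⟨ha, hya⟩ b ⟨hb, hyb⟩ hab
    have h1 := hS a ha b hb hab
    have h2 := (whitneyRadius_bounds hya).2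
    have h3 := (whitneyRadius_bounds hyb).2
    have := hpos a
    have := hpos b
    rcases min_le_iff.1 h1 with h | h <;> linarith

/-- The cut-off function of a Whitney ball. -/
noncomputable def whitneyBump (x y : Ω) : ℝ := max 0 (min 1 (2 - dist y x / whitneyRadius x))

theorem whitneyBump_nonneg (x y : Ω) : 0 ≤ whitneyBump x y := le_max_left _ _

theorem whitneyBump_le_one (x y : Ω) : whitneyBump x y ≤ 1 :=
  max_le zero_le_one (min_le_left _ _)

theorem whitneyBump_eq_zero {x y : Ω} (hx : 0 < whitneyRadius x)
    (h : 2 * whitneyRadius x ≤ dist y x) : whitneyBump x y = 0 := by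
  refine max_eq_left ((min_le_right _ _).trans ?_)
  rw [sub_nonpos, le_div_iff₀ hx]
  exact h

theorem whitneyBump_eq_one {x y : Ω} (hx : 0 < whitneyRadius x)
    (h : dist y x < whitneyRadius x) : whitneyBump x y = 1 := by
  have : dist y x / whitneyRadius x ≤ 1 := (div_le_one hx).2 h.le
  rw [whitneyBump, min_eq_left (by linarith), max_eq_right zero_le_one]

theorem abs_whitneyBump_sub_le {x : Ω} (hx : 0 < whitneyRadius x) (y z : Ω) :
    |whitneyBump x y - whitneyBump x z| ≤ dist y z / whitneyRadius x := by
  unfold whitneyBump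
  refine (abs_max_sub_max_le_max _ _ _ _).trans ?_
  rw [sub_self, abs_zero, max_eq_right (abs_nonneg _)]
  refine (abs_min_sub_min_le_max _ _ _ _).trans ?_
  rw [sub_self, abs_zero, max_eq_right (abs_nonneg _), sub_sub_sub_cancel_left, ← sub_div, abs_div,
    abs_of_pos hx]
  gcongr
  rw [abs_sub_comm]
  exact abs_dist_sub_le y z x

variable {S : Set Ω}

/-- The Whitney balls containing a point after doubling, as a finite set. -/
theorem exists_finset_whitney {N : ℕ} {y : Ω}
    (h : {x | x ∈ S ∧ y ∈ Metric.ball x (2 * whitneyRadius x)}.encard ≤ N) :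
    ∃ t : Finset S, t.card ≤ N ∧ ∀ x : S, x ∈ t ↔ dist y (x : Ω) < 2 * whitneyRadius (x : Ω) := by
  set A : Set S := {x | dist y (x : Ω) < 2 * whitneyRadius (x : Ω)} with hA
  have hAN : A.encard ≤ N := by
    rw [← Subtype.val_injective.encard_image]
    refine (encard_le_encard ?_).trans h
    rintro _ ⟨x, hx, rfl⟩
    exact ⟨x.2, hx⟩
  have hfin : A.Finite := finite_of_encard_le_coe hAN
  refine ⟨hfin.toFinset, ?_, fun x => by simp [hA]⟩
  have : (hfin.toFinset.card : ℕ∞) ≤ N := by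
    rw [← encard_coe_eq_coe_finsetCard]; simpa using hAN
  exact_mod_cast this

theorem finsum_whitneyBump_eq_sum (hpos : ∀ x : Ω, 0 < whitneyRadius x) {t : Finset S} {y : Ω}
    (ht : ∀ x : S, dist y (x : Ω) < 2 * whitneyRadius (x : Ω) → x ∈ t) :
    ∑ᶠ x : S, whitneyBump (x : Ω) y = ∑ x ∈ t, whitneyBump (x : Ω) y := by
  refine finsum_eq_sum_of_support_subset _ fun x hx => ht x ?_
  by_contra! hcon
  exact hx (whitneyBump_eq_zero (hpos x) hcon)

theorem one_le_finsum_whitneyBump (hpos : ∀ x : Ω, 0 < whitneyRadius x)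
    (hcov : ∀ y : Ω, ∃ x ∈ S, dist y x < whitneyRadius x)
    (hover : ∀ y : Ω, ∃ t : Finset S, ∀ x : S, dist y (x : Ω) < 2 * whitneyRadius (x : Ω) → x ∈ t)
    (y : Ω) : 1 ≤ ∑ᶠ x : S, whitneyBump (x : Ω) y := by
  obtain ⟨t, ht⟩ := hover y
  obtain ⟨x, hx, hyx⟩ := hcov y
  rw [finsum_whitneyBump_eq_sum hpos ht, ← whitneyBump_eq_one (hpos x) hyx]
  exact Finset.single_le_sum (f := fun x : S => whitneyBump (x : Ω) y)
    (fun x _ => whitneyBump_nonneg _ _) (ht ⟨x, hx⟩ (by linarith [hpos x]))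

/-- At most `2 * N` bumps are active at `y` or `z`, all with radius at least `2 / 5 * whitneyRadius
x`; hence the factor `5 * N`. -/
theorem abs_finsum_whitneyBump_sub_le (hpos : ∀ x : Ω, 0 < whitneyRadius x) {N : ℕ}
    (hover : ∀ y : Ω, ∃ t : Finset S, t.card ≤ N ∧
      ∀ x : S, x ∈ t ↔ dist y (x : Ω) < 2 * whitneyRadius (x : Ω))
    {x y z : Ω} (hy : dist y x < 2 * whitneyRadius x) (hyz : dist y z < whitneyRadius x / 4) :
    |∑ᶠ w : S, whitneyBump (w : Ω) y - ∑ᶠ w : S, whitneyBump (w : Ω) z| ≤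
      5 * N / whitneyRadius x * dist y z := by
  classical
  obtain ⟨ty, hty, hy'⟩ := hover y
  obtain ⟨tz, htz, hz'⟩ := hover z
  have hx0 := hpos x
  rw [finsum_whitneyBump_eq_sum hpos (t := ty ∪ tz)
      fun w hw => Finset.mem_union_left _ ((hy' w).2 hw),
    finsum_whitneyBump_eq_sum hpos (t := ty ∪ tz)
      fun w hw => Finset.mem_union_right _ ((hz' w).2 hw), ← Finset.sum_sub_distrib]
  have hrad : ∀ w ∈ ty ∪ tz, 2 / 5 * whitneyRadius x ≤ whitneyRadius (w : Ω) := by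
    intro w hw
    have h1 := (whitneyRadius_bounds hy).1
    have h2 := whitneyRadius_le_add y z
    rcases Finset.mem_union.1 hw with hw | hw
    · have := (whitneyRadius_bounds ((hy' w).1 hw)).2
      linarith
    · have := (whitneyRadius_bounds ((hz' w).1 hw)).2
      linarith
  calc |∑ w ∈ ty ∪ tz, (whitneyBump (w : Ω) y - whitneyBump (w : Ω) z)|
      ≤ ∑ w ∈ ty ∪ tz, |whitneyBump (w : Ω) y - whitneyBump (w : Ω) z| :=
        Finset.abs_sum_le_sum_abs _ _
    _ ≤ ∑ w ∈ ty ∪ tz, dist y z / (2 / 5 * whitneyRadius x) := by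
        refine Finset.sum_le_sum fun w hw => (abs_whitneyBump_sub_le (hpos w) y z).trans ?_
        gcongr
        exact hrad w hw
    _ = (ty ∪ tz).card * (dist y z / (2 / 5 * whitneyRadius x)) := by simp
    _ ≤ (2 * N) * (dist y z / (2 / 5 * whitneyRadius x)) := by
        gcongr
        have := Finset.card_union_le ty tz
        have h2 : (ty ∪ tz).card ≤ 2 * N := by omega
        exact_mod_cast h2
    _ = _ := by field_simp

theorem abs_div_sub_div_le {a b s t : ℝ} (hb0 : 0 ≤ b) (hb : b ≤ 1) (hs : 1 ≤ s) (ht : 1 ≤ t) :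
    |a / s - b / t| ≤ |a - b| + |s - t| := by
  have h : a / s - b / t = ((a - b) - b * ((s - t) / t)) / s := by field_simp; ring
  rw [h, abs_div, abs_of_pos (by linarith : 0 < s)]
  refine (div_le_self (abs_nonneg _) hs).trans ((abs_sub _ _).trans ?_)
  refine add_le_add le_rfl ?_
  rw [abs_mul, abs_of_nonneg hb0, abs_div, abs_of_pos (by linarith : 0 < t)]
  calc b * (|s - t| / t) ≤ 1 * (|s - t| / t) := by gcongr
    _ ≤ |s - t| := by rw [one_mul]; exact div_le_self (abs_nonneg _) ht

theorem exists_whitneyPartition [LocallyCompactSpace Ω] [MeasurableSpace Ω] [BorelSpace Ω]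
    {μ : Measure Ω} (hμ : IsDoubling μ) (hne : (boundary Ω).Nonempty) :
    Nonempty (WhitneyPartition Ω) := by
  have := hμ.properSpace
  have := hμ.secondCountableTopology
  have hpos := fun x : Ω => whitneyRadius_pos hne x
  obtain ⟨S, hsep, hcov⟩ := exists_whitney_centers Ω
  have hcov := fun y => hcov y (hpos y)
  obtain ⟨N, hN⟩ := whitney_bounded_overlap hμ hpos hsep
  have hover := fun y => exists_finset_whitney (hN y)
  choose near hnear using fun x : Ω => exists_nearest hne x
  let Ψ : Ω → ℝ := fun y => ∑ᶠ x : S, whitneyBump (x : Ω) y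
  have hΨ : ∀ y, 1 ≤ Ψ y := one_le_finsum_whitneyBump hpos hcov
    fun y => (hover y).imp fun t ht x hx => (ht.2 x).2 hx
  have hφ1 : ∀ x y : Ω, whitneyBump x y / Ψ y ≤ 1 := fun x y =>
    (div_le_one (by linarith [hΨ y])).2 ((whitneyBump_le_one x y).trans (hΨ y))
  have hφ0 : ∀ x y : Ω, 0 ≤ whitneyBump x y / Ψ y := fun x y =>
    div_nonneg (whitneyBump_nonneg _ _) (by linarith [hΨ y])
  have hlip : ∀ (x : S) (y z : Ω), dist y (x : Ω) < 2 * whitneyRadius (x : Ω) →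
      |whitneyBump (x : Ω) y / Ψ y - whitneyBump (x : Ω) z / Ψ z| ≤
        (5 * N + 4) / whitneyRadius (x : Ω) * dist y z := by
    intro x y z hy
    have hx0 := hpos x
    rcases lt_or_ge (dist y z) (whitneyRadius (x : Ω) / 4) with hyz | hyz
    · calc _ ≤ |whitneyBump (x : Ω) y - whitneyBump (x : Ω) z| + |Ψ y - Ψ z| :=
            abs_div_sub_div_le (whitneyBump_nonneg _ _) (whitneyBump_le_one _ _) (hΨ y) (hΨ z)
        _ ≤ dist y z / whitneyRadius (x : Ω) + 5 * N / whitneyRadius (x : Ω) * dist y z :=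
            add_le_add (abs_whitneyBump_sub_le hx0 y z)
              (abs_finsum_whitneyBump_sub_le hpos hover hy hyz)
        _ = (5 * N + 1) / whitneyRadius (x : Ω) * dist y z := by ring
        _ ≤ _ := by gcongr; norm_num
    -- At distance at least a quarter of the radius the trivial bound `1` is already of Lipschitz
    -- type.
    · calc _ ≤ 1 := abs_sub_le_of_nonneg_of_le (hφ0 _ _) (hφ1 _ _) (hφ0 _ _) (hφ1 _ _)
        _ = 4 / whitneyRadius (x : Ω) * (whitneyRadius (x : Ω) / 4) := by field_simp
        _ ≤ (5 * N + 4) / whitneyRadius (x : Ω) * dist y z := by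
            gcongr
            have : (0 : ℝ) ≤ N := N.cast_nonneg
            linarith
  exact ⟨{
    centers := S
    countable_centers := countable_whitney_centers hpos hsep
    cover := fun y => by simpa using hcov y
    bounded_overlap := ⟨N, hN⟩
    φ := fun x y => whitneyBump (x : Ω) y / Ψ y
    φ_nonneg := fun x y => hφ0 x y
    φ_le := fun x y => by
      by_cases hy : y ∈ Metric.ball (x : Ω) (2 * whitneyRadius (x : Ω))
      · rw [indicator_of_mem hy]; exact hφ1 x y
      · rw [indicator_of_notMem hy, whitneyBump_eq_zero (hpos x) (by simpa using hy), zero_div]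
    φ_sum := fun y => by
      simp_rw [div_eq_mul_inv]
      rw [← finsum_mul]
      exact mul_inv_cancel₀ (by linarith [hΨ y])
    φ_lipschitz := by
      refine ⟨5 * N + 4, fun x y z => ?_⟩
      by_cases hy : dist y (x : Ω) < 2 * whitneyRadius (x : Ω)
      · exact hlip x y z hy
      · by_cases hz : dist z (x : Ω) < 2 * whitneyRadius (x : Ω)
        · rw [abs_sub_comm, dist_comm y z]; exact hlip x z y hz
        · rw [whitneyBump_eq_zero (hpos x) (not_lt.1 hy),
            whitneyBump_eq_zero (hpos x) (not_lt.1 hz)]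
          have := hpos x
          simp only [zero_div, sub_self, abs_zero]
          positivity
    nearest := fun x => near x
    dist_nearest := fun x => hnear x }⟩

end Whitney

/-- The difference of two means is controlled by the mean oscillation over larger balls. -/
theorem enorm_average_sub_average_rpow_le {Z : Type*} [PseudoMetricSpace Z] [MeasurableSpace Z]
    {ν : Measure Z} {p : ℝ} (hp : 1 ≤ p) {f : Z → ℝ} (hf : Measurable f) {U V : Set Z} {ρ : ℝ}
    (hU : MeasurableSet U) (hbm : Measurable (ballOsc p ν f ρ))
    (hUf : IntegrableOn f U ν) (hVf : IntegrableOn f V ν)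
    (hU0 : ν U ≠ 0) (hUt : ν U ≠ ∞) (hV0 : ν V ≠ 0) (hVt : ν V ≠ ∞)
    (hb0 : ∀ x ∈ U, ν (Metric.ball x ρ) ≠ 0) (hbt : ∀ x ∈ U, ν (Metric.ball x ρ) ≠ ∞)
    (hsub : ∀ x ∈ U, V ⊆ Metric.ball x ρ) {K : ℝ≥0} (hK : K ≠ 0)
    (hKU : ∀ x ∈ U, ν (Metric.ball x ρ) ≤ K * ν U)
    (hKV : ∀ x ∈ U, ν (Metric.ball x ρ) ≤ K * ν V) :
    ‖⨍ x in U, f x ∂ν - ⨍ x in V, f x ∂ν‖ₑ ^ p ≤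
      K * K * ∫⁻ x in U, (ν (Metric.ball x ρ))⁻¹ * ballOsc p ν f ρ x ∂ν := by
  have hp0 : 0 < p := zero_lt_one.trans_le hp
  -- Jensen is used twice: here over `V` with `x` fixed, then over `U`.
  have hpt : ∀ x ∈ U, ‖f x - ⨍ y in V, f y ∂ν‖ₑ ≤ (K * ballOsc p ν f ρ x) ^ (1 / p) := by
    intro x hx
    rw [enorm_sub_rev]
    calc ‖⨍ y in V, f y ∂ν - f x‖ₑ ≤ ⨍⁻ y in V, ‖f y - f x‖ₑ ∂ν :=
          enorm_setAverage_sub_le hVf hV0 hVt _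
      _ ≤ (⨍⁻ y in V, ‖f y - f x‖ₑ ^ p ∂ν) ^ (1 / p) :=
          setLAverage_le_rpow hp hV0 hVt (hf.sub_const _).enorm.aemeasurable
      _ ≤ (K * ⨍⁻ y in Metric.ball x ρ, ‖f y - f x‖ₑ ^ p ∂ν) ^ (1 / p) := by
          gcongr
          exact setLAverage_le_of_subset (hsub x hx) (hKV x hx) (hb0 x hx) (hbt x hx)
      _ = _ := by simp_rw [ballOsc, enorm_sub_rev (f x)]
  have hUavg : ‖⨍ x in U, f x ∂ν - ⨍ x in V, f x ∂ν‖ₑ ≤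
      (⨍⁻ x in U, K * ballOsc p ν f ρ x ∂ν) ^ (1 / p) := by
    calc _ ≤ ⨍⁻ x in U, ‖f x - ⨍ y in V, f y ∂ν‖ₑ ∂ν :=
          enorm_setAverage_sub_le hUf hU0 hUt _
      _ ≤ ⨍⁻ x in U, (K * ballOsc p ν f ρ x) ^ (1 / p) ∂ν := by
          rw [setLAverage_eq, setLAverage_eq]
          gcongr ?_ / _
          exact setLIntegral_mono' hU hpt
      _ ≤ (⨍⁻ x in U, ((K * ballOsc p ν f ρ x) ^ (1 / p)) ^ p ∂ν) ^ (1 / p) :=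
          setLAverage_le_rpow hp hU0 hUt ((hbm.const_mul _).pow_const _).aemeasurable
      _ = _ := by
          simp_rw [← ENNReal.rpow_mul, one_div_mul_cancel hp0.ne', ENNReal.rpow_one]
  calc ‖⨍ x in U, f x ∂ν - ⨍ x in V, f x ∂ν‖ₑ ^ p
      ≤ ((⨍⁻ x in U, K * ballOsc p ν f ρ x ∂ν) ^ (1 / p)) ^ p := by gcongr
    _ = K * ((ν U)⁻¹ * ∫⁻ x in U, ballOsc p ν f ρ x ∂ν) := by
        rw [← ENNReal.rpow_mul, one_div_mul_cancel hp0.ne', ENNReal.rpow_one, setLAverage_eq,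
          lintegral_const_mul _ hbm, div_eq_mul_inv]
        ring
    _ = K * ∫⁻ x in U, (ν U)⁻¹ * ballOsc p ν f ρ x ∂ν := by
        rw [lintegral_const_mul _ hbm]
    _ ≤ K * ∫⁻ x in U, K * ((ν (Metric.ball x ρ))⁻¹ * ballOsc p ν f ρ x) ∂ν := by
        refine mul_le_mul' le_rfl (setLIntegral_mono' hU fun x hx => ?_)
        rw [← mul_assoc]
        gcongr
        exact inv_le_mul_inv hK (hKU x hx)
    _ = _ := by
        rw [lintegral_const_mul' _ _ ENNReal.coe_ne_top]; ring

/-! ### Oscillation of boundary data at the scale of an interior point. -/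

section OscillationEnergy

variable {Ω : Type*} [MetricSpace Ω] [LocallyCompactSpace Ω] [MeasurableSpace Ω] [BorelSpace Ω]
  [MeasurableSpace (boundary Ω)] [BorelSpace (boundary Ω)]
  {μ : Measure Ω} {ν : Measure (boundary Ω)} {p θ : ℝ} {f : boundary Ω → ℝ}

/-- The oscillation density of `f` at the scale `q.1` and the boundary point `q.2`. -/
noncomputable def oscDensity (p : ℝ) (ν : Measure (boundary Ω)) (f : boundary Ω → ℝ)
    (q : ℝ × boundary Ω) : ℝ≥0∞ :=
  (ENNReal.ofReal q.1)⁻¹ * (ENNReal.ofReal (q.1 ^ p))⁻¹ *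
    ((ν (Metric.ball q.2 q.1))⁻¹ * ballOsc p ν f q.1 q.2)

/-- The scales and boundary points relevant for the behaviour of the extension near `w`. -/
def oscRegion (w : Ω) : Set (ℝ × boundary Ω) :=
  {q | 40 * whitneyRadius w ≤ q.1 ∧ q.1 ≤ 80 * whitneyRadius w ∧
    dist (w : UniformSpace.Completion Ω) q.2 < q.1}

/-- The oscillation of `f` at scales comparable to the distance from `w` to the boundary. -/
noncomputable def oscEnergy (p : ℝ) (ν : Measure (boundary Ω)) (f : boundary Ω → ℝ) (w : Ω) :
    ℝ≥0∞ :=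
  ∫⁻ q in oscRegion w, oscDensity p ν f q ∂((volume.restrict (Ioi (0 : ℝ))).prod ν)

theorem continuous_whitneyRadius : Continuous (whitneyRadius : Ω → ℝ) :=
  continuous_bdryDist.div_const 8

theorem TraceSetting.measurableSet_oscRegion (h : TraceSetting p θ μ ν) :
    MeasurableSet {t : Ω × (ℝ × boundary Ω) | t.2 ∈ oscRegion t.1} := by
  have := h.doubling.properSpace
  have := h.doubling.secondCountableTopology
  have hr : Continuous fun t : Ω × (ℝ × boundary Ω) => whitneyRadius t.1 :=
    continuous_whitneyRadius.comp continuous_fst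
  have hρ : Continuous fun t : Ω × (ℝ × boundary Ω) => t.2.1 := continuous_snd.fst
  have hd : Continuous fun t : Ω × (ℝ × boundary Ω) =>
      dist (t.1 : UniformSpace.Completion Ω) t.2.2 :=
    ((UniformSpace.Completion.continuous_coe Ω).comp continuous_fst).dist
      (continuous_subtype_val.comp continuous_snd.snd)
  exact (measurableSet_le (hr.const_mul 40).measurable hρ.measurable).inter
    ((measurableSet_le hρ.measurable (hr.const_mul 80).measurable).inter
      (measurableSet_lt hd.measurable hρ.measurable))

theorem TraceSetting.measurableSet_oscRegion_apply (h : TraceSetting p θ μ ν) (w : Ω) :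
    MeasurableSet (oscRegion w) :=
  measurable_prodMk_left (x := w) h.measurableSet_oscRegion

theorem TraceSetting.measurableSet_ball_prod (h : TraceSetting p θ μ ν) :
    MeasurableSet {t : (ℝ × boundary Ω) × boundary Ω | dist t.2 t.1.2 < t.1.1} := by
  have := h.doubling.properSpace
  have hd : Continuous fun t : (ℝ × boundary Ω) × boundary Ω => dist t.2 t.1.2 :=
    continuous_snd.dist continuous_fst.snd
  exact measurableSet_lt hd.measurable continuous_fst.fst.measurable

theorem TraceSetting.measurable_measure_ball (h : TraceSetting p θ μ ν) :
    Measurable fun q : ℝ × boundary Ω => ν (Metric.ball q.2 q.1) := by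
  have := h.codim.sigmaFinite h.doubling h.pos
  exact measurable_measure_prodMk_left h.measurableSet_ball_prod

theorem TraceSetting.measurable_ballOsc_prod (h : TraceSetting p θ μ ν) (hf : Measurable f) :
    Measurable fun q : ℝ × boundary Ω => ballOsc p ν f q.1 q.2 := by
  have := h.codim.sigmaFinite h.doubling h.pos
  have h2 : Measurable fun t : (ℝ × boundary Ω) × boundary Ω => ‖f t.1.2 - f t.2‖ₑ ^ p :=
    (((hf.comp measurable_fst.snd).sub (hf.comp measurable_snd)).enorm).pow_const p
  have h3 := (h2.indicator h.measurableSet_ball_prod).lintegral_prod_right' (ν := ν)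
  refine (congrArg Measurable (funext fun q => ?_)).mpr (h3.div h.measurable_measure_ball)
  rw [ballOsc, setLAverage_eq, ← lintegral_indicator measurableSet_ball]
  rfl

theorem TraceSetting.measurable_oscDensity (h : TraceSetting p θ μ ν) (hf : Measurable f) :
    Measurable (oscDensity p ν f) :=
  ((measurable_fst.ennreal_ofReal.inv).mul ((measurable_fst.pow_const p).ennreal_ofReal.inv)).mul
    (h.measurable_measure_ball.inv.mul (h.measurable_ballOsc_prod hf))

theorem TraceSetting.measurable_oscEnergy (h : TraceSetting p θ μ ν) (hf : Measurable f) :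
    Measurable (oscEnergy p ν f) := by
  have := h.codim.sigmaFinite h.doubling h.pos
  have h1 := ((h.measurable_oscDensity hf).comp (measurable_snd (α := Ω))).indicator
    h.measurableSet_oscRegion
  refine (congrArg Measurable (funext fun w => ?_)).mpr
    (h1.lintegral_prod_right' (ν := (volume.restrict (Ioi (0 : ℝ))).prod ν))
  rw [oscEnergy, ← lintegral_indicator (h.measurableSet_oscRegion_apply w)]
  rfl

/-- The integral of the oscillation energy is controlled by the Besov seminorm. -/
theorem TraceSetting.lintegral_oscEnergy_le (h : TraceSetting p θ μ ν) :
    ∃ C : ℝ≥0, ∀ f : boundary Ω → ℝ, Measurable f →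
      ∫⁻ w, oscEnergy p ν f w ∂μ ≤ C * besovSeminorm (1 - θ / p) p ν f ^ p := by
  have := h.codim.sigmaFinite h.doubling h.pos
  have := h.doubling.sigmaFinite
  have hp0 := h.pos_p
  obtain ⟨C, hC⟩ := h.codim.iball_le_bball h.doubling 1
  refine ⟨C, fun f hf => ?_⟩
  have hα : (1 - θ / p) * p = p - θ := by field_simp
  rw [besovSeminorm_eq, hα, ← ENNReal.rpow_mul, one_div_mul_cancel hp0.ne', ENNReal.rpow_one]
  set m := (volume.restrict (Ioi (0 : ℝ))).prod ν with hm
  let k : Ω → ℝ × boundary Ω → ℝ≥0∞ := fun w q =>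
    {t : Ω × (ℝ × boundary Ω) | t.2 ∈ oscRegion t.1}.indicator (fun t => oscDensity p ν f t.2) (w, q)
  have hk : Measurable (Function.uncurry k) :=
    ((h.measurable_oscDensity hf).comp measurable_snd).indicator h.measurableSet_oscRegion
  have hbm := h.measurable_ballOsc_prod hf
  calc ∫⁻ w, oscEnergy p ν f w ∂μ = ∫⁻ w, ∫⁻ q, k w q ∂m ∂μ := by
        refine lintegral_congr fun w => ?_
        rw [oscEnergy, ← lintegral_indicator (h.measurableSet_oscRegion_apply w)]
        rfl
    _ = ∫⁻ q, ∫⁻ w, k w q ∂μ ∂m := lintegral_lintegral_swap hk.aemeasurable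
    -- After Fubini, the points `w` whose region contains `q` all lie in the ball of radius `q.1`
    -- about `q.2`. Codimensionality then trades its measure for `q.1 ^ θ` times the ν-measure,
    -- which cancels the normalization.
    _ ≤ ∫⁻ q, oscDensity p ν f q * μ (iball q.2 q.1) ∂m := by
        refine lintegral_mono fun q => ?_
        rw [← setLIntegral_const, ← lintegral_indicator (measurableSet_iball _ _)]
        refine lintegral_mono fun w => ?_
        by_cases hw : q ∈ oscRegion w
        · have hw' : w ∈ iball (q.2 : UniformSpace.Completion Ω) q.1 := hw.2.2
          simp [k, hw, hw']
        · simp [k, hw]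
    _ ≤ ∫⁻ q, C * ((ENNReal.ofReal (q.1 ^ (p - θ)))⁻¹ * (ENNReal.ofReal q.1)⁻¹ *
        ballOsc p ν f q.1 q.2) ∂m := by
        have hae : ∀ᵐ q ∂m, 0 < q.1 := by
          have h1 : ∀ᵐ r ∂(volume.restrict (Ioi (0 : ℝ))), 0 < r :=
            ae_restrict_mem measurableSet_Ioi
          exact Measure.quasiMeasurePreserving_fst.ae h1
        refine lintegral_mono_ae ?_
        filter_upwards [hae] with q hq
        have hb0 := h.codim.ball_pos h.doubling q.2 hq
        have hbt := (h.codim.bball_lt_top h.doubling h.pos q.2 q.1).ne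
        rw [bball_coe] at hbt
        have h1 := hC q.2 q.2 q.1 q.1 hq (by simp)
        have hpθ : (ENNReal.ofReal (q.1 ^ p))⁻¹ * ENNReal.ofReal (q.1 ^ θ) =
            (ENNReal.ofReal (q.1 ^ (p - θ)))⁻¹ := by
          rw [← ENNReal.ofReal_inv_of_pos (by positivity), ← ENNReal.ofReal_mul (by positivity),
            ← ENNReal.ofReal_inv_of_pos (by positivity), Real.rpow_sub hq, inv_div]
          congr 1
          ring
        calc oscDensity p ν f q * μ (iball q.2 q.1)
            ≤ (ENNReal.ofReal q.1)⁻¹ * (ENNReal.ofReal (q.1 ^ p))⁻¹ *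
              ((ν (Metric.ball q.2 q.1))⁻¹ * ballOsc p ν f q.1 q.2) *
              (C * (ENNReal.ofReal (q.1 ^ θ) * ν (Metric.ball q.2 q.1))) := by
              unfold oscDensity; gcongr
          _ = C * (((ENNReal.ofReal (q.1 ^ p))⁻¹ * ENNReal.ofReal (q.1 ^ θ)) *
              (ENNReal.ofReal q.1)⁻¹ * ballOsc p ν f q.1 q.2) *
              ((ν (Metric.ball q.2 q.1))⁻¹ * ν (Metric.ball q.2 q.1)) := by ring
          _ = _ := by rw [ENNReal.inv_mul_cancel hb0.ne' hbt, mul_one, hpθ]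
    _ = _ := by
        have hpow : Measurable fun r : ℝ => (ENNReal.ofReal (r ^ (p - θ)))⁻¹ * (ENNReal.ofReal r)⁻¹ :=
          ((measurable_id.pow_const (p - θ)).ennreal_ofReal.inv).mul
            measurable_id.ennreal_ofReal.inv
        have hpow2 : Measurable fun q : ℝ × boundary Ω =>
            (ENNReal.ofReal (q.1 ^ (p - θ)))⁻¹ * (ENNReal.ofReal q.1)⁻¹ := hpow.comp measurable_fst
        rw [lintegral_const_mul' _ _ ENNReal.coe_ne_top, hm,
          lintegral_prod (fun q : ℝ × boundary Ω => (ENNReal.ofReal (q.1 ^ (p - θ)))⁻¹ *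
            (ENNReal.ofReal q.1)⁻¹ * ballOsc p ν f q.1 q.2) (hpow2.mul hbm).aemeasurable]
        congr 1
        refine lintegral_congr fun r => ?_
        dsimp only
        exact lintegral_const_mul _ (h.measurable_ballOsc hf r)

theorem TraceSetting.le_lintegral_oscDensity (h : TraceSetting p θ μ ν) (hf : Measurable f) {w : Ω}
    {ρ : ℝ} (h1 : 40 * whitneyRadius w ≤ ρ) (h2 : ρ ≤ 80 * whitneyRadius w) :
    (ENNReal.ofReal ρ)⁻¹ * (ENNReal.ofReal (ρ ^ p))⁻¹ *
      ∫⁻ ζ in bball (w : UniformSpace.Completion Ω) ρ,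
        (ν (Metric.ball ζ ρ))⁻¹ * ballOsc p ν f ρ ζ ∂ν ≤
      ∫⁻ ζ, (oscRegion w).indicator (oscDensity p ν f) (ρ, ζ) ∂ν := by
  have hm : Measurable fun ζ : boundary Ω => (ν (Metric.ball ζ ρ))⁻¹ := by
    have : Measurable fun ζ : boundary Ω => ν (Metric.ball ζ ρ) :=
      h.measurable_measure_ball.comp (measurable_prodMk_left (x := ρ))
    exact this.inv
  have hm2 : Measurable fun ζ => (ν (Metric.ball ζ ρ))⁻¹ * ballOsc p ν f ρ ζ :=
    hm.mul (h.measurable_ballOsc hf ρ)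
  rw [← lintegral_const_mul _ hm2,
    ← lintegral_indicator (measurableSet_bball _ _)]
  refine lintegral_mono fun ζ => ?_
  by_cases hζ : ζ ∈ bball (w : UniformSpace.Completion Ω) ρ
  · have hmem : (ρ, ζ) ∈ oscRegion w := ⟨h1, h2, by rw [dist_comm]; exact hζ⟩
    rw [indicator_of_mem hζ, indicator_of_mem hmem]
    exact le_rfl
  · rw [indicator_of_notMem hζ]
    exact zero_le

/-- A quantity controlled at all relevant scales is controlled by the oscillation energy. -/
theorem TraceSetting.le_oscEnergy (h : TraceSetting p θ μ ν) (hf : Measurable f) {w : Ω}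
    {a : ℝ≥0∞} (ha : ∀ ρ : ℝ, 40 * whitneyRadius w ≤ ρ → ρ ≤ 80 * whitneyRadius w →
      a ≤ ∫⁻ ζ in bball (w : UniformSpace.Completion Ω) ρ,
        (ν (Metric.ball ζ ρ))⁻¹ * ballOsc p ν f ρ ζ ∂ν) {R : ℝ} (hR : R = 80 * whitneyRadius w) :
    a ≤ 2 * ENNReal.ofReal (R ^ p) * oscEnergy p ν f w := by
  have := h.codim.sigmaFinite h.doubling h.pos
  have hr : 0 < whitneyRadius w := whitneyRadius_pos h.nonempty w
  have hp0 := h.pos_p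
  have hR0 : 0 < R := by rw [hR]; positivity
  have hRp : ENNReal.ofReal (R ^ p) ≠ 0 := by
    rw [ne_eq, ENNReal.ofReal_eq_zero, not_le]; positivity
  have hreg := h.measurableSet_oscRegion_apply w
  -- The admissible scales form `[R / 2, R]`. The bound on `a` is integrated over them, with the
  -- decreasing weights replaced by their values at `R`.
  have key : (ENNReal.ofReal R)⁻¹ * (ENNReal.ofReal (R ^ p))⁻¹ * a * ENNReal.ofReal (R / 2) ≤
      oscEnergy p ν f w := by
    rw [oscEnergy, ← lintegral_indicator hreg,
      lintegral_prod _ ((h.measurable_oscDensity hf).indicator hreg).aemeasurable]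
    calc (ENNReal.ofReal R)⁻¹ * (ENNReal.ofReal (R ^ p))⁻¹ * a * ENNReal.ofReal (R / 2)
        = ∫⁻ _ in Icc (R / 2) R, (ENNReal.ofReal R)⁻¹ * (ENNReal.ofReal (R ^ p))⁻¹ * a := by
          rw [setLIntegral_const, Real.volume_Icc, sub_half]
      _ ≤ ∫⁻ ρ in Icc (R / 2) R, ∫⁻ ζ, (oscRegion w).indicator (oscDensity p ν f) (ρ, ζ) ∂ν := by
          refine setLIntegral_mono' measurableSet_Icc fun ρ hρ => ?_
          have hρ0 : 0 < ρ := lt_of_lt_of_le (half_pos hR0) hρ.1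
          have hρ40 : 40 * whitneyRadius w ≤ ρ := by linarith [hρ.1]
          have hρ80 : ρ ≤ 80 * whitneyRadius w := hρ.2.trans hR.le
          refine le_trans (mul_le_mul' (mul_le_mul' ?_ ?_) (ha ρ hρ40 hρ80))
            (h.le_lintegral_oscDensity hf hρ40 hρ80)
          · exact ENNReal.inv_le_inv.2 (ENNReal.ofReal_le_ofReal hρ.2)
          · exact ENNReal.inv_le_inv.2
              (ENNReal.ofReal_le_ofReal (Real.rpow_le_rpow hρ0.le hρ.2 hp0.le))
      _ ≤ _ := lintegral_mono_set fun ρ hρ => lt_of_lt_of_le (half_pos hR0) hρ.1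
  calc a = 2 * ENNReal.ofReal (R ^ p) * ((ENNReal.ofReal R)⁻¹ * (ENNReal.ofReal (R ^ p))⁻¹ * a *
        ENNReal.ofReal (R / 2)) := by
        rw [ENNReal.ofReal_div_of_pos two_pos, ENNReal.ofReal_ofNat, div_eq_mul_inv]
        calc a = 1 * 1 * 1 * a := by ring
          _ = (2 * 2⁻¹) * ((ENNReal.ofReal R)⁻¹ * ENNReal.ofReal R) *
              ((ENNReal.ofReal (R ^ p))⁻¹ * ENNReal.ofReal (R ^ p)) * a := by
            rw [ENNReal.mul_inv_cancel two_ne_zero ENNReal.ofNat_ne_top,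
              ENNReal.inv_mul_cancel (by simpa using hR0) ENNReal.ofReal_ne_top,
              ENNReal.inv_mul_cancel hRp ENNReal.ofReal_ne_top]
          _ = _ := by ring
    _ ≤ _ := mul_le_mul' le_rfl key

/-- The difference of the means of `f` over two boundary balls near the projection of `w`. -/
theorem TraceSetting.exists_average_bball_sub_le (h : TraceSetting p θ μ ν) :
    ∃ C : ℝ≥0, ∀ f : boundary Ω → ℝ, Measurable f → (∀ ζ R, IntegrableOn f (Metric.ball ζ R) ν) →
      ∀ (w : Ω) (ζ ξ : boundary Ω) (s t : ℝ), whitneyRadius w / 2 ≤ s → whitneyRadius w / 2 ≤ t →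
        dist (ζ : UniformSpace.Completion Ω) w + s ≤ 17 * whitneyRadius w →
        dist (ξ : UniformSpace.Completion Ω) w + t ≤ 17 * whitneyRadius w →
        ‖⨍ x in Metric.ball ζ s, f x ∂ν - ⨍ x in Metric.ball ξ t, f x ∂ν‖ₑ ≤
          C * ENNReal.ofReal (whitneyRadius w) * oscEnergy p ν f w ^ (1 / p) := by
  have hp0 := h.pos_p
  have hp1 : 0 ≤ 1 / p := by positivity
  -- With `r = whitneyRadius w`, centres are within `34 * r` of each other and `ρ ≤ 80 * r`; the
  -- total `114 * r` is below `300 * (r / 2)`, and both small radii are at least `r / 2`.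
  obtain ⟨K, hK⟩ := h.codim.bball_le h.doubling h.pos 300
  obtain ⟨Q, hQ⟩ : ∃ Q : ℝ≥0∞, Q = ((K + 1) * (K + 1) * (2 * ENNReal.ofReal (80 ^ p))) ^ (1 / p) :=
    ⟨_, rfl⟩
  have hQt : Q ≠ ∞ := hQ ▸ (ENNReal.rpow_lt_top_of_nonneg hp1 (by finiteness)).ne
  refine ⟨Q.toNNReal, fun f hf hint w ζ ξ s t hs ht hζ hξ => ?_⟩
  rw [ENNReal.coe_toNNReal hQt]
  have hr : 0 < whitneyRadius w := whitneyRadius_pos h.nonempty w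
  obtain ⟨r, hrw⟩ : ∃ r, r = whitneyRadius w := ⟨_, rfl⟩
  rw [← hrw] at hr hs ht hζ hξ ⊢
  have hs0 : 0 < s := by linarith
  have ht0 : 0 < t := by linarith
  obtain ⟨U, hU⟩ : ∃ U, U = Metric.ball ζ s := ⟨_, rfl⟩
  obtain ⟨V, hV⟩ : ∃ V, V = Metric.ball ξ t := ⟨_, rfl⟩
  rw [← hU, ← hV]
  have hU0 : ν U ≠ 0 := hU ▸ (h.codim.ball_pos h.doubling ζ hs0).ne'
  have hV0 : ν V ≠ 0 := hV ▸ (h.codim.ball_pos h.doubling ξ ht0).ne'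
  have hfin : ∀ (x : boundary Ω) (R : ℝ), ν (Metric.ball x R) ≠ ∞ := fun x R =>
    (h.codim.bball_lt_top h.doubling h.pos x R).ne
  have hUw : ∀ x ∈ U, dist (x : UniformSpace.Completion Ω) w < 17 * r := fun x hx => by
    have h1 : dist (x : UniformSpace.Completion Ω) ζ < s := by rw [hU] at hx; exact hx
    linarith [dist_triangle (x : UniformSpace.Completion Ω) ζ w]
  have hVw : ∀ x ∈ V, dist (x : UniformSpace.Completion Ω) w < 17 * r := fun x hx => by
    have h1 : dist (x : UniformSpace.Completion Ω) ξ < t := by rw [hV] at hx; exact hx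
    linarith [dist_triangle (x : UniformSpace.Completion Ω) ξ w]
  -- Both balls lie within `17 * r` of `w`, so for each `x` in `U` the ball of radius `ρ ≥ 40 * r`
  -- about `x` contains `V`.
  have hscale : ∀ ρ : ℝ, 40 * r ≤ ρ → ρ ≤ 80 * r →
      ‖⨍ x in U, f x ∂ν - ⨍ x in V, f x ∂ν‖ₑ ^ p ≤
        (K + 1) * (K + 1) * ∫⁻ x in bball (w : UniformSpace.Completion Ω) ρ, (ν (Metric.ball x ρ))⁻¹ * ballOsc p ν f ρ x ∂ν := by
    intro ρ hρ1 hρ2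
    have hmem : ∀ x ∈ U, ∀ y ∈ V, dist y x < 34 * r := fun x hx y hy => by
      have h3 := dist_triangle_right (y : UniformSpace.Completion Ω) x w
      rw [Subtype.dist_eq]
      linarith [hUw x hx, hVw y hy]
    have hle : ∀ m : ℝ≥0∞, (K : ℝ≥0∞) * m ≤ ((K + 1 : ℝ≥0) : ℝ≥0∞) * m := fun m => by
      gcongr; simp
    refine (enorm_average_sub_average_rpow_le h.one_le hf (hU ▸ measurableSet_ball)
      (h.measurable_ballOsc hf ρ) (hU ▸ hint ζ s) (hV ▸ hint ξ t) hU0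
      (hU ▸ hfin _ _) hV0 (hV ▸ hfin _ _) (fun x _ => (h.codim.ball_pos h.doubling x (by linarith)).ne')
      (fun x _ => hfin x ρ) (fun x hx y hy => (hmem x hx y hy).trans_le (by linarith))
      (K := K + 1) (by positivity) (fun x hx => (hK ζ x s ρ hs0 ?_).trans (hU ▸ hle _))
      (fun x hx => (hK ξ x t ρ ht0 ?_).trans (hV ▸ hle _))).trans ?_
    · have h3 := dist_triangle_right (ζ : UniformSpace.Completion Ω) x w
      linarith [hUw x hx]
    · have h3 := dist_triangle_right (ξ : UniformSpace.Completion Ω) x w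
      linarith [hUw x hx]
    · rw [ENNReal.coe_add, ENNReal.coe_one]
      exact mul_le_mul' le_rfl
        (lintegral_mono_set fun x hx => (hUw x hx).trans_le (by linarith))
  obtain ⟨D, hDdef⟩ : ∃ D, D = ‖⨍ x in U, f x ∂ν - ⨍ x in V, f x ∂ν‖ₑ := ⟨_, rfl⟩
  rw [← hDdef]
  have hD : D ^ p ≤ (K + 1) * (K + 1) * (2 * ENNReal.ofReal ((80 * r) ^ p) * oscEnergy p ν f w) := by
    have hKK : ((K : ℝ≥0∞) + 1) * (K + 1) ≠ ∞ := by finiteness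
    have hK0 : ((K : ℝ≥0∞) + 1) * (K + 1) ≠ 0 := by simp
    rw [mul_comm, ← ENNReal.div_le_iff hK0 hKK]
    refine h.le_oscEnergy hf (fun ρ h1 h2 => ?_) (by rw [hrw])
    rw [← hrw] at h1 h2
    rw [ENNReal.div_le_iff hK0 hKK, mul_comm]
    rw [hDdef]
    exact hscale ρ h1 h2
  calc D = (D ^ p) ^ (1 / p) := by
        rw [← ENNReal.rpow_mul, mul_one_div_cancel hp0.ne', ENNReal.rpow_one]
    _ ≤ ((K + 1) * (K + 1) * (2 * ENNReal.ofReal ((80 * r) ^ p) * oscEnergy p ν f w)) ^ (1 / p) := by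
        gcongr
    _ = (((K + 1) * (K + 1) * (2 * ENNReal.ofReal (80 ^ p))) * ENNReal.ofReal r ^ p *
        oscEnergy p ν f w) ^ (1 / p) := by
        rw [Real.mul_rpow (by norm_num) hr.le, ENNReal.ofReal_mul (by positivity),
          ENNReal.ofReal_rpow_of_nonneg hr.le hp0.le]
        congr 1; ring
    _ = _ := by
        rw [ENNReal.mul_rpow_of_nonneg _ _ hp1, ENNReal.mul_rpow_of_nonneg _ _ hp1, ← hQ,
          ← ENNReal.rpow_mul, mul_one_div_cancel hp0.ne', ENNReal.rpow_one]

end OscillationEnergy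

/-! ### Upper gradients from local Lipschitz estimates. -/

section UpperGradient

variable {Z : Type*} [PseudoMetricSpace Z] [MeasurableSpace Z]

/-- A local Lipschitz estimate, with a constant that may be evaluated at any nearby point, yields
an upper gradient. -/
theorem isUpperGradient_of_enorm_sub_le {u r : Z → ℝ} {g : Z → ℝ≥0∞} (hg : Measurable g)
    (hr : Continuous r) (hpos : ∀ x, 0 < r x)
    (h : ∀ w y z, dist y w ≤ r w → dist z w ≤ r w →
      ‖u y - u z‖ₑ ≤ ENNReal.ofReal (dist y z) * g w) : IsUpperGradient u g := by
  refine ⟨hg, fun γ => ?_⟩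
  obtain ⟨L, hL⟩ : ∃ L, L = γ.length := ⟨_, rfl⟩
  have hdist : ∀ s ∈ Icc 0 L, ∀ t ∈ Icc 0 L, dist (γ.toFun s) (γ.toFun t) ≤ |s - t| := by
    rw [hL]
    intro s hs t ht
    rcases le_total s t with hst | hst
    · rw [abs_sub_comm, abs_of_nonneg (sub_nonneg.2 hst)]
      exact γ.dist_le hs ht hst
    · rw [dist_comm, abs_of_nonneg (sub_nonneg.2 hst)]
      exact γ.dist_le ht hs hst
  have hL0 : 0 ≤ L := hL ▸ γ.length_nonneg
  have hcont : ContinuousOn γ.toFun (Icc 0 L) := by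
    refine LipschitzOnWith.continuousOn (K := 1) (LipschitzOnWith.of_dist_le_mul fun s hs t ht => ?_)
    rw [NNReal.coe_one, one_mul]
    exact hdist s hs t ht
  -- Compactness of the curve gives one positive radius valid along all of it, and hence a
  -- subdivision into finitely many pieces to which the local estimate applies.
  obtain ⟨t₀, -, ht₀⟩ := isCompact_Icc.exists_isMinOn ⟨0, left_mem_Icc.2 hL0⟩
    (hr.comp_continuousOn hcont)
  have hm : ∀ t ∈ Icc 0 L, r (γ.toFun t₀) ≤ r (γ.toFun t) := fun t ht => ht₀ ht
  have hm0 := hpos (γ.toFun t₀)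
  obtain ⟨n, hn⟩ := exists_nat_gt (L / r (γ.toFun t₀))
  have hn0 : (0 : ℝ) < n := (div_nonneg hL0 hm0.le).trans_lt hn
  have hδ : L / n ≤ r (γ.toFun t₀) := by
    rw [div_lt_iff₀ hm0] at hn
    rw [div_le_iff₀ hn0]
    linarith
  have hδ0 : 0 ≤ L / n := by positivity
  obtain ⟨δ, hδdef⟩ : ∃ δ, δ = L / n := ⟨_, rfl⟩
  rw [← hδdef] at hδ hδ0
  have hδn : δ * n = L := by rw [hδdef]; field_simp
  have hmem : ∀ k : ℕ, k ≤ n → δ * k ∈ Icc 0 L := fun k hk => by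
    have : (k : ℝ) ≤ n := by exact_mod_cast hk
    exact ⟨by positivity, hδn ▸ by gcongr⟩
  have hstep : ∀ k : ℕ, k ≤ n → ‖u (γ.toFun (δ * k)) - u (γ.toFun 0)‖ₑ ≤
      ∫⁻ t in Ioc 0 (δ * k), g (γ.toFun t) := by
    intro k
    induction k with
    | zero => intro; simp
    | succ k ih =>
      intro hk
      have hk' := ih (by omega)
      have hmk := hmem k (by omega)
      have hmk' := hmem (k + 1) hk
      have hlen : δ * (k + 1 : ℕ) - δ * k = δ := by push_cast; ring
      have hlt : δ * k ≤ δ * (k + 1 : ℕ) := by linarith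
      -- The increment over a piece is at most `δ * g (γ t)` for every `t` in the piece, since the
      -- estimate may be evaluated at any nearby point; averaging over `t` gives the integral.
      have hloc : ‖u (γ.toFun (δ * (k + 1 : ℕ))) - u (γ.toFun (δ * k))‖ₑ ≤
          ∫⁻ t in Ioc (δ * k) (δ * (k + 1 : ℕ)), g (γ.toFun t) := by
        rcases hδ0.eq_or_lt with h0 | h0
        · rw [← h0]; simp
        have hne : ENNReal.ofReal δ ≠ 0 := by simpa using h0
        calc _ = ∫⁻ _ in Ioc (δ * k) (δ * (k + 1 : ℕ)),
              ‖u (γ.toFun (δ * (k + 1 : ℕ))) - u (γ.toFun (δ * k))‖ₑ / ENNReal.ofReal δ := by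
              rw [setLIntegral_const, Real.volume_Ioc, hlen,
                ENNReal.div_mul_cancel hne ENNReal.ofReal_ne_top]
          _ ≤ _ := by
              refine setLIntegral_mono' measurableSet_Ioc fun t ht => ?_
              have htL : t ∈ Icc 0 L := ⟨hmk.1.trans ht.1.le, ht.2.trans hmk'.2⟩
              have h1 := (hdist _ hmk' _ htL).trans
                ((abs_of_nonneg (sub_nonneg.2 ht.2)).le.trans (by linarith [ht.1] : _ ≤ δ))
              have h2 := (hdist _ hmk _ htL).trans
                ((abs_of_nonpos (sub_nonpos.2 ht.1.le)).le.trans (by linarith [ht.2] : _ ≤ δ))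
              have h3 := (hdist _ hmk' _ hmk).trans
                ((abs_of_nonneg (sub_nonneg.2 hlt)).le.trans hlen.le)
              have h4 := hδ.trans (hm t htL)
              refine ENNReal.div_le_of_le_mul ((h _ _ _ (h1.trans h4) (h2.trans h4)).trans ?_)
              rw [mul_comm]
              exact mul_le_mul' le_rfl (ENNReal.ofReal_le_ofReal h3)
      calc _ ≤ _ := enorm_sub_le_add (u (γ.toFun (δ * k)))
        _ ≤ (∫⁻ t in Ioc (δ * k) (δ * (k + 1 : ℕ)), g (γ.toFun t)) +
            ∫⁻ t in Ioc 0 (δ * k), g (γ.toFun t) := add_le_add hloc hk'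
        _ = _ := by
            rw [add_comm, ← lintegral_union measurableSet_Ioc (Ioc_disjoint_Ioc_of_le le_rfl),
              Ioc_union_Ioc_eq_Ioc hmk.1 hlt]
  have hfin := hstep n le_rfl
  rw [hδn, hL] at hfin
  exact hfin.trans (lintegral_mono_set Ioc_subset_Icc_self)

end UpperGradient

/-! ### Locally finite sums against the partition of unity. -/

section PartitionOfUnity

variable {Ω : Type*} [MetricSpace Ω] (W : WhitneyPartition Ω)

theorem WhitneyPartition.φ_eq_zero {x : W.centers} {y : Ω}
    (h : ¬ dist y (x : Ω) < 2 * whitneyRadius (x : Ω)) : W.φ x y = 0 := by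
  refine le_antisymm ((W.φ_le x y).trans ?_) (W.φ_nonneg x y)
  rw [indicator_of_notMem (by simpa using h)]

theorem WhitneyPartition.exists_finset : ∃ N : ℕ, ∀ y : Ω, ∃ t : Finset W.centers, t.card ≤ N ∧
    ∀ x : W.centers, x ∈ t ↔ dist y (x : Ω) < 2 * whitneyRadius (x : Ω) := by
  obtain ⟨N, hN⟩ := W.bounded_overlap
  exact ⟨N, fun y => exists_finset_whitney (hN y)⟩

variable {W}

theorem WhitneyPartition.finsum_mul_φ (c : W.centers → ℝ) {t : Finset W.centers} {y : Ω}
    (ht : ∀ x : W.centers, dist y (x : Ω) < 2 * whitneyRadius (x : Ω) → x ∈ t) :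
    ∑ᶠ x, c x * W.φ x y = ∑ x ∈ t, c x * W.φ x y := by
  refine finsum_eq_sum_of_support_subset _ fun x hx => ht x ?_
  by_contra hcon
  exact hx (by simp [W.φ_eq_zero hcon])

theorem WhitneyPartition.sum_φ {t : Finset W.centers} {y : Ω}
    (ht : ∀ x : W.centers, dist y (x : Ω) < 2 * whitneyRadius (x : Ω) → x ∈ t) :
    ∑ x ∈ t, W.φ x y = 1 := by
  have := W.finsum_mul_φ (fun _ => 1) ht
  simp only [one_mul] at this
  rw [← this, W.φ_sum]

theorem WhitneyPartition.finsum_mul_φ_add (c d : W.centers → ℝ) (y : Ω) :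
    ∑ᶠ x, (c x + d x) * W.φ x y = ∑ᶠ x, c x * W.φ x y + ∑ᶠ x, d x * W.φ x y := by
  obtain ⟨N, hN⟩ := W.exists_finset
  obtain ⟨t, -, ht⟩ := hN y
  have ht' := fun x => (ht x).2
  rw [W.finsum_mul_φ c ht', W.finsum_mul_φ d ht', W.finsum_mul_φ (fun x => c x + d x) ht',
    ← Finset.sum_add_distrib]
  simp_rw [add_mul]

theorem WhitneyPartition.finsum_mul_φ_smul (a : ℝ) (c : W.centers → ℝ) (y : Ω) :
    ∑ᶠ x, (a * c x) * W.φ x y = a * ∑ᶠ x, c x * W.φ x y := by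
  obtain ⟨N, hN⟩ := W.exists_finset
  obtain ⟨t, -, ht⟩ := hN y
  have ht' := fun x => (ht x).2
  rw [W.finsum_mul_φ c ht', W.finsum_mul_φ (fun x => a * c x) ht', Finset.mul_sum]
  simp_rw [mul_assoc]

theorem WhitneyPartition.enorm_finsum_mul_φ_sub_le {c : W.centers → ℝ} {y : Ω} {b : ℝ} {M : ℝ≥0∞}
    (h : ∀ x : W.centers, dist y (x : Ω) < 2 * whitneyRadius (x : Ω) → ‖c x - b‖ₑ ≤ M) :
    ‖∑ᶠ x, c x * W.φ x y - b‖ₑ ≤ M := by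
  obtain ⟨N, hN⟩ := W.exists_finset
  obtain ⟨t, -, ht⟩ := hN y
  have ht' := fun x => (ht x).2
  have hsum := W.sum_φ ht'
  calc ‖∑ᶠ x, c x * W.φ x y - b‖ₑ = ‖∑ x ∈ t, (c x - b) * W.φ x y‖ₑ := by
        simp_rw [sub_mul]
        rw [W.finsum_mul_φ c ht', Finset.sum_sub_distrib, ← Finset.mul_sum, hsum, mul_one]
    _ ≤ ∑ x ∈ t, ‖(c x - b) * W.φ x y‖ₑ := enorm_sum_le _ _
    _ ≤ ∑ x ∈ t, M * ENNReal.ofReal (W.φ x y) := by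
        refine Finset.sum_le_sum fun x hx => ?_
        rw [enorm_mul, Real.enorm_of_nonneg (W.φ_nonneg x y)]
        exact mul_le_mul' (h x ((ht x).1 hx)) le_rfl
    _ = M := by
        rw [← Finset.mul_sum, ← ENNReal.ofReal_sum_of_nonneg fun x _ => W.φ_nonneg x y, hsum,
          ENNReal.ofReal_one, mul_one]

-- The sum over `x` of `W.φ x y - W.φ x z` vanishes, so any constant `b` may be subtracted from the
-- coefficients. Only the boundedly many balls active at `y` or `z` contribute, and `s` bounds their
-- radii from below.
variable (W) in
theorem WhitneyPartition.exists_enorm_finsum_sub_le : ∃ C : ℝ≥0, ∀ (c : W.centers → ℝ) (y z : Ω)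
    (b s : ℝ) (M : ℝ≥0∞), 0 < s → (∀ x : W.centers,
      dist y (x : Ω) < 2 * whitneyRadius (x : Ω) ∨ dist z (x : Ω) < 2 * whitneyRadius (x : Ω) →
        s ≤ whitneyRadius (x : Ω) ∧ ‖c x - b‖ₑ ≤ M) →
    ‖∑ᶠ x, c x * W.φ x y - ∑ᶠ x, c x * W.φ x z‖ₑ ≤ C * M * ENNReal.ofReal (dist y z / s) := by
  classical
  obtain ⟨N, hN⟩ := W.exists_finset
  obtain ⟨A, hA⟩ := W.φ_lipschitz
  refine ⟨2 * N * |A|.toNNReal, fun c y z b s M hs h => ?_⟩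
  obtain ⟨ty, hty, hy⟩ := hN y
  obtain ⟨tz, htz, hz⟩ := hN z
  have hy' : ∀ x : W.centers, dist y (x : Ω) < 2 * whitneyRadius (x : Ω) → x ∈ ty ∪ tz :=
    fun x hx => Finset.mem_union_left _ ((hy x).2 hx)
  have hz' : ∀ x : W.centers, dist z (x : Ω) < 2 * whitneyRadius (x : Ω) → x ∈ ty ∪ tz :=
    fun x hx => Finset.mem_union_right _ ((hz x).2 hx)
  have hcard : (ty ∪ tz).card ≤ 2 * N := (Finset.card_union_le ty tz).trans (by omega)
  calc ‖∑ᶠ x, c x * W.φ x y - ∑ᶠ x, c x * W.φ x z‖ₑ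
      = ‖∑ x ∈ ty ∪ tz, (c x - b) * (W.φ x y - W.φ x z)‖ₑ := by
        congr 1
        rw [W.finsum_mul_φ c hy', W.finsum_mul_φ c hz', ← Finset.sum_sub_distrib]
        simp_rw [sub_mul _ b, ← mul_sub]
        rw [Finset.sum_sub_distrib, ← Finset.mul_sum, Finset.sum_sub_distrib, W.sum_φ hy',
          W.sum_φ hz', sub_self, mul_zero, sub_zero]
    _ ≤ ∑ x ∈ ty ∪ tz, ‖(c x - b) * (W.φ x y - W.φ x z)‖ₑ := enorm_sum_le _ _
    _ ≤ ∑ x ∈ ty ∪ tz, M * ENNReal.ofReal (|A| * (dist y z / s)) := by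
        refine Finset.sum_le_sum fun x hx => ?_
        obtain ⟨h1, h2⟩ := h x ((Finset.mem_union.1 hx).imp (hy x).1 (hz x).1)
        rw [enorm_mul, Real.enorm_eq_ofReal_abs (W.φ x y - W.φ x z)]
        refine mul_le_mul' h2 (ENNReal.ofReal_le_ofReal ((hA x y z).trans ?_))
        calc A / whitneyRadius (x : Ω) * dist y z ≤ |A| / s * dist y z := by
              gcongr
              exact le_abs_self A
          _ = _ := by ring
    _ = (ty ∪ tz).card * (M * ENNReal.ofReal (|A| * (dist y z / s))) := by simp
    _ ≤ (2 * N : ℕ) * (M * ENNReal.ofReal (|A| * (dist y z / s))) := by gcongr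
    _ = _ := by
        rw [ENNReal.ofReal_mul (abs_nonneg A)]
        push_cast
        rw [ENNReal.ofReal]
        ring

variable [MeasurableSpace Ω] [BorelSpace Ω]

theorem WhitneyPartition.measurable_finsum_mul_φ (c : W.centers → ℝ) :
    Measurable fun y => ∑ᶠ x, c x * W.φ x y := by
  have := W.countable_centers.to_subtype
  have hφ : ∀ x, Measurable (W.φ x) := fun x => by
    obtain ⟨A, hA⟩ := W.φ_lipschitz
    refine (LipschitzWith.of_dist_le_mul (K := (A / whitneyRadius (x : Ω)).toNNReal)
      fun y z => (hA x y z).trans ?_).continuous.measurable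
    gcongr
    exact Real.le_coe_toNNReal _
  -- The finite partial sums are eventually constant at each point; countability of the centres
  -- makes this limit along finite sets preserve measurability.
  refine measurable_of_tendsto_metrizable' (f := fun s : Finset W.centers => fun y =>
    ∑ x ∈ s, c x * W.φ x y) atTop (fun s => Finset.measurable_fun_sum _ fun x _ => (hφ x).const_mul _) ?_
  refine tendsto_pi_nhds.2 fun y => ?_
  obtain ⟨N, hN⟩ := W.exists_finset
  obtain ⟨t, -, ht⟩ := hN y
  rw [W.finsum_mul_φ c fun x => (ht x).2]
  refine tendsto_const_nhds.congr' ?_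
  filter_upwards [eventually_ge_atTop t] with s hs
  rw [← W.finsum_mul_φ c fun x => (ht x).2, ← W.finsum_mul_φ c fun x hx => hs ((ht x).2 hx)]

end PartitionOfUnity

/-! ### The extension as a Dirichlet function. -/

section Extension

variable {Ω : Type*} [MetricSpace Ω] [LocallyCompactSpace Ω] [MeasurableSpace Ω] [BorelSpace Ω]
  [MeasurableSpace (boundary Ω)] [BorelSpace (boundary Ω)]
  {μ : Measure Ω} {ν : Measure (boundary Ω)} {p θ : ℝ} {f : boundary Ω → ℝ}
  (W : WhitneyPartition Ω)

-- Here `whitneyRadius x` is at most `11 / 8 * whitneyRadius w`. The way from the nearest point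
-- through `x` and `y` to `w`, plus the ball radius, costs at most `11 * whitneyRadius x +
-- whitneyRadius w / 4`, which is below `17 * whitneyRadius w`.
variable {W} in
theorem WhitneyPartition.dist_nearest_add_le {w y : Ω} (hw : 0 < whitneyRadius w)
    (hy : dist y w ≤ whitneyRadius w / 4)
    {x : W.centers} (hx : dist y (x : Ω) < 2 * whitneyRadius (x : Ω)) :
    whitneyRadius w / 2 ≤ whitneyRadius (x : Ω) ∧
      dist (W.nearest x : UniformSpace.Completion Ω) w + whitneyRadius (x : Ω) ≤
        17 * whitneyRadius w := by
  obtain ⟨h1, h2⟩ := whitneyRadius_bounds hx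
  have h3 := whitneyRadius_le_add y w
  have h4 := whitneyRadius_le_add w y
  rw [dist_comm] at h4
  have h5 : dist ((x : Ω) : UniformSpace.Completion Ω) (W.nearest x) =
      8 * whitneyRadius (x : Ω) := by
    rw [W.dist_nearest, whitneyRadius]; ring
  have h6 := dist_triangle (W.nearest x : UniformSpace.Completion Ω) (x : Ω) w
  have h7 := dist_triangle_left (x : Ω) w y
  rw [dist_comm (W.nearest x : UniformSpace.Completion Ω) (x : Ω), h5,
    UniformSpace.Completion.dist_eq] at h6
  constructor <;> linarith

/-- The Lipschitz estimate for the extension. -/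
theorem TraceSetting.exists_extend_sub_le (h : TraceSetting p θ μ ν) :
    ∃ C : ℝ≥0, ∀ f : boundary Ω → ℝ, Measurable f → (∀ ζ R, IntegrableOn f (Metric.ball ζ R) ν) →
      ∀ w y z : Ω, dist y w ≤ whitneyRadius w / 4 → dist z w ≤ whitneyRadius w / 4 →
        ‖W.extend ν f y - W.extend ν f z‖ₑ ≤
          ENNReal.ofReal (dist y z) * (C * oscEnergy p ν f w ^ (1 / p)) := by
  have := h.doubling.properSpace
  obtain ⟨C₁, h₁⟩ := W.exists_enorm_finsum_sub_le
  obtain ⟨C₂, h₂⟩ := h.exists_average_bball_sub_le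
  refine ⟨2 * C₁ * C₂, fun f hf hint w y z hy hz => ?_⟩
  have hw := whitneyRadius_pos h.nonempty w
  obtain ⟨ζ, hζ⟩ := exists_nearest h.nonempty w
  have hζ' : dist (ζ : UniformSpace.Completion Ω) w + whitneyRadius w ≤ 17 * whitneyRadius w := by
    rw [dist_comm, hζ]
    unfold whitneyRadius at hw ⊢
    linarith
  refine (h₁ _ y z (⨍ ξ in Metric.ball ζ (whitneyRadius w), f ξ ∂ν) (whitneyRadius w / 2)
    (C₂ * ENNReal.ofReal (whitneyRadius w) * oscEnergy p ν f w ^ (1 / p)) (by linarith)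
    fun x hx => ?_).trans ?_
  · obtain ⟨h3, h4⟩ : whitneyRadius w / 2 ≤ whitneyRadius (x : Ω) ∧
        dist (W.nearest x : UniformSpace.Completion Ω) w + whitneyRadius (x : Ω) ≤
          17 * whitneyRadius w :=
      hx.elim (W.dist_nearest_add_le hw hy) (W.dist_nearest_add_le hw hz)
    exact ⟨h3, h₂ f hf hint w _ ζ _ _ h3 (by linarith) h4 hζ'⟩
  · have h5 : ENNReal.ofReal (whitneyRadius w) * ENNReal.ofReal (dist y z / (whitneyRadius w / 2)) =
        2 * ENNReal.ofReal (dist y z) := by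
      rw [← ENNReal.ofReal_mul hw.le, ← ENNReal.ofReal_ofNat 2, ← ENNReal.ofReal_mul (by norm_num)]
      congr 1
      field_simp
    refine le_of_eq ?_
    push_cast
    calc _ = C₁ * C₂ * oscEnergy p ν f w ^ (1 / p) * (ENNReal.ofReal (whitneyRadius w) *
          ENNReal.ofReal (dist y z / (whitneyRadius w / 2))) := by ring
      _ = _ := by rw [h5]; ring

/-- The extension of a Besov function is a Dirichlet function, with an estimate. -/
theorem TraceSetting.dirichletSeminorm_extend_le (h : TraceSetting p θ μ ν) :
    ∃ C : ℝ≥0, ∀ f : boundary Ω → ℝ, Measurable f → besovSeminorm (1 - θ / p) p ν f < ∞ →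
      dirichletSeminorm p μ (W.extend ν f) ≤ C * besovSeminorm (1 - θ / p) p ν f := by
  have hp0 := h.pos_p
  obtain ⟨C₁, h₁⟩ := h.exists_extend_sub_le W
  obtain ⟨C₂, h₂⟩ := h.lintegral_oscEnergy_le
  refine ⟨C₁ * C₂ ^ (1 / p), fun f hf hfin => ?_⟩
  have hosc := h.measurable_oscEnergy (p := p) hf
  have hug : IsUpperGradient (W.extend ν f) fun w => C₁ * oscEnergy p ν f w ^ (1 / p) :=
    isUpperGradient_of_enorm_sub_le ((hosc.pow_const _).const_mul _)
      (continuous_whitneyRadius.div_const 4)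
      (fun x => by have := whitneyRadius_pos h.nonempty x; positivity)
      (h₁ f hf (h.integrableOn_of_besovSeminorm_lt_top hf hfin))
  refine (hug.dirichletSeminorm_le h.one_le).trans ?_
  calc (∫⁻ w, ((C₁ : ℝ≥0∞) * oscEnergy p ν f w ^ (1 / p)) ^ p ∂μ) ^ (1 / p)
      = ((C₁ : ℝ≥0∞) ^ p * ∫⁻ w, oscEnergy p ν f w ∂μ) ^ (1 / p) := by
        simp_rw [ENNReal.mul_rpow_of_nonneg _ _ hp0.le, ← ENNReal.rpow_mul,
          one_div_mul_cancel hp0.ne', ENNReal.rpow_one]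
        rw [lintegral_const_mul _ hosc]
    _ ≤ ((C₁ : ℝ≥0∞) ^ p * (C₂ * besovSeminorm (1 - θ / p) p ν f ^ p)) ^ (1 / p) :=
        ENNReal.rpow_le_rpow (mul_le_mul' le_rfl (h₂ f hf)) (by positivity)
    _ = _ := by
        have hp1 : 0 ≤ 1 / p := by positivity
        rw [ENNReal.mul_rpow_of_nonneg _ _ hp1, ENNReal.mul_rpow_of_nonneg _ _ hp1,
          ← ENNReal.rpow_mul, ← ENNReal.rpow_mul, mul_one_div_cancel hp0.ne', ENNReal.rpow_one,
          ENNReal.rpow_one, ENNReal.coe_mul, ENNReal.coe_rpow_of_nonneg _ hp1, mul_assoc]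

theorem TraceSetting.extend_mem_dirichletSpace (h : TraceSetting p θ μ ν) (hf : Measurable f)
    (hfin : besovSeminorm (1 - θ / p) p ν f < ∞) : W.extend ν f ∈ dirichletSpace p μ := by
  obtain ⟨C, hC⟩ := h.dirichletSeminorm_extend_le W
  exact ⟨(W.measurable_finsum_mul_φ _).aemeasurable,
    (hC f hf hfin).trans_lt (ENNReal.mul_lt_top ENNReal.coe_lt_top hfin)⟩

end Extension

/-! ### Algebra of the Besov seminorm. -/

section BesovSpace

variable {Z : Type*} [PseudoMetricSpace Z] [MeasurableSpace Z] {ν : Measure Z} {α p : ℝ}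

theorem besovSeminorm_congr_ae {f g : Z → ℝ} (h : f =ᵐ[ν] g) :
    besovSeminorm α p ν f = besovSeminorm α p ν g := by
  simp_rw [besovSeminorm_eq]
  congr 1
  refine lintegral_congr fun r => ?_
  congr 1
  refine lintegral_congr_ae ?_
  filter_upwards [h] with y hy
  refine laverage_congr ?_
  filter_upwards [ae_restrict_of_ae h] with x hx
  rw [hx, hy]

theorem besovSeminorm_const_mul (hp : 0 < p) (c : ℝ) (f : Z → ℝ) :
    besovSeminorm α p ν (fun x => c * f x) = ‖c‖ₑ * besovSeminorm α p ν f := by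
  have hc : ‖c‖ₑ ^ p ≠ ∞ := (ENNReal.rpow_lt_top_of_nonneg hp.le enorm_ne_top).ne
  have hosc : ∀ r y, ballOsc p ν (fun x => c * f x) r y = ‖c‖ₑ ^ p * ballOsc p ν f r y := by
    intro r y
    simp_rw [ballOsc, setLAverage_eq, ← mul_sub, enorm_mul, ENNReal.mul_rpow_of_nonneg _ _ hp.le]
    rw [lintegral_const_mul' _ _ hc, mul_div_assoc]
  simp_rw [besovSeminorm_eq, hosc, lintegral_const_mul' _ _ hc, mul_left_comm _ (‖c‖ₑ ^ p)]
  rw [lintegral_const_mul' _ _ hc, ENNReal.mul_rpow_of_nonneg _ _ (by positivity), ← ENNReal.rpow_mul,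
    mul_one_div_cancel hp.ne', ENNReal.rpow_one]

end BesovSpace

/-! ### The Besov space as a vector space, and the trace of the extension. -/

section Extension

variable {Ω : Type*} [MetricSpace Ω] [LocallyCompactSpace Ω] [MeasurableSpace Ω] [BorelSpace Ω]
  [MeasurableSpace (boundary Ω)] [BorelSpace (boundary Ω)]
  {μ : Measure Ω} {ν : Measure (boundary Ω)} {p θ α : ℝ}

theorem TraceSetting.ballOsc_add_le (h : TraceSetting p θ μ ν) {f g : boundary Ω → ℝ}
    (hf : Measurable f) (r : ℝ) (y : boundary Ω) :
    ballOsc p ν (fun x => f x + g x) r y ≤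
      2 ^ (p - 1) * (ballOsc p ν f r y + ballOsc p ν g r y) := by
  have hm : Measurable fun x => ‖f y - f x‖ₑ ^ p := ((hf.const_sub _).enorm).pow_const p
  have h2 : (2 : ℝ≥0∞) ^ (p - 1) ≠ ∞ :=
    (ENNReal.rpow_lt_top_of_nonneg (by linarith [h.one_le]) ENNReal.ofNat_ne_top).ne
  simp_rw [ballOsc, setLAverage_eq]
  rw [← ENNReal.add_div, ← lintegral_add_left hm, ← mul_div_assoc, ← lintegral_const_mul' _ _ h2]
  gcongr ?_ / _
  refine lintegral_mono fun x => ?_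
  refine le_trans (ENNReal.rpow_le_rpow ?_ h.pos_p.le)
    (ENNReal.rpow_add_le_mul_rpow_add_rpow _ _ h.one_le)
  rw [add_sub_add_comm]
  exact enorm_add_le _ _

/-- Closure under addition needs only finiteness, so the convexity bound with factor `2 ^ (p - 1)`
can stand in for the triangle inequality. -/
theorem TraceSetting.besovSeminorm_add_lt_top (h : TraceSetting p θ μ ν) {f g : boundary Ω → ℝ}
    (hf : Measurable f) (hfin : besovSeminorm α p ν f < ∞) (hgin : besovSeminorm α p ν g < ∞) :
    besovSeminorm α p ν (fun x => f x + g x) < ∞ := by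
  have := h.codim.sigmaFinite h.doubling h.pos
  have hp : 0 < 1 / p := one_div_pos.2 h.pos_p
  have h2 : (2 : ℝ≥0∞) ^ (p - 1) ≠ ∞ :=
    (ENNReal.rpow_lt_top_of_nonneg (by linarith [h.one_le]) ENNReal.ofNat_ne_top).ne
  rw [besovSeminorm_eq, ENNReal.rpow_lt_top_iff_of_pos hp] at *
  have hpow : Measurable fun r : ℝ => (ENNReal.ofReal (r ^ (α * p)))⁻¹ * (ENNReal.ofReal r)⁻¹ :=
    ((measurable_id.pow_const (α * p)).ennreal_ofReal.inv).mul measurable_id.ennreal_ofReal.inv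
  have hm : Measurable fun r : ℝ => (ENNReal.ofReal (r ^ (α * p)))⁻¹ * (ENNReal.ofReal r)⁻¹ *
      ∫⁻ y, ballOsc p ν f r y ∂ν :=
    hpow.mul (h.measurable_ballOsc_prod hf).lintegral_prod_right'
  refine lt_of_le_of_lt ?_ (ENNReal.mul_lt_top h2.lt_top (ENNReal.add_lt_top.2 ⟨hfin, hgin⟩))
  rw [← lintegral_add_left hm, ← lintegral_const_mul' _ _ h2]
  refine lintegral_mono fun r => ?_
  rw [← mul_add, ← lintegral_add_left (h.measurable_ballOsc hf r), mul_left_comm,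
    ← lintegral_const_mul' _ _ h2]
  exact mul_le_mul' le_rfl (lintegral_mono fun y => h.ballOsc_add_le hf r y)

theorem TraceSetting.mem_besovSpace_iff (h : TraceSetting p θ μ ν) {f : boundary Ω →ₘ[ν] ℝ} :
    f ∈ besovSpace α p ν ↔ besovSeminorm α p ν f < ∞ :=
  ⟨fun hf => hf.2, fun hf => ⟨fun ζ => ⟨_, Metric.ball_mem_nhds ζ one_pos,
    h.memLp_ball_of_besovSeminorm_lt_top f.measurable hf ζ 1⟩, hf⟩⟩

theorem TraceSetting.add_mem_besovSpace (h : TraceSetting p θ μ ν) {f g : boundary Ω →ₘ[ν] ℝ}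
    (hf : f ∈ besovSpace α p ν) (hg : g ∈ besovSpace α p ν) : f + g ∈ besovSpace α p ν := by
  rw [h.mem_besovSpace_iff, besovSeminorm_congr_ae (AEEqFun.coeFn_add f g)]
  exact h.besovSeminorm_add_lt_top f.measurable hf.2 hg.2

theorem TraceSetting.smul_mem_besovSpace (h : TraceSetting p θ μ ν) {f : boundary Ω →ₘ[ν] ℝ}
    (c : ℝ) (hf : f ∈ besovSpace α p ν) : c • f ∈ besovSpace α p ν := by
  rw [h.mem_besovSpace_iff, besovSeminorm_congr_ae (AEEqFun.coeFn_smul c f)]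
  exact (besovSeminorm_const_mul h.pos_p c f).trans_lt (ENNReal.mul_lt_top enorm_lt_top hf.2)

theorem TraceSetting.extend_add (h : TraceSetting p θ μ ν) (W : WhitneyPartition Ω)
    {f g : boundary Ω →ₘ[ν] ℝ} (hf : f ∈ besovSpace α p ν) (hg : g ∈ besovSpace α p ν) :
    W.extend ν (f + g : boundary Ω →ₘ[ν] ℝ) = W.extend ν f + W.extend ν g := by
  funext y
  have havg : ∀ ζ R, ⨍ ξ in Metric.ball ζ R, (f + g : boundary Ω →ₘ[ν] ℝ) ξ ∂ν =
      ⨍ ξ in Metric.ball ζ R, f ξ ∂ν + ⨍ ξ in Metric.ball ζ R, g ξ ∂ν := fun ζ R => by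
    rw [average_congr (ae_restrict_of_ae (AEEqFun.coeFn_add f g))]
    simp_rw [setAverage_eq, Pi.add_apply]
    rw [integral_add (h.integrableOn_of_besovSeminorm_lt_top f.measurable hf.2 ζ R)
      (h.integrableOn_of_besovSeminorm_lt_top g.measurable hg.2 ζ R), smul_add]
  simp_rw [WhitneyPartition.extend, havg]
  exact W.finsum_mul_φ_add _ _ y

theorem WhitneyPartition.extend_smul (W : WhitneyPartition Ω) (c : ℝ) (f : boundary Ω →ₘ[ν] ℝ) :
    W.extend ν (c • f : boundary Ω →ₘ[ν] ℝ) = c • W.extend ν f := by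
  funext y
  have havg : ∀ ζ R, ⨍ ξ in Metric.ball ζ R, (c • f : boundary Ω →ₘ[ν] ℝ) ξ ∂ν =
      c * ⨍ ξ in Metric.ball ζ R, f ξ ∂ν := fun ζ R => by
    rw [average_congr (ae_restrict_of_ae (AEEqFun.coeFn_smul c f))]
    simp_rw [setAverage_eq, Pi.smul_apply, integral_smul, smul_eq_mul]
    ring
  simp_rw [WhitneyPartition.extend, havg]
  exact W.finsum_mul_φ_smul _ _ y

/-- Near a boundary point, on corkscrew balls, the extension is close to the boundary value. -/
theorem TraceSetting.exists_enorm_extend_sub_le (h : TraceSetting p θ μ ν) (W : WhitneyPartition Ω)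
    {c : ℝ} (hc : 0 < c) :
    ∃ K : ℝ≥0, ∀ f : boundary Ω → ℝ, Measurable f → (∀ ζ R, IntegrableOn f (Metric.ball ζ R) ν) →
      ∀ (ζ : boundary Ω) (s : ℝ) (y : Ω), 0 < s → dist (y : UniformSpace.Completion Ω) ζ < 2 * s →
        c * s ≤ bdryDist y →
        ‖W.extend ν f y - f ζ‖ₑ ≤ K * ballOsc p ν f (16 * s) ζ ^ (1 / p) := by
  -- The balls active at `y` satisfy `c * s ≤ 8 * whitneyRadius y ≤ 10 * whitneyRadius x`, so the
  -- total reach, at most `40 * s`, is at most `400 / c` times `whitneyRadius x`.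
  obtain ⟨K, hK⟩ := h.codim.bball_le h.doubling h.pos (400 / c)
  refine ⟨K, fun f hf hint ζ s y hs hy hcs => W.enorm_finsum_mul_φ_sub_le fun x hx => ?_⟩
  obtain ⟨h1, h2⟩ := whitneyRadius_bounds hx
  have h3 : bdryDist y = 8 * whitneyRadius y := by rw [whitneyRadius]; ring
  have h4 := bdryDist_le y ζ
  have h5 : dist ((x : Ω) : UniformSpace.Completion Ω) (W.nearest x) =
      8 * whitneyRadius (x : Ω) := by
    rw [W.dist_nearest, whitneyRadius]; ring
  have h6 : dist (W.nearest x : UniformSpace.Completion Ω) ζ ≤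
      dist (W.nearest x : UniformSpace.Completion Ω) (x : Ω) + dist (x : Ω) y +
        dist (y : UniformSpace.Completion Ω) ζ := by
    rw [← UniformSpace.Completion.dist_eq (x : Ω) y]
    exact dist_triangle4 (W.nearest x : UniformSpace.Completion Ω) (x : Ω) y ζ
  rw [dist_comm (W.nearest x : UniformSpace.Completion Ω) (x : Ω), h5, dist_comm (x : Ω) y] at h6
  have hx0 := whitneyRadius_pos h.nonempty (x : Ω)
  have hs16 : 0 < 16 * s := by linarith
  have hν := hK (W.nearest x) ζ (whitneyRadius (x : Ω)) (16 * s) hx0 (by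
    have h7 : c * s ≤ 10 * whitneyRadius (x : Ω) := by linarith
    have h8 : s ≤ 10 / c * whitneyRadius (x : Ω) := by
      rw [div_mul_eq_mul_div, le_div_iff₀ hc]; linarith
    calc _ ≤ 40 * s := by linarith
      _ ≤ 40 * (10 / c * whitneyRadius (x : Ω)) := by linarith
      _ = _ := by ring)
  rw [bball_coe] at hν
  have hsub : Metric.ball (W.nearest x) (whitneyRadius (x : Ω)) ⊆ Metric.ball ζ (16 * s) := by
    refine Metric.ball_subset_ball' ?_
    rw [Subtype.dist_eq]
    linarith
  refine (enorm_setAverage_sub_le_mul (hint ζ _) hsub hν (h.ball_ne_zero ζ hs16)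
    (h.ball_ne_top ζ _) (f ζ)).trans (mul_le_mul' le_rfl ?_)
  refine (setLAverage_le_rpow h.one_le (h.ball_ne_zero ζ hs16) (h.ball_ne_top ζ _)
    (hf.sub_const _).enorm.aemeasurable).trans_eq ?_
  simp_rw [ballOsc, enorm_sub_rev (f ζ)]

/-- The extension has trace `f`. -/
theorem TraceSetting.eq_of_hasTraceAt_extend (h : TraceSetting p θ μ ν) (W : WhitneyPartition Ω)
    {f : boundary Ω → ℝ} (hf : Measurable f) (hfin : besovSeminorm (1 - θ / p) p ν f < ∞)
    {ζ : boundary Ω} (hζ : Tendsto (fun n => ballOsc p ν f ((1 / 2) ^ (n + 1)) ζ) atTop (𝓝 0))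
    {b : ℝ} (hb : HasTraceAt μ (W.extend ν f) ζ b) : b = f ζ := by
  obtain ⟨c, hc, hc1, hcork⟩ := h.uniform.exists_corkscrew h.unbounded
  -- On the ball of radius `c / 2 * s` about a corkscrew point at scale `s`, the distance to the
  -- boundary is still at least `c / 2 * s`.
  obtain ⟨K, hK⟩ := h.exists_enorm_extend_sub_le W (half_pos hc)
  obtain ⟨K₂, hK₂⟩ := h.doubling.iball_le (6 / c)
  have hE := h.extend_mem_dirichletSpace W hf hfin
  -- The shift by `5` makes `16 * (1 / 2) ^ (n + 5)` equal to the radius `(1 / 2) ^ (n + 1)` at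
  -- which the oscillation is known to vanish in the limit.
  have hs : ∀ n : ℕ, (0 : ℝ) < (1 / 2) ^ (n + 5) := fun n => by positivity
  choose x hxζ hxc using fun n : ℕ => hcork ζ _ (hs n)
  let A : ℕ → Set Ω := fun n => iball (x n) (c / 2 * (1 / 2) ^ (n + 5))
  have hcs : ∀ n : ℕ, 0 < c / 2 * (1 / 2) ^ (n + 5) := fun n => by positivity
  have hcs1 : ∀ n : ℕ, c / 2 * (1 / 2) ^ (n + 5) ≤ (1 / 2) ^ (n + 5) := fun n => by
    nlinarith [hs n]
  have hA : ∀ n, A n ⊆ iball ζ (2 * (1 / 2) ^ (n + 5)) := fun n =>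
    iball_subset (by linarith [hxζ n, hcs1 n])
  have hmean : Tendsto (fun n => ⨍ y in A n, W.extend ν f y ∂μ) atTop (𝓝 b) := by
    refine hb.tendsto_average (K := K₂) h.doubling (h.integrableOn_iball hE _)
      (fun n => mul_pos two_pos (hs n)) ?_ hA fun n => hK₂ _ _ _ _ (hcs n) ?_
    · have h1 := (tendsto_pow_atTop_nhds_zero_of_lt_one (r := (1 / 2 : ℝ)) (by norm_num)
        (by norm_num)).comp (tendsto_add_atTop_nat 5)
      simpa using h1.const_mul 2
    · calc _ ≤ 3 * (1 / 2 : ℝ) ^ (n + 5) := by linarith [hxζ n]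
        _ = _ := by field_simp; norm_num
  have hmean' : Tendsto (fun n => ⨍ y in A n, W.extend ν f y ∂μ) atTop (𝓝 (f ζ)) := by
    rw [tendsto_iff_edist_tendsto_0]
    have hlim : Tendsto (fun n => (K : ℝ≥0∞) * ballOsc p ν f ((1 / 2) ^ (n + 1)) ζ ^ (1 / p))
        atTop (𝓝 0) := by
      have h1 := (ENNReal.continuous_rpow_const (y := 1 / p)).tendsto 0 |>.comp hζ
      rw [ENNReal.zero_rpow_of_pos (one_div_pos.2 h.pos_p)] at h1
      simpa using ENNReal.Tendsto.const_mul (a := (K : ℝ≥0∞)) h1 (Or.inr ENNReal.coe_ne_top)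
    refine tendsto_of_tendsto_of_tendsto_of_le_of_le tendsto_const_nhds hlim (fun _ => zero_le)
      fun n => ?_
    have hA0 : μ (A n) ≠ 0 := (h.doubling.iball_pos _ (hcs n)).ne'
    have hAt : μ (A n) ≠ ∞ := (h.doubling.iball_lt_top _ _).ne
    dsimp only
    rw [edist_eq_enorm_sub]
    refine (enorm_setAverage_sub_le (h.integrableOn_iball hE _ _) hA0 hAt _).trans ?_
    refine le_trans ?_ (setLAverage_const_enorm hA0 hAt _).le
    rw [setLAverage_eq, setLAverage_eq]
    gcongr ?_ / _
    refine setLIntegral_mono' (measurableSet_iball _ _) fun y hy => ?_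
    have hpow : (16 : ℝ) * (1 / 2) ^ (n + 5) = (1 / 2) ^ (n + 1) := by
      rw [show n + 5 = n + 1 + 4 by ring, pow_add _ (n + 1) 4]; ring
    rw [← hpow]
    refine hK f hf (h.integrableOn_of_besovSeminorm_lt_top hf hfin) ζ _ y (hs n) (hA n hy) ?_
    have hyx : dist (y : UniformSpace.Completion Ω) (x n) < c / 2 * (1 / 2) ^ (n + 5) := hy
    rw [UniformSpace.Completion.dist_eq, dist_comm] at hyx
    linarith [bdryDist_le_add (x n) y, hxc n]
  exact tendsto_nhds_unique hmean hmean'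

end Extension

/-! ### The trace and extension operators. -/

section Operators

variable {Ω : Type*} [MetricSpace Ω] [LocallyCompactSpace Ω] [MeasurableSpace Ω] [BorelSpace Ω]
  [MeasurableSpace (boundary Ω)] [BorelSpace (boundary Ω)]
  {μ : Measure Ω} {ν : Measure (boundary Ω)} {p θ : ℝ}

/-- An operator that computes the trace of every Dirichlet function is bounded and linear. -/
theorem TraceSetting.isBoundedLinear_trace (h : TraceSetting p θ μ ν)
    {T : (Ω → ℝ) → (boundary Ω →ₘ[ν] ℝ)}
    (hT : ∀ u ∈ dirichletSpace p μ, ∀ᵐ ζ ∂ν, HasTraceAt μ u ζ (T u ζ)) :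
    IsBoundedLinear (dirichletSpace p μ) (dirichletSeminorm p μ)
      (besovSpace (1 - θ / p) p ν) (fun f => besovSeminorm (1 - θ / p) p ν f) T := by
  obtain ⟨C, hC⟩ := h.besovSeminorm_trace_le
  refine ⟨fun u hu => ?_, fun u hu v hv => ?_, fun c u hu => ?_, C, fun u hu => hC u hu _ (hT u hu)⟩
  · rw [h.mem_besovSpace_iff]
    exact (hC u hu _ (hT u hu)).trans_lt (ENNReal.mul_lt_top ENNReal.coe_lt_top hu.2)
  -- Additivity comes from uniqueness: a.e. both sides are traces of the same function at the same
  -- point.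
  · have huv := add_mem_dirichletSpace h.one_le hu hv
    refine ⟨huv, AEEqFun.ext ?_⟩
    filter_upwards [hT u hu, hT v hv, hT _ huv, AEEqFun.coeFn_add (T u) (T v)] with ζ h1 h2 h3 h4
    rw [h4]
    exact h3.unique h.doubling (h.integrableOn_iball huv _) (h1.add hu.1 h2)
  · have hcu := smul_mem_dirichletSpace h.one_le c hu
    refine ⟨hcu, AEEqFun.ext ?_⟩
    filter_upwards [hT u hu, hT _ hcu, AEEqFun.coeFn_smul c (T u)] with ζ h1 h2 h3
    rw [h3]
    exact h2.unique h.doubling (h.integrableOn_iball hcu _) (h1.const_smul c)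

/-- The extension operator is bounded and linear. -/
theorem TraceSetting.isBoundedLinear_extend (h : TraceSetting p θ μ ν) (W : WhitneyPartition Ω) :
    IsBoundedLinear (besovSpace (1 - θ / p) p ν) (fun f => besovSeminorm (1 - θ / p) p ν f)
      (dirichletSpace p μ) (dirichletSeminorm p μ) fun f : boundary Ω →ₘ[ν] ℝ => W.extend ν f := by
  obtain ⟨C, hC⟩ := h.dirichletSeminorm_extend_le W
  exact ⟨fun f hf => h.extend_mem_dirichletSpace W f.measurable hf.2,
    fun f hf g hg => ⟨h.add_mem_besovSpace hf hg, h.extend_add W hf hg⟩,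
    fun c f hf => ⟨h.smul_mem_besovSpace c hf, W.extend_smul c f⟩,
    C, fun f hf => hC f f.measurable hf.2⟩

/-- The trace of the extension is the original function. -/
theorem TraceSetting.trace_extend (h : TraceSetting p θ μ ν) (W : WhitneyPartition Ω)
    {f g : boundary Ω →ₘ[ν] ℝ} (hf : f ∈ besovSpace (1 - θ / p) p ν)
    (hg : ∀ᵐ ζ ∂ν, HasTraceAt μ (W.extend ν f) ζ (g ζ)) : g = f := by
  have hα : 0 < 1 - θ / p := by
    rw [sub_pos, div_lt_one h.pos_p]; exact h.lt
  refine AEEqFun.ext ?_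
  filter_upwards [hg, h.ae_tendsto_ballOsc f.measurable hα hf.2] with ζ h1 h2
  exact h.eq_of_hasTraceAt_extend W f.measurable hf.2 h2 h1

end Operators

end MetricTrace

theorem theorem1p1 {Ω : Type*} [MetricSpace Ω] [LocallyCompactSpace Ω]
    [MeasurableSpace Ω] [BorelSpace Ω] (μ : Measure Ω)
    (hΩ_unbounded : ¬ Bornology.IsBounded (univ : Set Ω))
    (hΩ_noncomplete : ¬ CompleteSpace Ω)
    (hμ : IsDoubling μ)
    (p θ : ℝ) (hp : 1 ≤ p) (hPoincare : SupportsPoincare p μ)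
    (hΩ_uniform : IsUniformDomain Ω)
    (hbdry_unbounded : ¬ Bornology.IsBounded (boundary Ω))
    [MeasurableSpace (boundary Ω)] [BorelSpace (boundary Ω)]
    (ν : Measure (boundary Ω)) [NullSingletonClass ν]
    (hθ : 0 < θ) (hθp : θ < p) (hcodim : IsCodimensional θ μ ν) :
    ∃ (T : (Ω → ℝ) → (boundary Ω →ₘ[ν] ℝ)) (E : (boundary Ω →ₘ[ν] ℝ) → (Ω → ℝ)),
      IsBoundedLinear (dirichletSpace p μ) (dirichletSeminorm p μ)
        (besovSpace (1 - θ / p) p ν) (fun f => besovSeminorm (1 - θ / p) p ν f) T ∧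
      (∀ u ∈ dirichletSpace p μ, ∀ᵐ ζ ∂ν,
        Tendsto (fun r : ℝ => ⨍⁻ x in innerBall ζ r, ‖u x - T u ζ‖ₑ ∂μ) (𝓝[>] 0) (𝓝 0)) ∧
      IsBoundedLinear (besovSpace (1 - θ / p) p ν) (fun f => besovSeminorm (1 - θ / p) p ν f)
        (dirichletSpace p μ) (dirichletSeminorm p μ) E ∧
      (∃ W : WhitneyPartition Ω, ∀ f ∈ besovSpace (1 - θ / p) p ν, E f = W.extend ν f) ∧
      (∀ f ∈ besovSpace (1 - θ / p) p ν, T (E f) = f) := by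
  classical
  have h : TraceSetting p θ μ ν :=
    ⟨hΩ_unbounded, hμ, hp, hPoincare, hΩ_uniform, boundary_nonempty hbdry_unbounded, hθ, hθp,
      hcodim⟩
  obtain ⟨W⟩ := exists_whitneyPartition hμ h.nonempty
  -- The trace is chosen separately for each function, with value `0` off the Dirichlet space;
  -- linearity needs no coherent choice because traces are a.e. unique.
  have htrace : ∀ u : Ω → ℝ, ∃ f : boundary Ω →ₘ[ν] ℝ,
      u ∈ dirichletSpace p μ → ∀ᵐ ζ ∂ν, HasTraceAt μ u ζ (f ζ) := fun u => by
    by_cases hu : u ∈ dirichletSpace p μ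
    · exact (h.exists_trace hu).imp fun f hf _ => hf
    · exact ⟨0, fun hu' => absurd hu' hu⟩
  choose T hT using htrace
  exact ⟨T, fun f => W.extend ν f, h.isBoundedLinear_trace hT, hT, h.isBoundedLinear_extend W,
    ⟨W, fun _ _ => rfl⟩,
    fun f hf => h.trace_extend W hf (hT _ ((h.isBoundedLinear_extend W).mapsTo hf))⟩
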